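/- Let $N\ge 2$ and $1\le k\le N-1$ be integers, $p>1$, $\beta\in\mathbb R\setminus\{0\}$ and $\omega>\frac{p+1}{p-1}\frac{N^2}{\beta^2}$. Let $\Gamma$ be the star graph with $N$ half-lines $(0,\infty)$, $L^2(\Gamma)=\bigoplus_{j=1}^N L^2(0,\infty)$ and $H^2(\Gamma)=\bigoplus_{j=1}^N H^2(0,\infty)$ (real-valued functions, or complex-valued ones; the result holds in both cases), and let $-\Delta_\beta$ be the operator $(-\Delta_\beta v)_j=-v_j''$ in $L^2(\Gamma)$ with domain $$\operatorname{dom}(\Delta_\beta)=\Big\{v\in H^2(\Gamma):\ v_1'(0)=\dots=v_N'(0),\ \sum_{j=1}^N v_j(0)=\beta v_1'(0)\Big\}.$$ For $a\in\mathbb R$ put $\phi_a(x)=\Big\{\tfrac{(p+1)\omega}{2}\operatorname{sech}^2\Big(\tfrac{(p-1)\sqrt\omega}{2}(x+a)\Big)\Big\}^{\frac1{p-1}}$. Let $0<t_1<t_N<1$ satisfy $$t_1^{p-1}-t_1^{p+1}=t_N^{p-1}-t_N^{p+1},\qquad k\,t_1^{-1}+(N-k)\,t_N^{-1}=|\beta|\sqrt\omega,$$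 let $x_i=-\operatorname{sign}(\beta)\frac{2}{(p-1)\sqrt\omega}\tanh^{-1}(t_i)$ for $i\in\{1,N\}$, and let $\phi_k=(\phi_{x_1},\dots,\phi_{x_1},\phi_{x_N},\dots,\phi_{x_N})$, with $k$ entries $\phi_{x_1}$ followed by $N-k$ entries $\phi_{x_N}$. Consider in $L^2(\Gamma)$ the operators $$L_1^{\phi_k}v=-\Delta_\beta v+\omega v-p\,\phi_k^{p-1}v,\qquad L_2^{\phi_k}v=-\Delta_\beta v+\omega v-\phi_k^{p-1}v,\qquad \operatorname{dom}(L_j^{\phi_k})=\operatorname{dom}(\Delta_\beta),$$ and write $n(L)$ for the number of negative eigenvalues of $L$, counted with multiplicity. Then: (i) if $\beta>0$, then $n(L_2^{\phi_k})\le N-1$ and $n(L_1^{\phi_k})\ge 2N-k-3$; (ii) if $\beta<0$, then $L_2^{\phi_k}\ge 0$ and $n(L_1^{\phi_k})\ge k$. -/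

import Mathlib

open MeasureTheory Set Filter Topology

noncomputable section

namespace StarGraph

/-- `L²(ℝ⁺; 𝕜)`, where `𝕜` is `ℝ` or `ℂ`. -/
abbrev L2Half (𝕜 : Type*) [RCLike 𝕜] : Type _ :=
  Lp 𝕜 2 (volume.restrict (Ioi (0 : ℝ)))

/-- `L²(Γ)`, the Hilbert space direct sum of `N` copies of `L²(ℝ⁺)`. -/
abbrev L2Graph (𝕜 : Type*) [RCLike 𝕜] (N : ℕ) : Type _ :=
  PiLp 2 (fun _ : Fin N => L2Half 𝕜)

/-- `g` is the weak derivative of `f` on the open half-line `(0, ∞)`. Hence `f ∈ H¹(ℝ⁺)` iff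
such a `g ∈ L²(ℝ⁺)` exists, and `f ∈ H²(ℝ⁺)` iff moreover `g` has a weak derivative in `L²(ℝ⁺)`. -/
def IsWeakDeriv {𝕜 : Type*} [RCLike 𝕜] (f g : L2Half 𝕜) : Prop :=
  ∀ ψ : ℝ → ℝ, ContDiff ℝ (⊤ : ℕ∞) ψ → HasCompactSupport ψ → tsupport ψ ⊆ Ioi (0 : ℝ) →
    ∫ x in Ioi (0 : ℝ), deriv ψ x • f x = - ∫ x in Ioi (0 : ℝ), ψ x • g x

/-- `z` is the boundary value `f(0) = lim_{x → 0+} f(x)` of the continuous representative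
of `f`. -/
def HasTrace {𝕜 : Type*} [RCLike 𝕜] (f : L2Half 𝕜) (z : 𝕜) : Prop :=
  ∃ F : ℝ → 𝕜, F =ᵐ[volume.restrict (Ioi (0 : ℝ))] f ∧ ContinuousOn F (Ioi 0) ∧
    Tendsto F (𝓝[>] 0) (𝓝 z)

/-- `v ∈ dom(Δ_β)` with first and second weak derivatives `g = v'` and `h = v''`:
`v ∈ H²(Γ)`, `v₁'(0) = … = v_N'(0)` and `∑ v_j(0) = β v₁'(0)`. -/
def InDomain {𝕜 : Type*} [RCLike 𝕜] (N : ℕ) (β : ℝ) (v g h : L2Graph 𝕜 N) : Prop :=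
  (∀ j, IsWeakDeriv (v j) (g j) ∧ IsWeakDeriv (g j) (h j)) ∧
    ∃ (z : Fin N → 𝕜) (d : 𝕜), (∀ j, HasTrace (v j) (z j)) ∧ (∀ j, HasTrace (g j) d) ∧
      ∑ j, z j = (β : 𝕜) * d

section Helpers

variable {𝕜 : Type*} [RCLike 𝕜]

lemma integrableOn_smul_of_test (f : L2Half 𝕜) {ψ : ℝ → ℝ} (hψ : Continuous ψ)
    (hc : HasCompactSupport ψ) :
    Integrable (fun x => ψ x • f x) (volume.restrict (Ioi (0 : ℝ))) := by
  have h1 : MemLp ψ 2 (volume.restrict (Ioi (0 : ℝ))) :=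
    (hψ.memLp_of_hasCompactSupport hc).restrict _
  have h2 : MemLp (ψ • (f : ℝ → 𝕜)) 1 (volume.restrict (Ioi (0 : ℝ))) := (Lp.memLp f).smul h1
  exact memLp_one_iff_integrable.1 h2

lemma isWeakDeriv_zero : IsWeakDeriv (0 : L2Half 𝕜) 0 := by
  intro ψ _ _ _
  have h0 := Lp.coeFn_zero 𝕜 2 (volume.restrict (Ioi (0 : ℝ)))
  have e : ∀ χ : ℝ → ℝ, ∫ x in Ioi (0 : ℝ), χ x • (0 : L2Half 𝕜) x = 0 := by
    intro χ
    rw [integral_congr_ae (g := fun _ => (0 : 𝕜))]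
    · simp
    · filter_upwards [h0] with x hx
      rw [hx, Pi.zero_apply, smul_zero]
  rw [e, e, neg_zero]

lemma IsWeakDeriv.add {f g f' g' : L2Half 𝕜} (h : IsWeakDeriv f g) (h' : IsWeakDeriv f' g') :
    IsWeakDeriv (f + f') (g + g') := by
  have e : ∀ (a b : L2Half 𝕜) (χ : ℝ → ℝ), Continuous χ → HasCompactSupport χ →
      ∫ x in Ioi (0 : ℝ), χ x • (a + b : L2Half 𝕜) x
        = (∫ x in Ioi (0 : ℝ), χ x • a x) + ∫ x in Ioi (0 : ℝ), χ x • b x := by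
    intro a b χ h1 h2
    rw [← integral_add (integrableOn_smul_of_test a h1 h2) (integrableOn_smul_of_test b h1 h2)]
    refine integral_congr_ae ?_
    filter_upwards [Lp.coeFn_add a b] with x hx
    rw [hx, Pi.add_apply, smul_add]
  intro ψ h1 h2 h3
  rw [e f f' _ (h1.continuous_deriv (by simp)) h2.deriv, e g g' _ h1.continuous h2,
    h ψ h1 h2 h3, h' ψ h1 h2 h3, neg_add]

lemma IsWeakDeriv.smul {f g : L2Half 𝕜} (c : 𝕜) (h : IsWeakDeriv f g) :
    IsWeakDeriv (c • f) (c • g) := by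
  have e : ∀ (a : L2Half 𝕜) (χ : ℝ → ℝ), ∫ x in Ioi (0 : ℝ), χ x • (c • a : L2Half 𝕜) x
        = c • ∫ x in Ioi (0 : ℝ), χ x • a x := by
    intro a χ
    rw [← integral_smul]
    refine integral_congr_ae ?_
    filter_upwards [Lp.coeFn_smul c a] with x hx
    simp only [hx, Pi.smul_apply]
    rw [smul_comm]
  intro ψ h1 h2 h3
  rw [e, e, h ψ h1 h2 h3, smul_neg]

/-- The weak derivative is unique. -/
lemma IsWeakDeriv.eq_zero {g : L2Half 𝕜} (h : IsWeakDeriv 0 g) : g = 0 := by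
  have key : ∀ᵐ x ∂(volume : Measure ℝ), x ∈ Ioi (0 : ℝ) → g x = 0 := by
    refine isOpen_Ioi.ae_eq_zero_of_integral_contDiff_smul_eq_zero ?_ ?_
    · exact (locallyIntegrableOn_of_locallyIntegrable_restrict
        ((Lp.memLp g).locallyIntegrable (by norm_num)))
    · intro ψ h1 h2 h3
      have e := h ψ h1 h2 h3
      have e0 : ∫ x in Ioi (0 : ℝ), deriv ψ x • (0 : L2Half 𝕜) x = 0 := by
        rw [integral_congr_ae (g := fun _ => (0 : 𝕜))]
        · simp
        · filter_upwards [Lp.coeFn_zero 𝕜 2 (volume.restrict (Ioi (0 : ℝ)))] with x hx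
          rw [hx, Pi.zero_apply, smul_zero]
      rw [e0, eq_comm, neg_eq_zero] at e
      rw [← e, setIntegral_eq_integral_of_forall_compl_eq_zero]
      intro x hx
      have : ψ x = 0 := image_eq_zero_of_notMem_tsupport (fun hx' => hx (h3 hx'))
      simp [this]
  refine Lp.ext ?_
  filter_upwards [(ae_restrict_iff' measurableSet_Ioi).2 key,
    Lp.coeFn_zero 𝕜 2 (volume.restrict (Ioi (0 : ℝ)))] with x hx hx0
  rw [hx, hx0, Pi.zero_apply]

lemma hasTrace_zero : HasTrace (0 : L2Half 𝕜) 0 :=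
  ⟨fun _ => 0, (Lp.coeFn_zero 𝕜 2 _).symm, continuousOn_const, tendsto_const_nhds⟩

lemma HasTrace.add {f f' : L2Half 𝕜} {z z' : 𝕜} (h : HasTrace f z) (h' : HasTrace f' z') :
    HasTrace (f + f') (z + z') := by
  obtain ⟨F, h1, h2, h3⟩ := h
  obtain ⟨F', h1', h2', h3'⟩ := h'
  exact ⟨F + F', (h1.add h1').trans (Lp.coeFn_add f f').symm, h2.add h2', h3.add h3'⟩

lemma HasTrace.smul {f : L2Half 𝕜} {z : 𝕜} (c : 𝕜) (h : HasTrace f z) :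
    HasTrace (c • f) (c * z) := by
  obtain ⟨F, h1, h2, h3⟩ := h
  exact ⟨c • F, (h1.const_smul c).trans (Lp.coeFn_smul c f).symm, h2.const_smul c,
    h3.const_mul c⟩

lemma inDomain_zero (N : ℕ) (β : ℝ) : InDomain N β (0 : L2Graph 𝕜 N) 0 0 :=
  ⟨fun _ => ⟨isWeakDeriv_zero, isWeakDeriv_zero⟩, 0, 0, fun _ => hasTrace_zero,
    fun _ => hasTrace_zero, by simp⟩

lemma InDomain.add {N : ℕ} {β : ℝ} {v g h v' g' h' : L2Graph 𝕜 N} (H : InDomain N β v g h)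
    (H' : InDomain N β v' g' h') : InDomain N β (v + v') (g + g') (h + h') := by
  obtain ⟨h1, z, d, h2, h3, h4⟩ := H
  obtain ⟨h1', z', d', h2', h3', h4'⟩ := H'
  refine ⟨fun j => ⟨(h1 j).1.add (h1' j).1, (h1 j).2.add (h1' j).2⟩, z + z', d + d',
    fun j => (h2 j).add (h2' j), fun j => (h3 j).add (h3' j), ?_⟩
  simp only [Pi.add_apply, Finset.sum_add_distrib, h4, h4']
  ring

lemma InDomain.smul {N : ℕ} {β : ℝ} {v g h : L2Graph 𝕜 N} (c : 𝕜) (H : InDomain N β v g h) :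
    InDomain N β (c • v) (c • g) (c • h) := by
  obtain ⟨h1, z, d, h2, h3, h4⟩ := H
  refine ⟨fun j => ⟨(h1 j).1.smul c, (h1 j).2.smul c⟩, fun j => c * z j, c * d,
    fun j => (h2 j).smul c, fun j => (h3 j).smul c, ?_⟩
  rw [← Finset.mul_sum, h4]
  ring

end Helpers

/-- The graph of the Schrödinger operator `-Δ_β + ω - V` on `Γ`: the pairs `(v, w)` such that
`v ∈ dom(Δ_β)` and `w_j = -v_j'' + ω v_j - V_j v_j` almost everywhere on every edge. -/
def schrodingerGraph (𝕜 : Type*) [RCLike 𝕜] (N : ℕ) (β ω : ℝ) (V : Fin N → ℝ → ℝ) :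
    Submodule 𝕜 (L2Graph 𝕜 N × L2Graph 𝕜 N) where
  carrier := {vw | ∃ g h : L2Graph 𝕜 N, InDomain N β vw.1 g h ∧
    ∀ j, ∀ᵐ x ∂(volume.restrict (Ioi (0 : ℝ))),
      vw.2 j x = - h j x + (ω : 𝕜) * vw.1 j x - (V j x : 𝕜) * vw.1 j x}
  add_mem' := by
    rintro ⟨v, w⟩ ⟨v', w'⟩ ⟨g, h, H, e⟩ ⟨g', h', H', e'⟩
    refine ⟨g + g', h + h', H.add H', fun j => ?_⟩
    filter_upwards [e j, e' j, Lp.coeFn_add (v j) (v' j), Lp.coeFn_add (w j) (w' j),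
      Lp.coeFn_add (h j) (h' j)] with x h1 h2 h3 h4 h5
    simp only [Prod.fst_add, Prod.snd_add, PiLp.add_apply] at *
    rw [h3, h4, h5, Pi.add_apply, Pi.add_apply, Pi.add_apply, h1, h2]
    ring
  zero_mem' := by
    refine ⟨0, 0, inDomain_zero N β, fun j => ?_⟩
    filter_upwards [Lp.coeFn_zero 𝕜 2 (volume.restrict (Ioi (0 : ℝ)))] with x hx
    change (0 : L2Half 𝕜) x
      = - (0 : L2Half 𝕜) x + (ω : 𝕜) * (0 : L2Half 𝕜) x - (V j x : 𝕜) * (0 : L2Half 𝕜) x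
    rw [hx, Pi.zero_apply]
    ring
  smul_mem' := by
    rintro c ⟨v, w⟩ ⟨g, h, H, e⟩
    refine ⟨c • g, c • h, H.smul c, fun j => ?_⟩
    filter_upwards [e j, Lp.coeFn_smul c (v j), Lp.coeFn_smul c (w j),
      Lp.coeFn_smul c (h j)] with x h1 h2 h3 h4
    simp only [Prod.smul_fst, Prod.smul_snd, PiLp.smul_apply] at *
    rw [h2, h3, h4, Pi.smul_apply, Pi.smul_apply, Pi.smul_apply, h1]
    simp only [smul_eq_mul]
    ring

/-- The unbounded operator `-Δ_β + ω - V` in `L²(Γ)`. For bounded measurable `V` its domain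
is `dom(Δ_β)`. -/
def schrodinger (𝕜 : Type*) [RCLike 𝕜] (N : ℕ) (β ω : ℝ) (V : Fin N → ℝ → ℝ) :
    L2Graph 𝕜 N →ₗ.[𝕜] L2Graph 𝕜 N :=
  (schrodingerGraph 𝕜 N β ω V).toLinearPMap

/-- The operator is well defined: its graph is the set of pairs described above. -/
lemma schrodinger_graph (𝕜 : Type*) [RCLike 𝕜] (N : ℕ) (β ω : ℝ) (V : Fin N → ℝ → ℝ) :
    (schrodinger 𝕜 N β ω V).graph = schrodingerGraph 𝕜 N β ω V := by
  refine Submodule.toLinearPMap_graph_eq _ ?_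
  rintro ⟨v, w⟩ ⟨g, h, ⟨H, -⟩, e⟩ hv
  simp only at hv H e
  subst hv
  ext j : 1
  have hg : g j = 0 := (H j).1.eq_zero
  have hh : h j = 0 := by
    have := (H j).2
    rw [hg] at this
    exact this.eq_zero
  refine Lp.ext ?_
  filter_upwards [e j, Lp.coeFn_zero 𝕜 2 (volume.restrict (Ioi (0 : ℝ)))] with x h1 h2
  change w j x = (0 : L2Half 𝕜) x
  rw [h1, hh]
  change - (0 : L2Half 𝕜) x + (ω : 𝕜) * (0 : L2Half 𝕜) x - (V j x : 𝕜) * (0 : L2Half 𝕜) x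
    = (0 : L2Half 𝕜) x
  rw [h2, Pi.zero_apply]
  ring

section Index

variable {𝕜 E : Type*} [RCLike 𝕜] [NormedAddCommGroup E] [InnerProductSpace 𝕜 E]

/-- The eigenspace `ker(L - l)` of an unbounded operator `L`, for a real number `l`. -/
def eigenspace (L : E →ₗ.[𝕜] E) (l : ℝ) : Submodule 𝕜 E where
  carrier := {v | ∃ hv : v ∈ L.domain, L ⟨v, hv⟩ = (l : 𝕜) • v}
  add_mem' := by
    rintro v w ⟨hv, ev⟩ ⟨hw, ew⟩
    refine ⟨L.domain.add_mem hv hw, ?_⟩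
    rw [smul_add, ← ev, ← ew, ← L.map_add]
    rfl
  zero_mem' := ⟨L.domain.zero_mem, by rw [smul_zero]; exact L.map_zero⟩
  smul_mem' := by
    rintro c v ⟨hv, ev⟩
    refine ⟨L.domain.smul_mem c hv, ?_⟩
    rw [smul_comm, ← ev, ← L.map_smul]
    rfl

/-- The Morse index `n(L)` of a self-adjoint operator: the number of its negative eigenvalues
counted with multiplicity, i.e. the sum over `l < 0` of the dimensions of `ker(L - l)`
(it is `⊤` if there are infinitely many). -/
def morseIndex (L : E →ₗ.[𝕜] E) : ℕ∞ :=
  Cardinal.toENat (Cardinal.sum fun l : Iio (0 : ℝ) => Module.rank 𝕜 (eigenspace L l))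

/-- `L ≥ 0` in the sense of quadratic forms. -/
def IsNonneg (L : E →ₗ.[𝕜] E) : Prop :=
  ∀ v : L.domain, 0 ≤ RCLike.re (inner 𝕜 (L v) (v : E))

end Index

/-- The soliton `φ_a(x) = {((p+1)ω/2) sech²(((p-1)√ω/2)(x+a))}^{1/(p-1)}`. -/
def soliton (p ω a x : ℝ) : ℝ :=
  ((p + 1) * ω / 2 * (1 / Real.cosh ((p - 1) * √ω / 2 * (x + a))) ^ 2) ^ (1 / (p - 1))

/-- The system for the parameters `0 < t₁ < t_N < 1` of the profile `φ_k`. -/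
structure IsProfileParam (N k : ℕ) (p ω β t₁ tN : ℝ) : Prop where
  pos : 0 < t₁
  lt : t₁ < tN
  lt_one : tN < 1
  eq : t₁ ^ (p - 1) - t₁ ^ (p + 1) = tN ^ (p - 1) - tN ^ (p + 1)
  sum : k * t₁⁻¹ + (N - k) * tN⁻¹ = |β| * √ω

/-- The translation with `|x| = 2/((p-1)√ω) artanh t`, negative for `β > 0` and positive for
`β < 0`. -/
def shift (p ω β t : ℝ) : ℝ :=
  - Real.sign β * (2 / ((p - 1) * √ω) * Real.artanh t)

/-- The profile `φ_k`: the first `k` entries are `φ_{x₁}`, the other `N - k` are `φ_{x_N}`. -/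
def profile (N k : ℕ) (p ω β t₁ tN : ℝ) (j : Fin N) (x : ℝ) : ℝ :=
  if (j : ℕ) < k then soliton p ω (shift p ω β t₁) x else soliton p ω (shift p ω β tN) x

/-- `L₁ = -Δ_β + ω - p φ^{p-1}` for a profile `φ` on `Γ`. -/
def opL₁ (𝕜 : Type*) [RCLike 𝕜] (N : ℕ) (p ω β : ℝ) (φ : Fin N → ℝ → ℝ) :
    L2Graph 𝕜 N →ₗ.[𝕜] L2Graph 𝕜 N :=
  schrodinger 𝕜 N β ω (fun j x => p * φ j x ^ (p - 1))

/-- `L₂ = -Δ_β + ω - φ^{p-1}` for a profile `φ` on `Γ`. -/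
def opL₂ (𝕜 : Type*) [RCLike 𝕜] (N : ℕ) (p ω β : ℝ) (φ : Fin N → ℝ → ℝ) :
    L2Graph 𝕜 N →ₗ.[𝕜] L2Graph 𝕜 N :=
  schrodinger 𝕜 N β ω (fun j x => φ j x ^ (p - 1))

end StarGraph

end

/-! Put `m = √ω` and `κ = (p - 1) √ω / 2`. Then `φ_a ^ (p - 1) = m (m + κ) sech² (κ (x + a))` and `p
φ_a ^ (p - 1) = (m + κ) (m + 2 κ) sech² (κ (x + a))`. Both operators are thus of Pöschl-Teller type
on every edge, and in their quadratic forms the edges interact only through the vertex term `β⁻¹ |∑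
v_j(0)|²`.

For `L₂`, the logarithmic derivative `-m tanh (κ (x + a))` of the soliton solves a Riccati equation.
Completing the square bounds the energy of an edge from below by `m tanh (κ a_j) |v_j(0)|²`
(`re_graphForm_sechSq_ge`), which leaves a quadratic form in the `N` boundary values. Here `tanh (κ
a_j) = -sign β * t_j` and `∑ t_j⁻¹ = |β| m`. If `β < 0`, a weighted Cauchy-Schwarz inequality makes
this form nonnegative. If `β > 0`, it vanishes as soon as the products `t_j v_j(0)` agree; these are
`N - 1` linear conditions, so at most `N - 1` negative eigenvalues exist (`morseIndex_le`).

For `L₁`, two functions are available on each edge (`exists_edge_modes`): the zero mode `u_j`,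
proportional to the derivative of the soliton, and, if the peak of the soliton is inside the edge, a
function `r_j` of negative energy that vanishes at the vertex. On their span the form is diagonal up
to the vertex term, and `u_j` contributes `-u_j(0) u_j'(0)`. The sign of this number depends on the
side of the critical point of `t ^ (p - 1) - t ^ (p + 1)` on which `t_j` lies, and by Rolle `t₁` and
`t_N` lie on opposite sides. For `β > 0` all the `r_j`, together with the `u_j` on the last `N - k`
edges under the one constraint that the vertex term vanishes, span a negative space. For `β < 0` the
vertex term has a good sign and the `u_j` on the first `k` edges suffice.

Negative spaces of the form yield eigenvectors by successive minimisation of the Rayleigh quotient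
(`IsCompactGarding.exists_orthonormal`). Compactness holds because the potentials decay, and
`mem_eigenspace_of_graphForm` recovers the second derivative and the vertex conditions from the weak
equation. -/

noncomputable section

namespace StarGraph

/-! ### Negative eigenvalues of semibounded forms by minimisation. -/

section Variational

open ComplexConjugate

variable {𝕜 X E : Type*} [RCLike 𝕜] [NormedAddCommGroup X] [NormedSpace 𝕜 X]
  [NormedAddCommGroup E] [InnerProductSpace 𝕜 E]

/-- A Hermitian form `Q` on `X` that is bounded, coercive up to the norm of `j u`, and whose negative
part is relatively compact. -/
structure IsCompactGarding (j : X →L[𝕜] E) (Q : X →ₗ⋆[𝕜] X →ₗ[𝕜] 𝕜) : Prop where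
  symm : ∀ u v, conj (Q u v) = Q v u
  bdd : ∃ C, ∀ u, RCLike.re (Q u u) ≤ C * ‖u‖ ^ 2
  garding : ∃ c > 0, ∃ M, ∀ u, c * ‖u‖ ^ 2 ≤ RCLike.re (Q u u) + M * ‖j u‖ ^ 2
  compact : ∃ c > 0, ∀ u : ℕ → X, (∃ R, ∀ n, ‖u n‖ ≤ R) → ∃ φ : ℕ → ℕ, StrictMono φ ∧
    ∀ ε > 0, ∃ n₀, ∀ n ≥ n₀, ∀ m ≥ n₀, c * ‖u (φ n) - u (φ m)‖ ^ 2 ≤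
      RCLike.re (Q (u (φ n) - u (φ m)) (u (φ n) - u (φ m))) + ε

/-- The pull-back `⟨j u, j v⟩` of the inner product. -/
def gram (j : X →L[𝕜] E) : X →ₗ⋆[𝕜] X →ₗ[𝕜] 𝕜 :=
  LinearMap.mk₂'ₛₗ (starRingEnd 𝕜) (RingHom.id 𝕜) (fun u v => inner 𝕜 (j u) (j v))
    (fun _ _ _ => by rw [map_add, inner_add_left])
    (fun _ _ _ => by rw [map_smul, inner_smul_left]; rfl)
    (fun _ _ _ => by rw [map_add, inner_add_right])
    (fun _ _ _ => by rw [map_smul, inner_smul_right]; rfl)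

@[simp] lemma gram_apply (j : X →L[𝕜] E) (u v : X) : gram j u v = inner 𝕜 (j u) (j v) := rfl

lemma re_gram_self (j : X →L[𝕜] E) (u : X) : RCLike.re (gram j u u) = ‖j u‖ ^ 2 := by
  rw [gram_apply, inner_self_eq_norm_sq]

/-- The rank one form `⟨j u, e⟩ ⟨e, j v⟩`. -/
def rankOneForm (j : X →L[𝕜] E) (e : E) : X →ₗ⋆[𝕜] X →ₗ[𝕜] 𝕜 :=
  LinearMap.mk₂'ₛₗ (starRingEnd 𝕜) (RingHom.id 𝕜) (fun u v => inner 𝕜 (j u) e * inner 𝕜 e (j v))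
    (fun _ _ _ => by rw [map_add, inner_add_left, add_mul])
    (fun _ _ _ => by rw [map_smul, inner_smul_left, mul_assoc]; rfl)
    (fun _ _ _ => by rw [map_add, inner_add_right, mul_add])
    (fun _ _ _ => by rw [map_smul, inner_smul_right, mul_left_comm]; rfl)

@[simp] lemma rankOneForm_apply (j : X →L[𝕜] E) (e : E) (u v : X) :
    rankOneForm j e u v = inner 𝕜 (j u) e * inner 𝕜 e (j v) := rfl

lemma re_rankOneForm_self (j : X →L[𝕜] E) (e : E) (u : X) :
    RCLike.re (rankOneForm j e u u) = ‖inner 𝕜 e (j u)‖ ^ 2 := by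
  rw [rankOneForm_apply, ← inner_conj_symm, RCLike.conj_mul, ← RCLike.ofReal_pow, RCLike.ofReal_re]

lemma form_re_add_smul {S : X →ₗ⋆[𝕜] X →ₗ[𝕜] 𝕜} (hs : ∀ u v, conj (S u v) = S v u)
    (a : 𝕜) (u v : X) : RCLike.re (S (u + a • v) (u + a • v)) =
      RCLike.re (S u u) + 2 * RCLike.re (a * S u v) + ‖a‖ ^ 2 * RCLike.re (S v v) := by
  have h1 : S (u + a • v) (u + a • v) =
      S u u + (a * S u v + conj (a * S u v)) + (conj a * a) * S v v := by
    simp only [map_add, LinearMap.add_apply, map_smul, LinearMap.map_smulₛₗ, LinearMap.smul_apply,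
      smul_eq_mul, map_mul, hs u v]
    ring
  rw [h1, RCLike.conj_mul, RCLike.add_conj, ← RCLike.ofReal_pow, map_add, map_add,
    RCLike.re_ofReal_mul, ← RCLike.ofReal_ofNat, RCLike.re_ofReal_mul, RCLike.ofReal_re]

/-- A null vector minimises the form. If `S u v ≠ 0`, a small step from `u` along `-conj (S u v) •
v` would make the form negative, because the linear term beats the quadratic one. -/
lemma form_eq_zero_of_nonneg {S : X →ₗ⋆[𝕜] X →ₗ[𝕜] 𝕜} (hs : ∀ u v, conj (S u v) = S v u)
    (h0 : ∀ u, 0 ≤ RCLike.re (S u u)) {u : X} (hu : RCLike.re (S u u) = 0) (v : X) :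
    S u v = 0 := by
  set s := S u v with hsdef
  set k := RCLike.re (S v v) with hk
  have hk0 : 0 ≤ k := h0 v
  -- The step size `(k + 1)⁻¹` is short enough for the quadratic term and also covers `k = 0`.
  have h := h0 (u + (-(((k + 1)⁻¹ : ℝ) : 𝕜) * conj s) • v)
  rw [form_re_add_smul hs, hu, ← hsdef, ← hk, mul_assoc, RCLike.conj_mul,
    ← RCLike.ofReal_neg, ← RCLike.ofReal_pow, ← RCLike.ofReal_mul, RCLike.ofReal_re, norm_mul,
    RCLike.norm_conj, RCLike.norm_ofReal, abs_neg, mul_pow, sq_abs] at h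
  have h2 : 0 < (k + 1)⁻¹ := by positivity
  have h3 : (k + 1)⁻¹ * k = 1 - (k + 1)⁻¹ := by field_simp; ring
  have h4 : 0 ≤ -((k + 1)⁻¹ * ‖s‖ ^ 2 * (1 + (k + 1)⁻¹)) := by
    calc (0 : ℝ) ≤ _ := h
      _ = (k + 1)⁻¹ * ‖s‖ ^ 2 * (-2 + (k + 1)⁻¹ * k) := by ring
      _ = _ := by rw [h3]; ring
  by_contra hne
  have : 0 < ‖s‖ := norm_pos_iff.2 hne
  have : 0 < (k + 1)⁻¹ * ‖s‖ ^ 2 * (1 + (k + 1)⁻¹) := by positivity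
  linarith

lemma form_parallelogram (S : X →ₗ⋆[𝕜] X →ₗ[𝕜] 𝕜) (u v : X) :
    RCLike.re (S (u - v) (u - v)) + RCLike.re (S (u + v) (u + v)) =
      2 * RCLike.re (S u u) + 2 * RCLike.re (S v v) := by
  simp only [map_add, map_sub, LinearMap.add_apply, LinearMap.sub_apply]
  ring

/-- A form with compact negative part that is negative somewhere attains the infimum of its
Rayleigh quotient, and so has an eigenvector for a negative eigenvalue. -/
theorem IsCompactGarding.exists_eigenvector [CompleteSpace X] {j : X →L[𝕜] E}
    {Q : X →ₗ⋆[𝕜] X →ₗ[𝕜] 𝕜} (hQ : IsCompactGarding j Q) {w : X} (hw : RCLike.re (Q w w) < 0) :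
    ∃ (u : X) (l : ℝ), l < 0 ∧ ‖j u‖ = 1 ∧ ∀ v, Q u v = (l : 𝕜) * inner 𝕜 (j u) (j v) := by
  obtain ⟨C, hC⟩ := hQ.bdd
  obtain ⟨c, hc, M, hM⟩ := hQ.garding
  obtain ⟨c', hc', hcomp⟩ := hQ.compact
  have hjw : j w ≠ 0 := by
    intro h
    have := hM w
    rw [h, norm_zero] at this
    nlinarith [sq_nonneg ‖w‖]
  have hscale : ∀ (a : ℝ) (u : X), RCLike.re (Q ((a : 𝕜) • u) ((a : 𝕜) • u))
      = a ^ 2 * RCLike.re (Q u u) := by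
    intro a u
    simp only [LinearMap.map_smulₛₗ, LinearMap.smul_apply, smul_eq_mul, RCLike.conj_ofReal,
      RingHom.id_apply, RCLike.re_ofReal_mul]
    ring
  have hnorm : ∀ u, j u ≠ 0 → ‖j (((‖j u‖⁻¹ : ℝ) : 𝕜) • u)‖ = 1 := by
    intro u hu
    rw [map_smul, norm_smul, RCLike.norm_ofReal, abs_of_nonneg (by positivity),
      inv_mul_cancel₀ (norm_ne_zero_iff.2 hu)]
  set A : Set ℝ := {q | ∃ u, ‖j u‖ = 1 ∧ q = RCLike.re (Q u u)} with hA
  have hAbdd : BddBelow A := by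
    refine ⟨-M, ?_⟩
    rintro q ⟨u, hu, rfl⟩
    have := hM u
    rw [hu] at this
    nlinarith [sq_nonneg ‖u‖]
  have hwA : (‖j w‖⁻¹) ^ 2 * RCLike.re (Q w w) ∈ A := ⟨_, hnorm w hjw, (hscale _ _).symm⟩
  set l := sInf A with hl
  have hl0 : l < 0 := by
    refine (csInf_le hAbdd hwA).trans_lt ?_
    have : 0 < ‖j w‖⁻¹ := by simpa using hjw
    exact mul_neg_of_pos_of_neg (by positivity) hw
  -- Since `l` is the infimum of the Rayleigh quotient, `S` is nonnegative; a minimiser is a null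
  -- vector of `S`, and the eigenvalue equation says that it lies in the kernel of `S`.
  set S : X →ₗ⋆[𝕜] X →ₗ[𝕜] 𝕜 := Q - (l : 𝕜) • gram j with hS
  have hSre : ∀ u, RCLike.re (S u u) = RCLike.re (Q u u) - l * ‖j u‖ ^ 2 := by
    intro u
    rw [hS, LinearMap.sub_apply, LinearMap.sub_apply, LinearMap.smul_apply, LinearMap.smul_apply,
      map_sub, smul_eq_mul, RCLike.re_ofReal_mul, re_gram_self]
  have hSsymm : ∀ u v, conj (S u v) = S v u := by
    intro u v
    simp only [hS, LinearMap.sub_apply, LinearMap.smul_apply, map_sub, smul_eq_mul, map_mul,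
      hQ.symm u v, RCLike.conj_ofReal, gram_apply, inner_conj_symm]
  have hS0 : ∀ u, 0 ≤ RCLike.re (S u u) := by
    intro u
    rw [hSre]
    -- `j` is not assumed injective: vectors in its kernel cannot be normalised, but there the
    -- Gårding inequality already makes `Q` nonnegative.
    by_cases hu : j u = 0
    · have := hM u
      rw [hu, norm_zero] at this ⊢
      nlinarith [sq_nonneg ‖u‖, mul_nonneg hc.le (sq_nonneg ‖u‖)]
    · have h1 : l ≤ (‖j u‖⁻¹) ^ 2 * RCLike.re (Q u u) :=
        csInf_le hAbdd ⟨_, hnorm u hu, (hscale _ _).symm⟩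
      have h2 : 0 < ‖j u‖ := norm_pos_iff.2 hu
      rw [inv_pow, inv_mul_eq_div, le_div_iff₀ (by positivity)] at h1
      linarith
  obtain ⟨q, -, hq, hqA⟩ := exists_seq_tendsto_sInf ⟨_, hwA⟩ hAbdd
  choose u hu1 huq using hqA
  have hSu : Tendsto (fun n => RCLike.re (S (u n) (u n))) atTop (𝓝 0) := by
    have : (fun n => RCLike.re (S (u n) (u n))) = fun n => q n - l := by
      ext n; rw [hSre, hu1, huq]; ring
    rw [this, ← sub_self l]
    exact hq.sub_const l
  have hbddu : ∃ R, ∀ n, ‖u n‖ ≤ R := by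
    obtain ⟨R, hR⟩ := hq.bddAbove_range
    refine ⟨(R + M) / c + 1, fun n => ?_⟩
    have h1 : q n ≤ R := hR ⟨n, rfl⟩
    have h2 := hM (u n)
    rw [hu1, ← huq] at h2
    have h3 : ‖u n‖ ^ 2 ≤ (R + M) / c := by
      rw [le_div_iff₀ hc]; linarith
    nlinarith [sq_nonneg (‖u n‖ - 1)]
  obtain ⟨φ, hφ, hφc⟩ := hcomp u hbddu
  have hSφ := hSu.comp hφ.tendsto_atTop
  -- By the parallelogram law and `S ≥ 0`, the value of `S` at a difference is at most twice the sum
  -- of the two values, which tend to zero. As `l < 0`, it dominates `Q` at the difference, and the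
  -- compactness hypothesis turns this into a bound on the norm.
  have hcau : CauchySeq (fun n => u (φ n)) := by
    rw [Metric.cauchySeq_iff]
    intro ε hε
    obtain ⟨n₀, hn₀⟩ := hφc (c' * ε ^ 2 / 4) (by positivity)
    obtain ⟨n₁, hn₁⟩ := eventually_atTop.1
      (hSφ.eventually (gt_mem_nhds (show 0 < c' * ε ^ 2 / 8 by positivity)))
    refine ⟨max n₀ n₁, fun m hm n hn => ?_⟩
    have h1 := hn₀ m (le_trans (le_max_left _ _) hm) n (le_trans (le_max_left _ _) hn)
    have h2 := hn₁ m (le_trans (le_max_right _ _) hm)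
    have h3 := hn₁ n (le_trans (le_max_right _ _) hn)
    have h4 := form_parallelogram S (u (φ m)) (u (φ n))
    have h5 := hS0 (u (φ m) + u (φ n))
    have h6 := hSre (u (φ m) - u (φ n))
    have h7 : 0 ≤ -l * ‖j (u (φ m) - u (φ n))‖ ^ 2 :=
      mul_nonneg (by linarith) (sq_nonneg _)
    simp only [Function.comp_apply] at h2 h3
    have h8 : c' * ‖u (φ m) - u (φ n)‖ ^ 2 < c' * ε ^ 2 := by
      have : 0 < c' * ε ^ 2 := by positivity
      linarith
    rw [dist_eq_norm]
    exact lt_of_pow_lt_pow_left₀ 2 hε.le (lt_of_mul_lt_mul_left h8 hc'.le)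
  obtain ⟨v, hv⟩ := cauchySeq_tendsto_of_complete hcau
  have hjv : ‖j v‖ = 1 := by
    have h1 : Tendsto (fun n => ‖j (u (φ n))‖) atTop (𝓝 ‖j v‖) :=
      ((j.continuous.tendsto v).comp hv).norm
    simp only [hu1] at h1
    exact tendsto_nhds_unique h1 tendsto_const_nhds
  -- The parallelogram law for `v = u (φ n) - (u (φ n) - v)` replaces continuity of the form, so the
  -- one-sided bound `bdd` is enough.
  have hSv : RCLike.re (S v v) = 0 := by
    refine le_antisymm ?_ (hS0 v)
    have h1 : Tendsto (fun n => 2 * RCLike.re (S (u (φ n)) (u (φ n)))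
        + 2 * ((C - l * ‖j‖ ^ 2) * ‖u (φ n) - v‖ ^ 2)) atTop (𝓝 (2 * 0 + 2 * ((C - l * ‖j‖ ^ 2) * 0 ^ 2))) := by
      have h2 : Tendsto (fun n => ‖u (φ n) - v‖) atTop (𝓝 0) :=
        tendsto_iff_norm_sub_tendsto_zero.1 hv
      exact (hSφ.const_mul 2).add (((h2.pow 2).const_mul _).const_mul 2)
    rw [show (2 : ℝ) * 0 + 2 * ((C - l * ‖j‖ ^ 2) * 0 ^ 2) = 0 by ring] at h1
    refine ge_of_tendsto' h1 fun n => ?_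
    have h3 := form_parallelogram S (u (φ n)) (u (φ n) - v)
    have h4 : u (φ n) - (u (φ n) - v) = v := by abel
    rw [h4] at h3
    have h5 := hS0 (u (φ n) + (u (φ n) - v))
    have h6 := hSre (u (φ n) - v)
    have h7 := hC (u (φ n) - v)
    have h8 : ‖j (u (φ n) - v)‖ ^ 2 ≤ ‖j‖ ^ 2 * ‖u (φ n) - v‖ ^ 2 := by
      rw [← mul_pow]
      exact pow_le_pow_left₀ (norm_nonneg _) (j.le_opNorm _) 2
    have h9 := mul_le_mul_of_nonneg_left h8 (show 0 ≤ -l by linarith)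
    linarith
  refine ⟨v, l, hl0, hjv, fun w => ?_⟩
  have := form_eq_zero_of_nonneg hSsymm hS0 hSv w
  rw [hS, LinearMap.sub_apply, LinearMap.sub_apply, LinearMap.smul_apply, LinearMap.smul_apply,
    sub_eq_zero] at this
  exact this

/-- A penalty that lifts the eigenvectors already found out of the negative spectrum. Being
nonnegative, it preserves both lower bounds; its size enters only in the upper bound. -/
lemma IsCompactGarding.add_rankOne {j : X →L[𝕜] E} {Q : X →ₗ⋆[𝕜] X →ₗ[𝕜] 𝕜}
    (hQ : IsCompactGarding j Q) {C : ℝ} (hC : 0 ≤ C) {n : ℕ} (e : Fin n → E) :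
    IsCompactGarding j (Q + (C : 𝕜) • ∑ i, rankOneForm j (e i)) := by
  have key : ∀ u, RCLike.re ((Q + (C : 𝕜) • ∑ i, rankOneForm j (e i)) u u) =
      RCLike.re (Q u u) + C * ∑ i, ‖inner 𝕜 (e i) (j u)‖ ^ 2 := by
    intro u
    simp only [LinearMap.add_apply, LinearMap.smul_apply, LinearMap.sum_apply, map_add,
      smul_eq_mul, RCLike.re_ofReal_mul, map_sum, re_rankOneForm_self]
  have key' : ∀ u, RCLike.re (Q u u) ≤
      RCLike.re ((Q + (C : 𝕜) • ∑ i, rankOneForm j (e i)) u u) := by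
    intro u
    rw [key]
    have : 0 ≤ C * ∑ i, ‖inner 𝕜 (e i) (j u)‖ ^ 2 := by positivity
    linarith
  refine ⟨fun u v => ?_, ?_, ?_, ?_⟩
  · simp only [LinearMap.add_apply, LinearMap.smul_apply, LinearMap.sum_apply, map_add,
      smul_eq_mul, map_mul, map_sum, hQ.symm u v, RCLike.conj_ofReal, rankOneForm_apply,
      inner_conj_symm, mul_comm]
  · obtain ⟨D, hD⟩ := hQ.bdd
    refine ⟨D + C * ∑ i, (‖e i‖ * ‖j‖) ^ 2, fun u => ?_⟩
    rw [key, add_mul, mul_assoc, Finset.sum_mul]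
    gcongr with i
    · exact hD u
    · rw [← mul_pow]
      gcongr
      calc _ ≤ ‖e i‖ * ‖j u‖ := norm_inner_le_norm _ _
        _ ≤ ‖e i‖ * (‖j‖ * ‖u‖) := by gcongr; exact j.le_opNorm u
        _ = _ := by ring
  · obtain ⟨c, hc, M, hM⟩ := hQ.garding
    exact ⟨c, hc, M, fun u => (hM u).trans (by linarith [key' u])⟩
  · obtain ⟨c, hc, h⟩ := hQ.compact
    refine ⟨c, hc, fun u hu => ?_⟩
    obtain ⟨φ, hφ, h⟩ := h u hu
    refine ⟨φ, hφ, fun ε hε => ?_⟩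
    obtain ⟨n₀, h⟩ := h ε hε
    exact ⟨n₀, fun n hn m hm => (h n hn m hm).trans (by linarith [key' (u (φ n) - u (φ m))])⟩

/-- A form with compact negative part has as many eigenvectors for negative eigenvalues as the
dimension of any space on which it is negative definite. -/
theorem IsCompactGarding.exists_orthonormal [CompleteSpace X] {j : X →L[𝕜] E}
    {Q : X →ₗ⋆[𝕜] X →ₗ[𝕜] 𝕜} (hQ : IsCompactGarding j Q) {Y : Type*} [AddCommGroup Y] [Module 𝕜 Y]
    [FiniteDimensional 𝕜 Y] (Φ : Y →ₗ[𝕜] X) (hΦ : ∀ y, y ≠ 0 → RCLike.re (Q (Φ y) (Φ y)) < 0)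
    (n : ℕ) (hn : n ≤ Module.finrank 𝕜 Y) :
    ∃ (e : Fin n → X) (l : Fin n → ℝ), (∀ i, l i < 0) ∧ Orthonormal 𝕜 (fun i => j (e i)) ∧
      ∀ i v, Q (e i) v = (l i : 𝕜) * inner 𝕜 (j (e i)) (j v) := by
  induction n with
  | zero => exact ⟨Fin.elim0, Fin.elim0, fun i => i.elim0, ⟨fun i => i.elim0, fun i => i.elim0⟩,
      fun i => i.elim0⟩
  | succ n ih =>
    obtain ⟨e, l, hl, ho, he⟩ := ih (by omega)
    -- The `n` orthogonality conditions have a nonzero solution in dimension at least `n + 1`. The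
    -- penalty vanishes at `Φ y`, so the penalised form is still negative there.
    obtain ⟨y, hy, hy0⟩ : ∃ y : Y, (∀ i, inner 𝕜 (j (e i)) (j (Φ y)) = 0) ∧ y ≠ 0 := by
      let T : Y →ₗ[𝕜] (Fin n → 𝕜) :=
        LinearMap.pi fun i => (innerₛₗ 𝕜 (j (e i))).comp (j.toLinearMap.comp Φ)
      have hT : LinearMap.ker T ≠ ⊥ := LinearMap.ker_ne_bot_of_finrank_lt (by simpa using hn)
      obtain ⟨y, hy, hy0⟩ := (Submodule.ne_bot_iff _).1 hT
      exact ⟨y, fun i => congrFun (LinearMap.mem_ker.1 hy) i, hy0⟩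
    -- With this `C` the penalised form has the eigenvalue `l i + C ≥ 0` at `e i`. The new
    -- eigenvalue `l'` is negative, hence different, which forces orthogonality to every `e i`.
    set C : ℝ := ∑ i, |l i| with hC
    have hC0 : 0 ≤ C := by positivity
    have hCl : ∀ i, 0 ≤ l i + C := by
      intro i
      have h1 : |l i| ≤ C := Finset.single_le_sum (f := fun i => |l i|) (fun _ _ => abs_nonneg _)
        (Finset.mem_univ i)
      have := neg_abs_le (l i)
      linarith
    obtain ⟨u, l', hl', hu, huv⟩ := (hQ.add_rankOne hC0 (fun i => j (e i))).exists_eigenvector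
      (w := Φ y) (by
        simp only [LinearMap.add_apply, LinearMap.smul_apply, LinearMap.sum_apply,
          rankOneForm_apply, hy, mul_zero, Finset.sum_const_zero, smul_zero, add_zero]
        exact hΦ y hy0)
    simp only [LinearMap.add_apply, LinearMap.smul_apply, LinearMap.sum_apply,
      rankOneForm_apply, smul_eq_mul] at huv
    have horth : ∀ i, inner 𝕜 (j u) (j (e i)) = 0 := by
      intro i
      have h1 := huv (e i)
      have h2 : Q u (e i) = (l i : 𝕜) * inner 𝕜 (j u) (j (e i)) := by
        rw [← hQ.symm, he i u, map_mul, RCLike.conj_ofReal, inner_conj_symm]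
      have h3 : ∑ i', inner 𝕜 (j u) (j (e i')) * inner 𝕜 (j (e i')) (j (e i))
          = inner 𝕜 (j u) (j (e i)) := by
        rw [Finset.sum_eq_single i]
        · rw [inner_self_eq_norm_sq_to_K, ho.1 i]; simp
        · intro b _ hb
          rw [ho.2 hb, mul_zero]
        · simp
      rw [h2, h3, ← add_mul, ← sub_eq_zero, ← sub_mul, ← RCLike.ofReal_add, ← RCLike.ofReal_sub]
        at h1
      rcases mul_eq_zero.1 h1 with h | h
      · have : l i + C - l' = 0 := by exact_mod_cast h
        linarith [hCl i]
      · exact h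
    have horth' : ∀ i, inner 𝕜 (j (e i)) (j u) = 0 := fun i => by
      rw [← inner_conj_symm, horth, map_zero]
    refine ⟨Fin.cons u e, Fin.cons l' l, fun i => ?_, ⟨fun i => ?_, fun i i' => ?_⟩, fun i v => ?_⟩
    · induction i using Fin.cases with
      | zero => exact hl'
      | succ i => exact hl i
    · induction i using Fin.cases with
      | zero => exact hu
      | succ i => exact ho.1 i
    · induction i using Fin.cases with
      | zero =>
        induction i' using Fin.cases with
        | zero => exact fun h => absurd rfl h
        | succ i' => exact fun _ => horth i'
      | succ i =>
        induction i' using Fin.cases with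
        | zero => exact fun _ => horth' i
        | succ i' => exact fun h => ho.2 (fun h' => h (congrArg Fin.succ h'))
    · induction i using Fin.cases with
      | zero =>
        -- By orthogonality the penalty drops out, so the new vector is an eigenvector of `Q`
        -- itself.
        have := huv v
        simp only [horth, zero_mul, Finset.sum_const_zero, mul_zero, add_zero] at this
        exact this
      | succ i => exact he i v

end Variational

/-! ### Weak derivatives on the half-line and primitives. -/

section HalfLine

open ComplexConjugate

variable {𝕜 : Type*} [RCLike 𝕜]

/-- The increments are dominated by those of the primitive of the norm, which reduces the claim to
real integrands. -/
lemma absolutelyContinuousOnInterval_integral {g : ℝ → 𝕜} {a b c : ℝ}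
    (h : IntervalIntegrable g volume a b) (hc : c ∈ uIcc a b) :
    AbsolutelyContinuousOnInterval (fun x => ∫ v in c..x, g v) a b := by
  have hr := h.norm.absolutelyContinuousOnInterval_intervalIntegral hc
  refine squeeze_zero' (.of_forall fun _ => Finset.sum_nonneg fun _ _ => dist_nonneg) ?_ hr
  refine eventually_inf_principal.2 (.of_forall fun I hI => Finset.sum_le_sum fun i hi => ?_)
  have h1 := hI.1 i (Finset.mem_coe.2 hi)
  have hint : ∀ x ∈ uIcc a b, IntervalIntegrable g volume c x := fun x hx =>
    h.mono_set (uIcc_subset_uIcc hc hx)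
  rw [dist_comm, dist_eq_norm, dist_comm, Real.dist_eq,
    intervalIntegral.integral_interval_sub_left (hint _ h1.2) (hint _ h1.1),
    intervalIntegral.integral_interval_sub_left (hint _ h1.2).norm (hint _ h1.1).norm]
  exact intervalIntegral.norm_integral_le_abs_integral_norm

/-- The primitive of `g` on the half-line with value `z` at the origin. -/
def prim (z : 𝕜) (g : ℝ → 𝕜) (x : ℝ) : 𝕜 := z + ∫ t in (0 : ℝ)..x, g t

@[simp] lemma prim_zero (z : 𝕜) (g : ℝ → 𝕜) : prim z g 0 = z := by simp [prim]

lemma absolutelyContinuousOnInterval_prim (z : 𝕜) {g : ℝ → 𝕜} {b : ℝ}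
    (h : IntervalIntegrable g volume 0 b) : AbsolutelyContinuousOnInterval (prim z g) 0 b := by
  have h1 : AbsolutelyContinuousOnInterval (fun _ : ℝ => z) 0 b :=
    (LipschitzWith.const z).lipschitzOnWith.absolutelyContinuousOnInterval
  exact h1.add (absolutelyContinuousOnInterval_integral h left_mem_uIcc)

/-- Integration by parts without continuity of the derivatives: the product minus the integral of
its formal derivative is absolutely continuous with derivative zero almost everywhere, hence
constant. -/
lemma integral_prim_mul_prim (z₁ z₂ : 𝕜) {g₁ g₂ : ℝ → 𝕜} {b : ℝ}
    (h₁ : IntervalIntegrable g₁ volume 0 b) (h₂ : IntervalIntegrable g₂ volume 0 b) :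
    ∫ x in (0 : ℝ)..b, (g₁ x * prim z₂ g₂ x + prim z₁ g₁ x * g₂ x) =
      prim z₁ g₁ b * prim z₂ g₂ b - z₁ * z₂ := by
  have a₁ := absolutelyContinuousOnInterval_prim z₁ h₁
  have a₂ := absolutelyContinuousOnInterval_prim z₂ h₂
  have hint : IntervalIntegrable (fun x => g₁ x * prim z₂ g₂ x + prim z₁ g₁ x * g₂ x) volume 0 b :=
    (h₁.mul_continuousOn a₂.continuousOn).add (h₂.continuousOn_mul a₁.continuousOn)
  have a₃ := (a₁.smul a₂).sub (absolutelyContinuousOnInterval_integral hint left_mem_uIcc)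
  obtain ⟨C, hC⟩ := a₃.const_of_ae_hasDerivAt_zero (by
    filter_upwards [h₁.ae_hasDerivAt_integral, h₂.ae_hasDerivAt_integral,
      hint.ae_hasDerivAt_integral] with x d₁ d₂ d₃ hx
    have e₁ := (d₁ hx 0 left_mem_uIcc).const_add z₁
    have e₂ := (d₂ hx 0 left_mem_uIcc).const_add z₂
    have e₃ := (e₁.mul e₂).sub (d₃ hx 0 left_mem_uIcc)
    convert! e₃ using 1
    simp only [prim]
    ring)
  have hb := hC b right_mem_uIcc
  have h0 := hC 0 left_mem_uIcc
  simp only [Pi.sub_apply, smul_eq_mul, Pi.mul_apply, prim_zero,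
    intervalIntegral.integral_same, sub_zero] at hb h0
  rw [← h0] at hb
  rw [← hb]
  ring

lemma continuousOn_prim (z : 𝕜) {g : ℝ → 𝕜} (h : ∀ b, 0 ≤ b → IntervalIntegrable g volume 0 b) :
    ContinuousOn (prim z g) (Ici 0) := by
  intro x hx
  have hx0 : (0 : ℝ) ≤ x := hx
  have h1 := (absolutelyContinuousOnInterval_prim z (h (x + 1) (by linarith))).continuousOn
  rw [uIcc_of_le (by linarith)] at h1
  refine (h1 x ⟨hx0, by linarith⟩).mono_of_mem_nhdsWithin ?_
  exact Filter.mem_of_superset (inter_mem_nhdsWithin _ (Iio_mem_nhds (by linarith : x < x + 1)))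
    fun y hy => ⟨hy.1, le_of_lt hy.2⟩

lemma L2Half.intervalIntegrable (f : L2Half 𝕜) {b : ℝ} (hb : 0 ≤ b) :
    IntervalIntegrable f volume 0 b := by
  rw [intervalIntegrable_iff_integrableOn_Ioc_of_le hb]
  exact ((Lp.memLp f).mono_measure (Measure.restrict_mono Ioc_subset_Ioi_self le_rfl)).integrable
    (by norm_num)

/-- A compactly supported function vanishes beyond some `b > 0`. -/
lemma exists_forall_le_eq_zero {ψ : ℝ → ℝ} (hc : HasCompactSupport ψ) :
    ∃ b, 0 < b ∧ ∀ x, b ≤ x → ψ x = 0 := by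
  obtain ⟨b, hb⟩ := hc.isCompact.bddAbove
  refine ⟨max b 0 + 1, by positivity, fun x hx => image_eq_zero_of_notMem_tsupport fun h => ?_⟩
  have := hb h
  have := le_max_left b 0
  linarith

lemma integrableOn_Ioi_smul_of_test {h : ℝ → 𝕜}
    (hh : ∀ b, 0 ≤ b → IntervalIntegrable h volume 0 b) {ψ : ℝ → ℝ} (hψ : Continuous ψ)
    (hc : HasCompactSupport ψ) : IntegrableOn (fun x => ψ x • h x) (Ioi 0) := by
  obtain ⟨b, hb, h0⟩ := exists_forall_le_eq_zero hc
  have h1 := (hh b hb.le).continuousOn_smul hψ.continuousOn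
  rw [intervalIntegrable_iff_integrableOn_Ioc_of_le hb.le] at h1
  refine h1.of_forall_sdiff_eq_zero measurableSet_Ioi fun x hx => ?_
  rw [h0 x, zero_smul]
  by_contra hlt
  exact hx.2 ⟨hx.1, (not_le.1 hlt).le⟩

lemma setIntegral_Ioi_eq_intervalIntegral {h : ℝ → 𝕜} {b : ℝ} (hb : 0 ≤ b)
    (h0 : ∀ x, b ≤ x → h x = 0) : ∫ x in Ioi (0 : ℝ), h x = ∫ x in (0 : ℝ)..b, h x := by
  rw [intervalIntegral.integral_of_le hb]
  refine setIntegral_eq_of_subset_of_forall_sdiff_eq_zero measurableSet_Ioi Ioc_subset_Ioi_self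
    fun x hx => h0 x ?_
  by_contra hlt
  exact hx.2 ⟨hx.1, (not_le.1 hlt).le⟩

/-- The test function is itself a primitive with value zero at the origin. The product formula up to
a point beyond its support has no boundary terms. -/
lemma integral_deriv_smul_prim (z : 𝕜) {g : ℝ → 𝕜}
    (h : ∀ b, 0 ≤ b → IntervalIntegrable g volume 0 b) {ψ : ℝ → ℝ} (hψ : ContDiff ℝ (⊤ : ℕ∞) ψ)
    (hc : HasCompactSupport ψ) (hs : tsupport ψ ⊆ Ioi 0) :
    ∫ x in Ioi (0 : ℝ), deriv ψ x • prim z g x = - ∫ x in Ioi (0 : ℝ), ψ x • g x := by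
  obtain ⟨b, hb, h0⟩ := exists_forall_le_eq_zero hc
  obtain ⟨b', hb', h0'⟩ := exists_forall_le_eq_zero hc.deriv
  set B := max b b'
  have hB : 0 ≤ B := hb.le.trans (le_max_left _ _)
  have hψ' : Continuous (deriv ψ) := hψ.continuous_deriv (by simp)
  rw [setIntegral_Ioi_eq_intervalIntegral hB
      (fun x hx => by rw [h0' x ((le_max_right _ _).trans hx), zero_smul]),
    setIntegral_Ioi_eq_intervalIntegral hB
      (fun x hx => by rw [h0 x ((le_max_left _ _).trans hx), zero_smul])]
  have hψ0 : ψ 0 = 0 := image_eq_zero_of_notMem_tsupport fun h => lt_irrefl (0 : ℝ) (hs h)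
  have hprim : ∀ x, prim (0 : 𝕜) (fun t => ((deriv ψ t : ℝ) : 𝕜)) x = (ψ x : 𝕜) := by
    intro x
    rw [prim, zero_add, show ∫ t in (0 : ℝ)..x, ((deriv ψ t : ℝ) : 𝕜) =
        ((∫ t in (0 : ℝ)..x, deriv ψ t : ℝ) : 𝕜) from
        (RCLike.ofRealCLM (K := 𝕜)).intervalIntegral_comp_comm (hψ'.intervalIntegrable 0 x),
      intervalIntegral.integral_deriv_eq_sub' ψ rfl
        (fun y _ => (hψ.differentiable (by simp)).differentiableAt) hψ'.continuousOn, hψ0, sub_zero]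
  have hg1 : IntervalIntegrable (fun t => ((deriv ψ t : ℝ) : 𝕜)) volume 0 B :=
    (RCLike.continuous_ofReal.comp hψ').intervalIntegrable _ _
  have key := integral_prim_mul_prim 0 z hg1 (h B hB)
  simp only [hprim, h0 B (le_max_left _ _), RCLike.ofReal_zero, zero_mul, sub_zero] at key
  have hi1 := hg1.mul_continuousOn (absolutelyContinuousOnInterval_prim z (h B hB)).continuousOn
  have hi2 : IntervalIntegrable (fun x => (ψ x : 𝕜) * g x) volume 0 B := (h B hB).continuousOn_mul
    (RCLike.continuous_ofReal.comp hψ.continuous : Continuous fun t => ((ψ t : ℝ) : 𝕜)).continuousOn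
  rw [intervalIntegral.integral_add hi1 hi2] at key
  simp only [RCLike.real_smul_eq_coe_mul]
  exact eq_neg_of_add_eq_zero_left key

/-- The fundamental lemma of du Bois-Reymond on the half-line. -/
lemma ae_eq_const_of_integral_deriv_smul_eq_zero {h : ℝ → 𝕜}
    (hh : ∀ b, 0 ≤ b → IntervalIntegrable h volume 0 b)
    (H : ∀ ψ : ℝ → ℝ, ContDiff ℝ (⊤ : ℕ∞) ψ → HasCompactSupport ψ → tsupport ψ ⊆ Ioi (0 : ℝ) →
      ∫ x in Ioi (0 : ℝ), deriv ψ x • h x = 0) :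
    ∃ c : 𝕜, ∀ᵐ x ∂(volume.restrict (Ioi (0 : ℝ))), h x = c := by
  -- A fixed test function of integral one, supported in `[1, 3]`; the constant is the mean of `h`
  -- against it.
  let B : ContDiffBump (2 : ℝ) := ⟨1 / 2, 1, by norm_num, by norm_num⟩
  set ρ : ℝ → ℝ := B.normed volume with hρ
  have ρd : ContDiff ℝ (⊤ : ℕ∞) ρ := B.contDiff_normed
  have ρc : HasCompactSupport ρ := B.hasCompactSupport_normed
  have ρi : ∫ x, ρ x = 1 := B.integral_normed
  have ρs : tsupport ρ ⊆ Icc 1 3 := by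
    rw [hρ, B.tsupport_normed_eq, Real.closedBall_eq_Icc]
    norm_num
  set c : 𝕜 := ∫ x in Ioi (0 : ℝ), ρ x • h x with hcdef
  have key : ∀ᵐ x ∂(volume : Measure ℝ), x ∈ Ioi (0 : ℝ) → h x - c = 0 := by
    refine isOpen_Ioi.ae_eq_zero_of_integral_contDiff_smul_eq_zero ?_ ?_
    · refine LocallyIntegrableOn.sub ?_ ((locallyIntegrable_const c).locallyIntegrableOn _)
      intro x hx
      have h1 := hh (x + 1) (by linarith [mem_Ioi.1 hx])
      rw [intervalIntegrable_iff_integrableOn_Ioc_of_le (by linarith [mem_Ioi.1 hx])] at h1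
      exact ⟨Ioc 0 (x + 1), mem_nhdsWithin_of_mem_nhds
        (Ioc_mem_nhds hx (by linarith)), h1⟩
    · intro ψ hψ hψc hψs
      set m : ℝ := ∫ x, ψ x with hm
      -- Subtracting `m * ρ` gives `η` mean zero, so its primitive `χ` is again a test function on
      -- the open half-line. The hypothesis for `χ` says that `η` integrates to zero against `h`, so
      -- `ψ` integrates to `m • c` against `h`.
      set η : ℝ → ℝ := fun x => ψ x - m * ρ x with hη
      have ηd : ContDiff ℝ (⊤ : ℕ∞) η := hψ.sub (contDiff_const.mul ρd)
      have hψI : Integrable ψ := hψ.continuous.integrable_of_hasCompactSupport hψc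
      have hρI : Integrable ρ := ρd.continuous.integrable_of_hasCompactSupport ρc
      set χ : ℝ → ℝ := fun x => ∫ t in (0 : ℝ)..x, η t with hχ
      have χ' : ∀ x, HasDerivAt χ (η x) x := fun x =>
        intervalIntegral.integral_hasDerivAt_right (ηd.continuous.intervalIntegrable _ _)
          (ηd.continuous.stronglyMeasurableAtFilter _ _) ηd.continuous.continuousAt
      have dχ : deriv χ = η := funext fun x => (χ' x).deriv
      have χd : ContDiff ℝ (⊤ : ℕ∞) χ := by
        rw [contDiff_infty_iff_deriv, dχ]
        exact ⟨fun x => (χ' x).differentiableAt, ηd⟩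
      obtain ⟨b, hb, hb0⟩ := exists_forall_le_eq_zero hψc
      obtain ⟨a, ha, ha0⟩ : ∃ a, 0 < a ∧ ∀ x, x ≤ a → ψ x = 0 := by
        rcases (tsupport ψ).eq_empty_or_nonempty with he | hne
        · exact ⟨1, one_pos, fun x _ => image_eq_zero_of_notMem_tsupport (by simp [he])⟩
        · obtain ⟨a, ha, hle⟩ := hψc.isCompact.exists_isLeast hne
          have ha0 : 0 < a := hψs ha
          refine ⟨a / 2, by linarith, fun x hx => image_eq_zero_of_notMem_tsupport fun h => ?_⟩
          have := hle h
          linarith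
      have ρ0 : ∀ x, x ∉ Icc (1 : ℝ) 3 → ρ x = 0 := fun x hx =>
        image_eq_zero_of_notMem_tsupport fun h => hx (ρs h)
      set a' := min a (1 / 2) with ha'
      set b' := max b 4 with hb'
      have ha'0 : 0 < a' := lt_min ha (by norm_num)
      have η0 : ∀ x, x ≤ a' → η x = 0 := by
        intro x hx
        have h1 : x ≤ 1 / 2 := hx.trans (min_le_right _ _)
        rw [hη]
        simp only
        rw [ha0 x (hx.trans (min_le_left _ _)), ρ0 x (fun h => by linarith [h.1])]
        ring
      have η1 : ∀ x, b' ≤ x → η x = 0 := by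
        intro x hx
        have h1 : 4 ≤ x := (le_max_right _ _).trans hx
        rw [hη]
        simp only
        rw [hb0 x ((le_max_left _ _).trans hx), ρ0 x (fun h => by linarith [h.2])]
        ring
      have χ0 : ∀ x, x ≤ a' → χ x = 0 := by
        intro x hx
        refine intervalIntegral.integral_zero_ae (.of_forall fun t ht => η0 t ?_)
        rcases le_total 0 x with h | h
        · rw [uIoc_of_le h] at ht
          exact ht.2.trans hx
        · rw [uIoc_of_ge h] at ht
          exact ht.2.trans ha'0.le
      have hηI : ∫ x, η x = 0 := by
        rw [hη, integral_sub hψI (hρI.const_mul m), integral_const_mul, ρi, ← hm]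
        ring
      have χ1 : ∀ x, b' ≤ x → χ x = 0 := by
        intro x hx
        have hx0 : 0 ≤ x := (show (0 : ℝ) ≤ 4 by norm_num).trans ((le_max_right _ _).trans hx)
        rw [hχ]
        simp only
        rw [intervalIntegral.integral_of_le hx0]
        refine (setIntegral_eq_integral_of_forall_compl_eq_zero fun t ht => ?_).trans hηI
        rcases le_or_gt t 0 with h | h
        · exact η0 t (h.trans ha'0.le)
        · refine η1 t (hx.trans ?_)
          by_contra hlt
          exact ht ⟨h, (not_le.1 hlt).le⟩
      have χsupp : Function.support χ ⊆ Icc a' b' := by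
        intro x hx
        refine ⟨?_, ?_⟩ <;> by_contra hlt
        · exact hx (χ0 x (not_le.1 hlt).le)
        · exact hx (χ1 x (not_le.1 hlt).le)
      have χts : tsupport χ ⊆ Icc a' b' := closure_minimal χsupp isClosed_Icc
      have χc : HasCompactSupport χ := isCompact_Icc.of_isClosed_subset (isClosed_tsupport _) χts
      have h0 := H χ χd χc (χts.trans fun x hx => ha'0.trans_le hx.1)
      rw [dχ] at h0
      have i1 := integrableOn_Ioi_smul_of_test hh hψ.continuous hψc
      have i2 := integrableOn_Ioi_smul_of_test hh ρd.continuous ρc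
      have e1 : ∫ x in Ioi (0 : ℝ), η x • h x = (∫ x in Ioi (0 : ℝ), ψ x • h x) - m • c := by
        have i3 : Integrable (fun x => m • ρ x • h x) (volume.restrict (Ioi 0)) := i2.smul m
        rw [hcdef, ← integral_smul, ← integral_sub i1 i3]
        refine integral_congr_ae (.of_forall fun x => ?_)
        simp only [hη, sub_smul, mul_smul]
      have e2 : ∫ x, ψ x • (h x - c) = ∫ x in Ioi (0 : ℝ), ψ x • (h x - c) := by
        refine (setIntegral_eq_integral_of_forall_compl_eq_zero fun x hx => ?_).symm
        rw [image_eq_zero_of_notMem_tsupport (fun hx' => hx (hψs hx')), zero_smul]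
      have e3 : ∫ x in Ioi (0 : ℝ), ψ x = m :=
        setIntegral_eq_integral_of_forall_compl_eq_zero fun x hx =>
          image_eq_zero_of_notMem_tsupport (fun hx' => hx (hψs hx'))
      rw [e2]
      simp only [smul_sub]
      rw [integral_sub i1 (hψI.integrableOn.smul_const c), integral_smul_const, e3, ← e1, h0]
  refine ⟨c, (ae_restrict_iff' measurableSet_Ioi).2 ?_⟩
  filter_upwards [key] with x hx hx0 using sub_eq_zero.1 (hx hx0)

lemma HasTrace.of_ae_eq_prim {f g : L2Half 𝕜} {z : 𝕜}
    (h : f =ᵐ[volume.restrict (Ioi (0 : ℝ))] prim z g) : HasTrace f z := by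
  have hc := continuousOn_prim z (fun b hb => L2Half.intervalIntegrable g hb)
  refine ⟨prim z g, h.symm, hc.mono Ioi_subset_Ici_self, ?_⟩
  have := (hc 0 self_mem_Ici).mono Ioi_subset_Ici_self
  rwa [ContinuousWithinAt, prim_zero] at this

lemma HasTrace.unique {f : L2Half 𝕜} {z z' : 𝕜} (h : HasTrace f z) (h' : HasTrace f z') :
    z = z' := by
  obtain ⟨F, h1, h2, h3⟩ := h
  obtain ⟨F', h1', h2', h3'⟩ := h'
  have h4 : EqOn F F' (Ioi 0) :=
    Measure.eqOn_open_of_ae_eq (h1.trans h1'.symm) isOpen_Ioi h2 h2'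
  exact tendsto_nhds_unique h3 (h3'.congr' (eventually_nhdsWithin_of_forall fun x hx => (h4 hx).symm))

/-- An element of `H¹(ℝ⁺)` is the primitive of its weak derivative. -/
lemma IsWeakDeriv.exists_ae_eq_prim {f g : L2Half 𝕜} (h : IsWeakDeriv f g) :
    ∃ z, f =ᵐ[volume.restrict (Ioi (0 : ℝ))] prim z g := by
  have hg : ∀ b, 0 ≤ b → IntervalIntegrable g volume 0 b :=
    fun b hb => L2Half.intervalIntegrable g hb
  have hp : ∀ b, 0 ≤ b → IntervalIntegrable (prim 0 g) volume 0 b := fun b hb =>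
    ((continuousOn_prim 0 hg).mono (by rw [uIcc_of_le hb]; exact Icc_subset_Ici_self)).intervalIntegrable
  obtain ⟨z, hz⟩ := ae_eq_const_of_integral_deriv_smul_eq_zero (h := fun x => f x - prim 0 g x)
    (fun b hb => (L2Half.intervalIntegrable f hb).sub (hp b hb)) (by
      intro ψ h1 h2 h3
      have c := h1.continuous_deriv (n := (⊤ : ℕ∞)) (by simp)
      simp only [smul_sub]
      rw [integral_sub (integrableOn_smul_of_test f c h2.deriv)
        (integrableOn_Ioi_smul_of_test hp c h2.deriv), integral_deriv_smul_prim 0 hg h1 h2 h3,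
        h ψ h1 h2 h3, sub_self])
  refine ⟨z, ?_⟩
  filter_upwards [hz] with x hx
  rw [sub_eq_iff_eq_add] at hx
  rw [hx, prim, prim, zero_add]

lemma IsWeakDeriv.of_ae_eq_prim {f g : L2Half 𝕜} {z : 𝕜}
    (h : f =ᵐ[volume.restrict (Ioi (0 : ℝ))] prim z g) : IsWeakDeriv f g := by
  intro ψ h1 h2 h3
  rw [← integral_deriv_smul_prim z (fun b hb => L2Half.intervalIntegrable g hb) h1 h2 h3]
  refine integral_congr_ae ?_
  filter_upwards [h] with x hx
  rw [hx]

lemma IsWeakDeriv.ae_eq_prim {f g : L2Half 𝕜} {z : 𝕜} (h : IsWeakDeriv f g) (hz : HasTrace f z) :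
    f =ᵐ[volume.restrict (Ioi (0 : ℝ))] prim z g := by
  obtain ⟨z', hz'⟩ := h.exists_ae_eq_prim
  rwa [hz.unique (HasTrace.of_ae_eq_prim hz')]

lemma IsWeakDeriv.exists_hasTrace {f g : L2Half 𝕜} (h : IsWeakDeriv f g) : ∃ z, HasTrace f z :=
  let ⟨z, hz⟩ := h.exists_ae_eq_prim
  ⟨z, HasTrace.of_ae_eq_prim hz⟩

end HalfLine

/-! ### Integration by parts, traces and the Riccati bound on an edge. -/

section HalfLineForms

open ComplexConjugate
open scoped BoundedContinuousFunction

variable {𝕜 : Type*} [RCLike 𝕜]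

lemma conj_prim (z : 𝕜) (g : ℝ → 𝕜) (x : ℝ) :
    prim (conj z) (fun t => conj (g t)) x = conj (prim z g x) := by
  rw [prim, prim, map_add]
  congr 1
  simp only [intervalIntegral, map_sub, integral_conj]

lemma intervalIntegrable_conj {g : ℝ → 𝕜} {a b : ℝ} (h : IntervalIntegrable g volume a b) :
    IntervalIntegrable (fun t => conj (g t)) volume a b :=
  ⟨(RCLike.conjCLE (K := 𝕜)).toContinuousLinearMap.integrable_comp h.1,
    (RCLike.conjCLE (K := 𝕜)).toContinuousLinearMap.integrable_comp h.2⟩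

/-- Integration by parts on the half-line. -/
theorem IsWeakDeriv.inner_add_inner {f₁ g₁ f₂ g₂ : L2Half 𝕜} {z₁ z₂ : 𝕜}
    (h₁ : IsWeakDeriv f₁ g₁) (h₂ : IsWeakDeriv f₂ g₂) (t₁ : HasTrace f₁ z₁) (t₂ : HasTrace f₂ z₂) :
    inner 𝕜 g₁ f₂ + inner 𝕜 f₁ g₂ = -(conj z₁ * z₂) := by
  have e₁ := h₁.ae_eq_prim t₁
  have e₂ := h₂.ae_eq_prim t₂
  set P : ℝ → 𝕜 := fun x => conj (prim z₁ g₁ x) * prim z₂ g₂ x with hP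
  set D : ℝ → 𝕜 := fun x => conj (g₁ x) * prim z₂ g₂ x + conj (prim z₁ g₁ x) * g₂ x with hD
  have hDe : (fun x => inner 𝕜 (g₁ x) (f₂ x) + inner 𝕜 (f₁ x) (g₂ x))
      =ᵐ[volume.restrict (Ioi (0 : ℝ))] D := by
    filter_upwards [e₁, e₂] with x h1 h2
    rw [h1, h2]
    simp only [RCLike.inner_apply, hD]
    ring
  have hDi : IntegrableOn D (Ioi 0) :=
    ((L2.integrable_inner g₁ f₂).add (L2.integrable_inner f₁ g₂)).congr hDe
  have hPi : IntegrableOn P (Ioi 0) := by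
    refine (L2.integrable_inner f₁ f₂).congr ?_
    filter_upwards [e₁, e₂] with x h1 h2
    rw [h1, h2]
    simp only [RCLike.inner_apply, hP]
    ring
  have hPD : ∀ b, 0 ≤ b → ∫ x in (0 : ℝ)..b, D x = P b - conj z₁ * z₂ := by
    intro b hb
    have := integral_prim_mul_prim (conj z₁) z₂
      (intervalIntegrable_conj (L2Half.intervalIntegrable g₁ hb)) (L2Half.intervalIntegrable g₂ hb)
    simpa only [conj_prim] using this
  have hlim : Tendsto P atTop (𝓝 ((∫ x in Ioi (0 : ℝ), D x) + conj z₁ * z₂)) := by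
    have h1 := (intervalIntegral_tendsto_integral_Ioi 0 hDi tendsto_id).add_const (conj z₁ * z₂)
    refine h1.congr' ?_
    filter_upwards [eventually_ge_atTop 0] with b hb
    rw [id, hPD b hb]
    ring
  -- `P` is integrable and has a limit at infinity, so this limit is zero and infinity contributes
  -- no boundary term.
  have h0 : (∫ x in Ioi (0 : ℝ), D x) + conj z₁ * z₂ = 0 := by
    refine IntegrableAtFilter.eq_zero_of_tendsto (μ := volume) ⟨Ioi 0, Ioi_mem_atTop 0, hPi⟩ ?_ hlim
    intro s hs
    obtain ⟨a, ha⟩ := mem_atTop_sets.1 hs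
    exact top_unique (Real.volume_Ici (a := a) ▸ measure_mono (fun x hx => ha x hx))
  rw [L2.inner_def, L2.inner_def,
    ← integral_add (L2.integrable_inner g₁ f₂) (L2.integrable_inner f₁ g₂), integral_congr_ae hDe]
  exact eq_neg_of_add_eq_zero_left h0

/-- The trace inequality. -/
lemma IsWeakDeriv.norm_trace_sq_le {f g : L2Half 𝕜} {z : 𝕜} (h : IsWeakDeriv f g)
    (t : HasTrace f z) : ‖z‖ ^ 2 ≤ 2 * (‖f‖ * ‖g‖) := by
  have h1 := h.inner_add_inner h t t
  have h2 : ‖inner 𝕜 g f + inner 𝕜 f g‖ ≤ 2 * (‖f‖ * ‖g‖) := by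
    refine (norm_add_le _ _).trans ?_
    have := norm_inner_le_norm (𝕜 := 𝕜) g f
    have := norm_inner_le_norm (𝕜 := 𝕜) f g
    linarith [mul_comm ‖f‖ ‖g‖]
  rw [h1, norm_neg, norm_mul, RCLike.norm_conj] at h2
  rwa [sq]

/-- Cauchy-Schwarz against the indicator of `(a, b]`. It makes primitives Hölder continuous of
exponent one half, the source of the equicontinuity used for compactness. -/
lemma L2Half.norm_intervalIntegral_le (g : L2Half 𝕜) {a b : ℝ} (ha : 0 ≤ a) (hab : a ≤ b) :
    ‖∫ t in a..b, g t‖ ≤ √(b - a) * ‖g‖ := by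
  have hsub : Ioc a b ⊆ Ioi (0 : ℝ) := fun x hx => ha.trans_lt hx.1
  have hμ : (volume.restrict (Ioi (0 : ℝ))) (Ioc a b) = ENNReal.ofReal (b - a) := by
    rw [Measure.restrict_apply measurableSet_Ioc, inter_eq_left.2 hsub, Real.volume_Ioc]
  have hμ' : (volume.restrict (Ioi (0 : ℝ))) (Ioc a b) ≠ ⊤ := by rw [hμ]; simp
  have h1 := L2.inner_indicatorConstLp_one (𝕜 := 𝕜) measurableSet_Ioc hμ' g
  rw [Measure.restrict_restrict measurableSet_Ioc, inter_eq_left.2 hsub] at h1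
  rw [intervalIntegral.integral_of_le hab, ← h1]
  refine (norm_inner_le_norm _ _).trans ?_
  rw [norm_indicatorConstLp (by norm_num) (by norm_num), norm_one, one_mul, Measure.real, hμ,
    ENNReal.toReal_ofReal (by linarith), Real.sqrt_eq_rpow]
  norm_num

lemma L2Half.norm_prim_sub_le (g : L2Half 𝕜) (z : 𝕜) {a b : ℝ} (ha : 0 ≤ a) (hb : 0 ≤ b) :
    ‖prim z g b - prim z g a‖ ≤ √|b - a| * ‖g‖ := by
  have h : ∀ {a b : ℝ}, 0 ≤ a → a ≤ b → ‖prim z g b - prim z g a‖ ≤ √|b - a| * ‖g‖ := by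
    intro a b ha hab
    rw [prim, prim, add_sub_add_left_eq_sub, intervalIntegral.integral_interval_sub_left
      (L2Half.intervalIntegrable g (ha.trans hab)) (L2Half.intervalIntegrable g ha),
      abs_of_nonneg (by linarith)]
    exact L2Half.norm_intervalIntegral_le g ha hab
  rcases le_total a b with hab | hab
  · exact h ha hab
  · rw [norm_sub_rev, abs_sub_comm]
    exact h hb hab

lemma memLp_mul_of_bounded (q : ℝ →ᵇ ℝ) (f : L2Half 𝕜) :
    MemLp (fun x => (q x : 𝕜) * f x) 2 (volume.restrict (Ioi (0 : ℝ))) :=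
  (Lp.memLp f).of_le_mul (c := ‖q‖)
    ((RCLike.continuous_ofReal.comp q.continuous).aestronglyMeasurable.mul (Lp.aestronglyMeasurable f))
    (.of_forall fun x => by
      rw [norm_mul, RCLike.norm_ofReal]
      exact mul_le_mul_of_nonneg_right (q.norm_coe_le_norm x) (norm_nonneg _))

/-- Multiplication by a bounded continuous function. -/
def mulOp (q : ℝ →ᵇ ℝ) : L2Half 𝕜 →L[𝕜] L2Half 𝕜 :=
  LinearMap.mkContinuous
    { toFun := fun f => (memLp_mul_of_bounded q f).toLp _
      map_add' := fun f g => by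
        rw [← MemLp.toLp_add]
        refine MemLp.toLp_congr _ _ ?_
        filter_upwards [Lp.coeFn_add f g] with x hx
        rw [hx, Pi.add_apply, Pi.add_apply, mul_add]
      map_smul' := fun c f => by
        rw [RingHom.id_apply, ← MemLp.toLp_const_smul]
        refine MemLp.toLp_congr _ _ ?_
        filter_upwards [Lp.coeFn_smul c f] with x hx
        rw [hx, Pi.smul_apply, Pi.smul_apply, smul_eq_mul, smul_eq_mul, mul_left_comm] } ‖q‖
    (fun f => by
      refine Lp.norm_le_mul_norm_of_ae_le_mul ?_
      filter_upwards [(memLp_mul_of_bounded q f).coeFn_toLp] with x hx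
      change ‖(memLp_mul_of_bounded q f).toLp _ x‖ ≤ _
      rw [hx, norm_mul, RCLike.norm_ofReal]
      exact mul_le_mul_of_nonneg_right (q.norm_coe_le_norm x) (norm_nonneg _))

lemma coeFn_mulOp (q : ℝ →ᵇ ℝ) (f : L2Half 𝕜) :
    mulOp q f =ᵐ[volume.restrict (Ioi (0 : ℝ))] fun x => (q x : 𝕜) * f x :=
  MemLp.coeFn_toLp (memLp_mul_of_bounded q f)

lemma norm_mulOp_le (q : ℝ →ᵇ ℝ) (f : L2Half 𝕜) : ‖mulOp q f‖ ≤ ‖q‖ * ‖f‖ :=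
  Lp.norm_le_mul_norm_of_ae_le_mul (by
    filter_upwards [coeFn_mulOp q f] with x hx
    rw [hx, norm_mul, RCLike.norm_ofReal]
    exact mul_le_mul_of_nonneg_right (q.norm_coe_le_norm x) (norm_nonneg _))

lemma inner_mulOp_left (q : ℝ →ᵇ ℝ) (f g : L2Half 𝕜) :
    inner 𝕜 (mulOp q f) g = ∫ x in Ioi (0 : ℝ), (q x : 𝕜) * inner 𝕜 (f x) (g x) := by
  rw [L2.inner_def]
  refine integral_congr_ae ?_
  filter_upwards [coeFn_mulOp q f] with x hx
  rw [hx]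
  simp only [RCLike.inner_apply, map_mul, RCLike.conj_ofReal]
  ring

lemma inner_mulOp_right (q : ℝ →ᵇ ℝ) (f g : L2Half 𝕜) :
    inner 𝕜 f (mulOp q g) = inner 𝕜 (mulOp q f) g := by
  rw [inner_mulOp_left, L2.inner_def]
  refine integral_congr_ae ?_
  filter_upwards [coeFn_mulOp q g] with x hx
  rw [hx]
  simp only [RCLike.inner_apply]
  ring

/-- The product rule for the product with a smooth bounded function. -/
lemma isWeakDeriv_mulOp {f g : L2Half 𝕜} (h : IsWeakDeriv f g) {q q' : ℝ →ᵇ ℝ}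
    (hq : ContDiff ℝ (⊤ : ℕ∞) q) (hq' : ∀ x, HasDerivAt q (q' x) x) :
    IsWeakDeriv (mulOp q f) (mulOp q' f + mulOp q g) := by
  intro ψ h1 h2 h3
  have hd : ∀ x, deriv (fun x => ψ x * q x) x = deriv ψ x * q x + ψ x * q' x := fun x =>
    (((h1.differentiable (by simp)).differentiableAt.hasDerivAt).mul (hq' x)).deriv
  have hc : HasCompactSupport (fun x => ψ x * q x) := h2.mul_right
  have key := h (fun x => ψ x * q x) (h1.mul hq) hc
    ((closure_mono (fun x hx => left_ne_zero_of_mul hx)).trans h3)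
  have i1 := integrableOn_smul_of_test f (ψ := fun x => deriv ψ x * q x)
    ((h1.continuous_deriv (by simp)).mul q.continuous) h2.deriv.mul_right
  have i2 := integrableOn_smul_of_test f (ψ := fun x => ψ x * q' x)
    (h1.continuous.mul q'.continuous) h2.mul_right
  have i3 := integrableOn_smul_of_test g (ψ := fun x => ψ x * q x)
    (h1.continuous.mul q.continuous) h2.mul_right
  simp only [hd, add_smul] at key
  rw [integral_add i1 i2] at key
  have e1 : ∫ x in Ioi (0 : ℝ), deriv ψ x • mulOp q f x =
      ∫ x in Ioi (0 : ℝ), (deriv ψ x * q x) • f x := by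
    refine integral_congr_ae ?_
    filter_upwards [coeFn_mulOp q f] with x hx
    rw [hx, mul_smul, RCLike.real_smul_eq_coe_mul (q x)]
  have e2 : ∫ x in Ioi (0 : ℝ), ψ x • (mulOp q' f + mulOp q g : L2Half 𝕜) x =
      (∫ x in Ioi (0 : ℝ), (ψ x * q' x) • f x) + ∫ x in Ioi (0 : ℝ), (ψ x * q x) • g x := by
    rw [← integral_add i2 i3]
    refine integral_congr_ae ?_
    filter_upwards [coeFn_mulOp q' f, coeFn_mulOp q g,
      Lp.coeFn_add (mulOp q' f) (mulOp q g)] with x hx hx' hx''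
    rw [hx'', Pi.add_apply, hx, hx', mul_smul, mul_smul, RCLike.real_smul_eq_coe_mul (q x),
      RCLike.real_smul_eq_coe_mul (q' x), smul_add]
  rw [e1, e2, eq_sub_of_add_eq key]
  ring

lemma hasTrace_mulOp {f : L2Half 𝕜} {z : 𝕜} (h : HasTrace f z) (q : ℝ →ᵇ ℝ) :
    HasTrace (mulOp q f) ((q 0 : 𝕜) * z) := by
  obtain ⟨F, h1, h2, h3⟩ := h
  have hc : Continuous fun x => (q x : 𝕜) := RCLike.continuous_ofReal.comp q.continuous
  refine ⟨fun x => (q x : 𝕜) * F x, ?_, hc.continuousOn.mul h2,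
    (hc.continuousAt.tendsto.mono_left nhdsWithin_le_nhds).mul h3⟩
  filter_upwards [h1, coeFn_mulOp q f] with x hx hx'
  rw [hx', hx]

/-- A lower bound for the energy on the half-line from a solution `q` of a Riccati equation. -/
lemma IsWeakDeriv.riccati_bound {f g : L2Half 𝕜} {z : 𝕜} (h : IsWeakDeriv f g) (t : HasTrace f z)
    {q q' V : ℝ →ᵇ ℝ} {ω : ℝ} (hq : ContDiff ℝ (⊤ : ℕ∞) q) (hq' : ∀ x, HasDerivAt q (q' x) x)
    (hV : ∀ x, q' x + q x ^ 2 = ω - V x) :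
    -(q 0 * ‖z‖ ^ 2) ≤ ‖g‖ ^ 2 + ω * ‖f‖ ^ 2 - RCLike.re (inner 𝕜 (mulOp V f) f) := by
  -- Integrating the derivative of `q |f|²` and replacing `q'` by the Riccati equation, the energy
  -- becomes `‖g - q f‖² - q 0 * ‖z‖²`; dropping the square gives the bound.
  have h1 := (isWeakDeriv_mulOp h hq hq').inner_add_inner h (hasTrace_mulOp t q) t
  have h2 : mulOp q' f = (ω : 𝕜) • f - mulOp V f - mulOp q (mulOp q f) := by
    refine Lp.ext ?_
    filter_upwards [coeFn_mulOp q' f, coeFn_mulOp V f, coeFn_mulOp q f,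
      coeFn_mulOp q (mulOp q f), Lp.coeFn_smul (ω : 𝕜) f,
      Lp.coeFn_sub ((ω : 𝕜) • f) (mulOp V f),
      Lp.coeFn_sub ((ω : 𝕜) • f - mulOp V f) (mulOp q (mulOp q f))] with x a1 a2 a3 a4 a5 a6 a7
    rw [a7, Pi.sub_apply, a6, Pi.sub_apply, a5, Pi.smul_apply, a1, a2, a4, a3, smul_eq_mul]
    have : (q' x : 𝕜) = ω - V x - q x * q x := by
      rw [← RCLike.ofReal_sub, ← RCLike.ofReal_mul, ← RCLike.ofReal_sub]
      congr 1
      linarith [hV x]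
    rw [this]
    ring
  have h3 := congrArg RCLike.re h1
  have h4 : RCLike.re (conj ((q 0 : 𝕜) * z) * z) = q 0 * ‖z‖ ^ 2 := by
    rw [map_mul (starRingEnd 𝕜), RCLike.conj_ofReal, mul_assoc, RCLike.re_ofReal_mul,
      RCLike.conj_mul,
      ← RCLike.ofReal_pow, RCLike.ofReal_re]
  have h5 : RCLike.re (inner 𝕜 (mulOp q (mulOp q f)) f) = ‖mulOp q f‖ ^ 2 := by
    rw [← inner_mulOp_right, inner_self_eq_norm_sq]
  have h6 : RCLike.re (inner 𝕜 (mulOp q g) f) = RCLike.re (inner 𝕜 (mulOp q f) g) := by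
    rw [← inner_mulOp_right, inner_re_symm]
  rw [map_neg, h4, h2, inner_add_left, inner_sub_left, inner_sub_left, inner_smul_left,
    RCLike.conj_ofReal] at h3
  simp only [map_add, map_sub, RCLike.re_ofReal_mul, inner_self_eq_norm_sq, h5, h6] at h3
  have h7 := norm_sub_sq (𝕜 := 𝕜) g (mulOp q f)
  rw [inner_re_symm] at h7
  nlinarith [sq_nonneg ‖g - mulOp q f‖]

end HalfLineForms

/-! ### The form domain, the quadratic form and its compactness. -/

section FormDomain

open ComplexConjugate
open scoped BoundedContinuousFunction

variable {𝕜 : Type*} [RCLike 𝕜]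

lemma L2Half.norm_prim_le (g : L2Half 𝕜) {z : 𝕜} {R x : ℝ} (hz : ‖z‖ ≤ R) (hg : ‖g‖ ≤ R)
    (hx : 0 ≤ x) : ‖prim z g x‖ ≤ R * (1 + √x) := by
  have h1 := L2Half.norm_prim_sub_le g z le_rfl hx
  rw [prim_zero, sub_zero, abs_of_nonneg hx] at h1
  have h2 := norm_le_norm_add_norm_sub z (prim z g x)
  rw [norm_sub_rev] at h2
  nlinarith [mul_le_mul_of_nonneg_left hg (Real.sqrt_nonneg x)]

/-- Bounded sequences in `H¹` have locally uniformly convergent subsequences. -/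
lemma exists_subseq_cauchySeq_prim {N : ℕ} {z : ℕ → Fin N → 𝕜} {g : ℕ → Fin N → L2Half 𝕜} {R : ℝ}
    (hz : ∀ n j, ‖z n j‖ ≤ R) (hg : ∀ n j, ‖g n j‖ ≤ R) :
    ∃ φ : ℕ → ℕ, StrictMono φ ∧ ∀ j x, 0 ≤ x →
      CauchySeq fun n => prim (z (φ n) j) (g (φ n) j) x := by
  -- Values at countably many points lie in a product of compact balls, which is sequentially
  -- compact. The absolute value of the rational keeps the points in the half-line.
  have hcomp : IsCompact (Set.univ.pi fun i : Fin N × ℚ =>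
      Metric.closedBall (0 : 𝕜) (R * (1 + √|(i.2 : ℝ)|))) :=
    isCompact_univ_pi fun i => isCompact_closedBall _ _
  obtain ⟨a, -, φ, hφ, ha⟩ := hcomp.tendsto_subseq
    (x := fun n i => prim (z n i.1) (g n i.1) |(i.2 : ℝ)|)
    (fun n i _ => by
      rw [mem_closedBall_zero_iff]
      exact L2Half.norm_prim_le _ (hz n i.1) (hg n i.1) (abs_nonneg _))
  refine ⟨φ, hφ, fun j x hx => ?_⟩
  have hR : 0 ≤ R := (norm_nonneg _).trans (hz 0 j)
  rw [Metric.cauchySeq_iff]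
  intro ε hε
  -- A rational point within `δ` of `x` changes each primitive by at most `√δ * R < ε / 3`; `R + 1`
  -- avoids dividing by zero.
  set δ : ℝ := (ε / (3 * (R + 1))) ^ 2 with hδ
  have hδ0 : 0 < δ := by positivity
  obtain ⟨q, hq1, hq2⟩ := exists_rat_btwn (show x < x + δ by linarith)
  have hq0 : 0 ≤ (q : ℝ) := by linarith
  have hcl : ∀ n, ‖prim (z (φ n) j) (g (φ n) j) x - prim (z (φ n) j) (g (φ n) j) q‖ < ε / 3 := by
    intro n
    refine (L2Half.norm_prim_sub_le _ _ hq0 hx).trans_lt ?_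
    have h1 : √|x - q| ≤ ε / (3 * (R + 1)) := by
      rw [← Real.sqrt_sq (show 0 ≤ ε / (3 * (R + 1)) by positivity), ← hδ]
      refine Real.sqrt_le_sqrt ?_
      rw [abs_sub_comm, abs_of_nonneg (by linarith)]
      linarith
    calc √|x - q| * ‖g (φ n) j‖ ≤ ε / (3 * (R + 1)) * R :=
          mul_le_mul h1 (hg _ _) (norm_nonneg _) (by positivity)
      _ < ε / (3 * (R + 1)) * (R + 1) := by
          refine mul_lt_mul_of_pos_left (by linarith) (by positivity)
      _ = ε / 3 := by field_simp
  have hc : CauchySeq fun n => prim (z (φ n) j) (g (φ n) j) q := by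
    have := (tendsto_pi_nhds.1 ha (j, q)).cauchySeq
    simpa only [Function.comp_apply, abs_of_nonneg hq0] using this
  obtain ⟨n₀, hn₀⟩ := Metric.cauchySeq_iff.1 hc (ε / 3) (by linarith)
  refine ⟨n₀, fun m hm n hn => ?_⟩
  have h1 := hcl m
  have h2 := hcl n
  have h3 := hn₀ m hm n hn
  rw [dist_eq_norm] at h3 ⊢
  rw [norm_sub_rev] at h2
  have h4 : prim (z (φ m) j) (g (φ m) j) x - prim (z (φ n) j) (g (φ n) j) x =
      (prim (z (φ m) j) (g (φ m) j) x - prim (z (φ m) j) (g (φ m) j) q) +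
      (prim (z (φ m) j) (g (φ m) j) q - prim (z (φ n) j) (g (φ n) j) q) +
      (prim (z (φ n) j) (g (φ n) j) q - prim (z (φ n) j) (g (φ n) j) x) := by ring
  rw [h4]
  refine (norm_add₃_le).trans_lt ?_
  linarith

/-- Dominated convergence for the potential energy of the differences. -/
lemma tendsto_integral_weight_mul_norm_prim_sub_sq {V : ℝ → ℝ} (hVc : Continuous V)
    (hV : IntegrableOn (fun x => |V x| * (1 + x)) (Ioi 0)) {z : ℕ → 𝕜} {g : ℕ → L2Half 𝕜} {R : ℝ}
    (hz : ∀ n, ‖z n‖ ≤ R) (hg : ∀ n, ‖g n‖ ≤ R)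
    (hc : ∀ x, 0 ≤ x → CauchySeq fun n => prim (z n) (g n) x) :
    Tendsto (fun p : ℕ × ℕ => ∫ x in Ioi (0 : ℝ),
      |V x| * ‖prim (z p.1) (g p.1) x - prim (z p.2) (g p.2) x‖ ^ 2) atTop (𝓝 0) := by
  have hcont : ∀ n, ContinuousOn (prim (z n) (g n)) (Ioi 0) := fun n =>
    (continuousOn_prim _ fun b hb => L2Half.intervalIntegrable (g n) hb).mono Ioi_subset_Ici_self
  have h0 : ∫ x in Ioi (0 : ℝ), (0 : ℝ) = 0 := by simp
  suffices h : Tendsto _ atTop (𝓝 (∫ x in Ioi (0 : ℝ), (0 : ℝ))) by rwa [h0] at h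
  -- Each primitive is at most `R * (1 + √x)`, so the squared difference is at most `4 R² (1 + √x)²
  -- ≤ 8 R² (1 + x)`. This growth is why the weight `1 + x` appears in the hypothesis on `V`.
  refine tendsto_integral_filter_of_dominated_convergence
    (fun x => 8 * R ^ 2 * (|V x| * (1 + x))) (.of_forall fun p => ?_) (.of_forall fun p => ?_)
    (hV.const_mul _) ?_
  · exact (hVc.abs.continuousOn.mul
      (((hcont p.1).sub (hcont p.2)).norm.pow 2)).aestronglyMeasurable measurableSet_Ioi
  · refine (ae_restrict_iff' measurableSet_Ioi).2 (.of_forall fun x hx => ?_)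
    have hx0 : 0 ≤ x := le_of_lt hx
    have h1 := L2Half.norm_prim_le (g p.1) (hz p.1) (hg p.1) hx0
    have h2 := L2Half.norm_prim_le (g p.2) (hz p.2) (hg p.2) hx0
    have h3 : ‖prim (z p.1) (g p.1) x - prim (z p.2) (g p.2) x‖ ≤ 2 * R * (1 + √x) :=
      (norm_sub_le _ _).trans (by linarith)
    have h4 : ‖prim (z p.1) (g p.1) x - prim (z p.2) (g p.2) x‖ ^ 2 ≤ 8 * R ^ 2 * (1 + x) := by
      refine (pow_le_pow_left₀ (norm_nonneg _) h3 2).trans ?_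
      have h5 := Real.sq_sqrt hx0
      have h6 : (1 + √x) ^ 2 ≤ 2 * (1 + x) := by nlinarith [sq_nonneg (1 - √x)]
      calc (2 * R * (1 + √x)) ^ 2 = 4 * R ^ 2 * (1 + √x) ^ 2 := by ring
        _ ≤ 4 * R ^ 2 * (2 * (1 + x)) := by gcongr
        _ = _ := by ring
    rw [Real.norm_of_nonneg (by positivity)]
    calc _ ≤ |V x| * (8 * R ^ 2 * (1 + x)) := by gcongr
      _ = _ := by ring
  · refine (ae_restrict_iff' measurableSet_Ioi).2 (.of_forall fun x hx => ?_)
    have h1 := (cauchySeq_iff_tendsto_dist_atTop_0.1 (hc x (le_of_lt hx)))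
    simp only [dist_eq_norm] at h1
    have h2 := (h1.pow 2).const_mul |V x|
    simpa using h2

/-- The boundary value, with value `0` if there is none. -/
def trace (f : L2Half 𝕜) : 𝕜 := by
  classical exact if h : ∃ z, HasTrace f z then h.choose else 0

lemma HasTrace.trace_eq {f : L2Half 𝕜} {z : 𝕜} (h : HasTrace f z) : trace f = z := by
  have h' : ∃ z, HasTrace f z := ⟨z, h⟩
  rw [trace, dif_pos h']
  exact h'.choose_spec.unique h

lemma IsWeakDeriv.hasTrace_trace {f g : L2Half 𝕜} (h : IsWeakDeriv f g) : HasTrace f (trace f) := by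
  obtain ⟨z, hz⟩ := h.exists_hasTrace
  rwa [hz.trace_eq]

/-- The form domain `H¹(Γ)`, as the space of pairs of a function and its weak derivative. -/
def H1Graph (𝕜 : Type*) [RCLike 𝕜] (N : ℕ) : Submodule 𝕜 (L2Graph 𝕜 N × L2Graph 𝕜 N) where
  carrier := {u | ∀ j, IsWeakDeriv (u.1 j) (u.2 j)}
  add_mem' h h' j := (h j).add (h' j)
  zero_mem' _ := isWeakDeriv_zero
  smul_mem' c _ h j := (h j).smul c

variable {N : ℕ}

/-- Integrals against test functions are continuous functionals on `L²`, so weak differentiability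
is a closed condition and the form domain is complete. -/
lemma integral_smul_eq_inner {χ : ℝ → ℝ} (h1 : Continuous χ) (h2 : HasCompactSupport χ) :
    ∃ k : L2Half 𝕜, ∀ f : L2Half 𝕜, ∫ x in Ioi (0 : ℝ), χ x • f x = inner 𝕜 k f := by
  have hm : MemLp (fun x => (χ x : 𝕜)) 2 (volume.restrict (Ioi (0 : ℝ))) :=
    ((h1.memLp_of_hasCompactSupport h2).restrict _).ofReal
  refine ⟨hm.toLp _, fun f => ?_⟩
  rw [L2.inner_def]
  refine integral_congr_ae ?_
  filter_upwards [hm.coeFn_toLp] with x hx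
  rw [hx, RCLike.inner_apply, RCLike.conj_ofReal, RCLike.real_smul_eq_coe_mul, mul_comm]

lemma isClosed_H1Graph : IsClosed (H1Graph 𝕜 N : Set (L2Graph 𝕜 N × L2Graph 𝕜 N)) := by
  have : (H1Graph 𝕜 N : Set (L2Graph 𝕜 N × L2Graph 𝕜 N)) =
      {u | ∀ j, IsWeakDeriv (u.1 j) (u.2 j)} := rfl
  rw [this]
  simp only [IsWeakDeriv, ofPred_forall]
  refine isClosed_iInter fun j => isClosed_iInter fun ψ => isClosed_iInter fun h1 =>
    isClosed_iInter fun h2 => isClosed_iInter fun _ => ?_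
  obtain ⟨k, hk⟩ := integral_smul_eq_inner (𝕜 := 𝕜) h1.continuous h2
  obtain ⟨k', hk'⟩ := integral_smul_eq_inner (𝕜 := 𝕜)
    (h1.continuous_deriv (n := (⊤ : ℕ∞)) (by simp)) h2.deriv
  simp only [hk, hk']
  refine isClosed_eq ?_ ?_ <;> fun_prop

instance : CompleteSpace (H1Graph 𝕜 N) := isClosed_H1Graph.completeSpace_coe

/-- The sum of the boundary values. -/
def traceSum : H1Graph 𝕜 N →ₗ[𝕜] 𝕜 where
  toFun u := ∑ j, trace (u.1.1 j)
  map_add' u w := by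
    rw [← Finset.sum_add_distrib]
    exact Finset.sum_congr rfl fun j _ =>
      ((u.2 j).hasTrace_trace.add (w.2 j).hasTrace_trace).trace_eq
  map_smul' c u := by
    rw [RingHom.id_apply, smul_eq_mul, Finset.mul_sum]
    exact Finset.sum_congr rfl fun j _ => ((u.2 j).hasTrace_trace.smul c).trace_eq

lemma traceSum_apply (u : H1Graph 𝕜 N) : traceSum u = ∑ j, trace (u.1.1 j) := rfl

/-- The quadratic form of `-f'' + (ω - V) f` on one edge, without boundary terms. -/
def edgeForm (ω : ℝ) (V : ℝ →ᵇ ℝ) (f g f' g' : L2Half 𝕜) : 𝕜 :=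
  inner 𝕜 g g' + (ω : 𝕜) * inner 𝕜 f f' - inner 𝕜 (mulOp V f) f'

/-- The quadratic form of `-Δ_β + ω - V`. -/
def graphForm (β ω : ℝ) (V : Fin N → ℝ →ᵇ ℝ) : H1Graph 𝕜 N →ₗ⋆[𝕜] H1Graph 𝕜 N →ₗ[𝕜] 𝕜 :=
  LinearMap.mk₂'ₛₗ (starRingEnd 𝕜) (RingHom.id 𝕜)
    -- Integration by parts on the edges leaves `conj d * traceSum w`, where `d` is the common
    -- derivative at the vertex; on the operator domain `d` equals `β⁻¹ * traceSum u`, whence the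
    -- last term.
    (fun u w => (∑ j, edgeForm ω (V j) (u.1.1 j) (u.1.2 j) (w.1.1 j) (w.1.2 j))
      + ((β⁻¹ : ℝ) : 𝕜) * (conj (traceSum u) * traceSum w))
    (fun u u' w => by
      have : ∀ j, edgeForm ω (V j) ((u + u').1.1 j) ((u + u').1.2 j) (w.1.1 j) (w.1.2 j) =
          edgeForm ω (V j) (u.1.1 j) (u.1.2 j) (w.1.1 j) (w.1.2 j) +
          edgeForm ω (V j) (u'.1.1 j) (u'.1.2 j) (w.1.1 j) (w.1.2 j) := fun j => by
        simp only [edgeForm, Submodule.coe_add, Prod.fst_add, Prod.snd_add, PiLp.add_apply,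
          map_add, inner_add_left]
        ring
      simp only [this, map_add, Finset.sum_add_distrib]
      ring)
    (fun c u w => by
      have : ∀ j, edgeForm ω (V j) ((c • u).1.1 j) ((c • u).1.2 j) (w.1.1 j) (w.1.2 j) =
          conj c * edgeForm ω (V j) (u.1.1 j) (u.1.2 j) (w.1.1 j) (w.1.2 j) := fun j => by
        simp only [edgeForm, Submodule.coe_smul, Prod.smul_fst, Prod.smul_snd, PiLp.smul_apply,
          map_smul, inner_smul_left]
        ring
      simp only [this, map_smul, ← Finset.mul_sum, smul_eq_mul, map_mul]
      ring)
    (fun u w w' => by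
      have : ∀ j, edgeForm ω (V j) (u.1.1 j) (u.1.2 j) ((w + w').1.1 j) ((w + w').1.2 j) =
          edgeForm ω (V j) (u.1.1 j) (u.1.2 j) (w.1.1 j) (w.1.2 j) +
          edgeForm ω (V j) (u.1.1 j) (u.1.2 j) (w'.1.1 j) (w'.1.2 j) := fun j => by
        simp only [edgeForm, Submodule.coe_add, Prod.fst_add, Prod.snd_add, PiLp.add_apply,
          inner_add_right]
        ring
      simp only [this, map_add, Finset.sum_add_distrib]
      ring)
    (fun c u w => by
      have : ∀ j, edgeForm ω (V j) (u.1.1 j) (u.1.2 j) ((c • w).1.1 j) ((c • w).1.2 j) =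
          c * edgeForm ω (V j) (u.1.1 j) (u.1.2 j) (w.1.1 j) (w.1.2 j) := fun j => by
        simp only [edgeForm, Submodule.coe_smul, Prod.smul_fst, Prod.smul_snd, PiLp.smul_apply,
          inner_smul_right]
        ring
      simp only [this, map_smul, ← Finset.mul_sum, smul_eq_mul, RingHom.id_apply]
      ring)

lemma graphForm_apply (β ω : ℝ) (V : Fin N → ℝ →ᵇ ℝ) (u w : H1Graph 𝕜 N) :
    graphForm β ω V u w = (∑ j, edgeForm ω (V j) (u.1.1 j) (u.1.2 j) (w.1.1 j) (w.1.2 j))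
      + ((β⁻¹ : ℝ) : 𝕜) * (conj (traceSum u) * traceSum w) := rfl

lemma conj_edgeForm (ω : ℝ) (V : ℝ →ᵇ ℝ) (f g f' g' : L2Half 𝕜) :
    conj (edgeForm ω V f g f' g') = edgeForm ω V f' g' f g := by
  simp only [edgeForm, map_add, map_sub, map_mul, inner_conj_symm, RCLike.conj_ofReal,
    inner_mulOp_right]

lemma re_edgeForm_self (ω : ℝ) (V : ℝ →ᵇ ℝ) (f g : L2Half 𝕜) :
    RCLike.re (edgeForm ω V f g f g) =
      ‖g‖ ^ 2 + ω * ‖f‖ ^ 2 - RCLike.re (inner 𝕜 (mulOp V f) f) := by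
  simp only [edgeForm, map_add, map_sub, RCLike.re_ofReal_mul, inner_self_eq_norm_sq]

lemma re_graphForm_self (β ω : ℝ) (V : Fin N → ℝ →ᵇ ℝ) (u : H1Graph 𝕜 N) :
    RCLike.re (graphForm β ω V u u) = (∑ j, (‖u.1.2 j‖ ^ 2 + ω * ‖u.1.1 j‖ ^ 2
      - RCLike.re (inner 𝕜 (mulOp (V j) (u.1.1 j)) (u.1.1 j)))) + β⁻¹ * ‖traceSum u‖ ^ 2 := by
  rw [graphForm_apply, map_add, map_sum, RCLike.re_ofReal_mul, RCLike.conj_mul,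
    ← RCLike.ofReal_pow, RCLike.ofReal_re]
  simp only [re_edgeForm_self]

lemma norm_traceSum_sq_le (u : H1Graph 𝕜 N) :
    ‖traceSum u‖ ^ 2 ≤ ∑ j, 2 * N * (‖u.1.1 j‖ * ‖u.1.2 j‖) := by
  calc ‖traceSum u‖ ^ 2 ≤ (∑ j, ‖trace (u.1.1 j)‖) ^ 2 := by
        rw [traceSum_apply]
        exact pow_le_pow_left₀ (norm_nonneg _) (norm_sum_le _ _) 2
    _ ≤ N * ∑ j, ‖trace (u.1.1 j)‖ ^ 2 := by
        simpa using sq_sum_le_card_mul_sum_sq (s := Finset.univ)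
          (f := fun j => ‖trace (u.1.1 j)‖)
    _ ≤ _ := by
        rw [Finset.mul_sum]
        refine Finset.sum_le_sum fun j _ => ?_
        have := (u.2 j).norm_trace_sq_le (u.2 j).hasTrace_trace
        calc _ ≤ (N : ℝ) * (2 * (‖u.1.1 j‖ * ‖u.1.2 j‖)) := by gcongr
          _ = _ := by ring

lemma re_inner_mulOp_le (V : ℝ →ᵇ ℝ) (f : L2Half 𝕜) :
    |RCLike.re (inner 𝕜 (mulOp V f) f)| ≤ ‖V‖ * ‖f‖ ^ 2 := by
  refine (RCLike.abs_re_le_norm _).trans ((norm_inner_le_norm _ _).trans ?_)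
  calc _ ≤ ‖V‖ * ‖f‖ * ‖f‖ := by gcongr; exact norm_mulOp_le V f
    _ = _ := by ring

lemma H1Graph.norm_sq_le (u : H1Graph 𝕜 N) : ‖u‖ ^ 2 ≤ ∑ j, (‖u.1.1 j‖ ^ 2 + ‖u.1.2 j‖ ^ 2) := by
  have h1 : ‖u‖ = max ‖u.1.1‖ ‖u.1.2‖ := rfl
  rw [Finset.sum_add_distrib, ← PiLp.norm_sq_eq_of_L2, ← PiLp.norm_sq_eq_of_L2, h1]
  rcases max_choice ‖u.1.1‖ ‖u.1.2‖ with h | h <;> rw [h]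
  · linarith [sq_nonneg ‖u.1.2‖]
  · linarith [sq_nonneg ‖u.1.1‖]

lemma H1Graph.norm_fst_apply_le (u : H1Graph 𝕜 N) (j : Fin N) : ‖u.1.1 j‖ ≤ ‖u‖ :=
  (PiLp.norm_apply_le u.1.1 j).trans (le_max_left ‖u.1.1‖ ‖u.1.2‖)

lemma H1Graph.norm_snd_apply_le (u : H1Graph 𝕜 N) (j : Fin N) : ‖u.1.2 j‖ ≤ ‖u‖ :=
  (PiLp.norm_apply_le u.1.2 j).trans (le_max_right ‖u.1.1‖ ‖u.1.2‖)

/-- The embedding of `H¹(Γ)` into `L²(Γ)`. -/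
def H1Graph.toL2 (𝕜 : Type*) [RCLike 𝕜] (N : ℕ) : H1Graph 𝕜 N →L[𝕜] L2Graph 𝕜 N :=
  (ContinuousLinearMap.fst 𝕜 _ _).comp (H1Graph 𝕜 N).subtypeL

lemma H1Graph.toL2_apply (u : H1Graph 𝕜 N) : H1Graph.toL2 𝕜 N u = u.1.1 := rfl

/-- The part `‖u'‖² + ω ‖u‖²` controls the norm of `H¹`, and the rest is compact relative to it:
along a subsequence of a bounded sequence the traces converge and the functions converge pointwise,
so by the decay of `V` the potential and vertex terms of the differences tend to zero. -/
theorem isCompactGarding_graphForm (β : ℝ) {ω : ℝ} (hω : 0 < ω) {V : Fin N → ℝ →ᵇ ℝ}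
    (hV : ∀ j, IntegrableOn (fun x => |V j x| * (1 + x)) (Ioi 0)) :
    IsCompactGarding (H1Graph.toL2 𝕜 N) (graphForm β ω V) := by
  refine ⟨fun u w => ?_, ?_, ?_, ?_⟩
  · simp only [graphForm_apply, map_add, map_sum, map_mul, conj_edgeForm, RCLike.conj_ofReal,
      RCLike.conj_conj]
    ring
  · refine ⟨(∑ j, (1 + ω + ‖V j‖)) + |β⁻¹| * ∑ _j : Fin N, 2 * (N : ℝ), fun u => ?_⟩
    rw [re_graphForm_self, add_mul, Finset.sum_mul, mul_assoc, Finset.sum_mul]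
    refine add_le_add (Finset.sum_le_sum fun j _ => ?_) ?_
    · have h1 := pow_le_pow_left₀ (norm_nonneg _) (H1Graph.norm_fst_apply_le u j) 2
      have h2 := pow_le_pow_left₀ (norm_nonneg _) (H1Graph.norm_snd_apply_le u j) 2
      have h3 := (abs_le.1 (re_inner_mulOp_le (V j) (u.1.1 j))).1
      have h4 := mul_le_mul_of_nonneg_left h1 hω.le
      have h5 := mul_le_mul_of_nonneg_left h1 (norm_nonneg (V j))
      linarith
    · refine (mul_le_mul_of_nonneg_right (le_abs_self _) (sq_nonneg _)).trans ?_
      refine mul_le_mul_of_nonneg_left ((norm_traceSum_sq_le u).trans ?_) (abs_nonneg _)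
      refine Finset.sum_le_sum fun j _ => mul_le_mul_of_nonneg_left ?_ (by positivity)
      rw [sq]
      exact mul_le_mul (H1Graph.norm_fst_apply_le u j) (H1Graph.norm_snd_apply_le u j) (norm_nonneg _)
        (norm_nonneg _)
  -- Young's inequality `2 b ‖f‖ ‖g‖ ≤ ‖g‖² / 2 + 2 b² ‖f‖²` with `b = |β⁻¹| * N` absorbs the vertex
  -- term; the sum of the `‖V j‖` pays for the potential and the final `1` for the `L²` part of the
  -- norm.
  · set M : ℝ := (∑ j, ‖V j‖) + 2 * (|β⁻¹| * N) ^ 2 + 1 with hM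
    refine ⟨1 / 2, by norm_num, M, fun u => ?_⟩
    rw [re_graphForm_self, H1Graph.toL2_apply, PiLp.norm_sq_eq_of_L2]
    have h1 : -(|β⁻¹| * ∑ j, 2 * N * (‖u.1.1 j‖ * ‖u.1.2 j‖)) ≤ β⁻¹ * ‖traceSum u‖ ^ 2 := by
      have h2 := mul_le_mul_of_nonneg_left (norm_traceSum_sq_le u) (abs_nonneg β⁻¹)
      have h3 := mul_le_mul_of_nonneg_right (neg_abs_le β⁻¹) (sq_nonneg ‖traceSum u‖)
      linarith
    have h4 : 1 / 2 * ‖u‖ ^ 2 ≤ ∑ j, 1 / 2 * (‖u.1.1 j‖ ^ 2 + ‖u.1.2 j‖ ^ 2) := by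
      rw [← Finset.mul_sum]
      exact mul_le_mul_of_nonneg_left (H1Graph.norm_sq_le u) (by norm_num)
    refine h4.trans (le_trans ?_ (add_le_add_left (add_le_add_right h1 _) _))
    rw [Finset.mul_sum, ← sub_eq_add_neg, Finset.mul_sum, ← Finset.sum_sub_distrib,
      ← Finset.sum_add_distrib]
    refine Finset.sum_le_sum fun j _ => ?_
    have h5 := (abs_le.1 (re_inner_mulOp_le (V j) (u.1.1 j))).2
    have h6 : ‖V j‖ * ‖u.1.1 j‖ ^ 2 ≤ (∑ j, ‖V j‖) * ‖u.1.1 j‖ ^ 2 :=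
      mul_le_mul_of_nonneg_right (Finset.single_le_sum (f := fun j => ‖V j‖)
        (fun _ _ => norm_nonneg _) (Finset.mem_univ j)) (sq_nonneg _)
    have h7 : 0 ≤ ω * ‖u.1.1 j‖ ^ 2 := by positivity
    nlinarith [sq_nonneg (‖u.1.2 j‖ - 2 * (|β⁻¹| * N) * ‖u.1.1 j‖)]
  · refine ⟨min 1 ω, lt_min one_pos hω, fun u ⟨R, hR⟩ => ?_⟩
    have hR0 : 0 ≤ R := (norm_nonneg _).trans (hR 0)
    have hg : ∀ n j, ‖(u n).1.2 j‖ ≤ 2 * R := fun n j =>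
      (H1Graph.norm_snd_apply_le (u n) j).trans ((hR n).trans (by linarith))
    have hz : ∀ n j, ‖trace ((u n).1.1 j)‖ ≤ 2 * R := by
      intro n j
      have h1 := ((u n).2 j).norm_trace_sq_le ((u n).2 j).hasTrace_trace
      have h2 := mul_le_mul ((H1Graph.norm_fst_apply_le (u n) j).trans (hR n))
        ((H1Graph.norm_snd_apply_le (u n) j).trans (hR n)) (norm_nonneg _) hR0
      refine le_of_sq_le_sq ?_ (by linarith)
      nlinarith
    obtain ⟨φ, hφ, hc⟩ := exists_subseq_cauchySeq_prim hz hg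
    refine ⟨φ, hφ, fun ε hε => ?_⟩
    have hdiff : ∀ n m j, ((u (φ n) - u (φ m)).1.1 j) =ᵐ[volume.restrict (Ioi (0 : ℝ))]
        fun x => prim (trace ((u (φ n)).1.1 j)) ((u (φ n)).1.2 j) x -
          prim (trace ((u (φ m)).1.1 j)) ((u (φ m)).1.2 j) x := by
      intro n m j
      filter_upwards [((u (φ n)).2 j).ae_eq_prim ((u (φ n)).2 j).hasTrace_trace,
        ((u (φ m)).2 j).ae_eq_prim ((u (φ m)).2 j).hasTrace_trace,
        Lp.coeFn_sub ((u (φ n)).1.1 j) ((u (φ m)).1.1 j)] with x h1 h2 h3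
      rw [← h1, ← h2]
      exact h3
    have hpot : ∀ n m j, RCLike.re (inner 𝕜 (mulOp (V j) ((u (φ n) - u (φ m)).1.1 j))
        ((u (φ n) - u (φ m)).1.1 j)) ≤ ∫ x in Ioi (0 : ℝ),
          |V j x| * ‖prim (trace ((u (φ n)).1.1 j)) ((u (φ n)).1.2 j) x -
          prim (trace ((u (φ m)).1.1 j)) ((u (φ m)).1.2 j) x‖ ^ 2 := by
      intro n m j
      refine (RCLike.re_le_norm _).trans ?_
      rw [inner_mulOp_left]
      refine (norm_integral_le_integral_norm _).trans (le_of_eq (integral_congr_ae ?_))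
      filter_upwards [hdiff n m j] with x hx
      rw [hx, norm_mul, RCLike.norm_ofReal, inner_self_eq_norm_sq_to_K, norm_pow,
        RCLike.norm_ofReal, abs_norm]
    have ht : Tendsto (fun p : ℕ × ℕ => (∑ j, ∫ x in Ioi (0 : ℝ),
          |V j x| * ‖prim (trace ((u (φ p.1)).1.1 j)) ((u (φ p.1)).1.2 j) x -
          prim (trace ((u (φ p.2)).1.1 j)) ((u (φ p.2)).1.2 j) x‖ ^ 2) +
          |β⁻¹| * ‖traceSum (u (φ p.1)) - traceSum (u (φ p.2))‖ ^ 2) atTop (𝓝 0) := by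
      have h1 := tendsto_finsetSum Finset.univ fun j (_ : j ∈ Finset.univ) =>
        tendsto_integral_weight_mul_norm_prim_sub_sq (V j).continuous (hV j)
          (fun n => hz (φ n) j) (fun n => hg (φ n) j) (hc j)
      have h2 : CauchySeq fun n => traceSum (u (φ n)) := by
        have h3 : ∀ j, ∃ a, Tendsto (fun n => trace ((u (φ n)).1.1 j)) atTop (𝓝 a) := fun j => by
          have := hc j 0 le_rfl
          simp only [prim_zero] at this
          exact cauchySeq_tendsto_of_complete this
        choose a ha using h3
        exact (tendsto_finsetSum Finset.univ fun j _ => ha j).cauchySeq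
      have h4 := cauchySeq_iff_tendsto_dist_atTop_0.1 h2
      simp only [dist_eq_norm] at h4
      have h5 := h1.add ((h4.pow 2).const_mul |β⁻¹|)
      simpa using h5
    obtain ⟨⟨n₁, n₂⟩, hn⟩ := eventually_atTop.1 (ht.eventually (gt_mem_nhds hε))
    refine ⟨max n₁ n₂, fun n hn' m hm' => ?_⟩
    have h1 := hn (n, m) ⟨(le_max_left _ _).trans hn', (le_max_right _ _).trans hm'⟩
    rw [re_graphForm_self]
    set w := u (φ n) - u (φ m) with hw
    have h2 : min 1 ω * ‖w‖ ^ 2 ≤ ∑ j, (‖w.1.2 j‖ ^ 2 + ω * ‖w.1.1 j‖ ^ 2) := by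
      refine (mul_le_mul_of_nonneg_left (H1Graph.norm_sq_le w) (lt_min one_pos hω).le).trans ?_
      rw [Finset.mul_sum]
      refine Finset.sum_le_sum fun j _ => ?_
      have h3 := mul_le_mul_of_nonneg_right (min_le_left 1 ω) (sq_nonneg ‖w.1.2 j‖)
      have h4 := mul_le_mul_of_nonneg_right (min_le_right 1 ω) (sq_nonneg ‖w.1.1 j‖)
      linarith
    have h5 : -(|β⁻¹| * ‖traceSum (u (φ n)) - traceSum (u (φ m))‖ ^ 2) ≤
        β⁻¹ * ‖traceSum w‖ ^ 2 := by
      rw [hw, map_sub, ← neg_mul]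
      exact mul_le_mul_of_nonneg_right (neg_abs_le _) (sq_nonneg _)
    have h6 := Finset.sum_le_sum fun j (_ : j ∈ Finset.univ) => hpot n m j
    simp only [Finset.sum_sub_distrib]
    simp only at h1
    linarith

end FormDomain

/-! ### The Morse index and dimensions of subspaces. -/

section IndexBounds

open scoped DirectSum

variable {𝕜 E : Type*} [RCLike 𝕜] [NormedAddCommGroup E] [InnerProductSpace 𝕜 E]

lemma morseIndex_eq_toENat_rank (L : E →ₗ.[𝕜] E) :
    morseIndex L = Cardinal.toENat (Module.rank 𝕜 (⨁ l : Iio (0 : ℝ), eigenspace L l)) := by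
  rw [morseIndex, rank_directSum]

/-- Orthonormal eigenvectors for negative eigenvalues bound the Morse index from below. -/
lemma le_morseIndex {L : E →ₗ.[𝕜] E} {n : ℕ} {v : Fin n → E} {l : Fin n → ℝ} (hl : ∀ i, l i < 0)
    (ho : Orthonormal 𝕜 v) (hv : ∀ i, v i ∈ eigenspace L (l i)) : (n : ℕ∞) ≤ morseIndex L := by
  classical
  rw [morseIndex_eq_toENat_rank, Cardinal.natCast_le_toENat]
  let w : Fin n → ⨁ l : Iio (0 : ℝ), eigenspace L l := fun i =>
    DirectSum.lof 𝕜 (Iio (0 : ℝ)) (fun l => eigenspace L l) ⟨l i, hl i⟩ ⟨v i, hv i⟩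
  have hw : LinearIndependent 𝕜 w := by
    refine LinearIndependent.of_comp (DirectSum.coeLinearMap fun l : Iio (0 : ℝ) => eigenspace L l) ?_
    convert! ho.linearIndependent using 1
    ext i
    exact DirectSum.coeLinearMap_lof _ _ _
  simpa using hw.cardinal_lift_le_rank

/-- If `L` is symmetric and nonnegative on the kernel of a map into an `m`-dimensional space, then
its Morse index is at most `m`. -/
lemma morseIndex_le {L : E →ₗ.[𝕜] E} (hL : ∀ v w : L.domain, inner 𝕜 (L v) (w : E) = inner 𝕜 (v : E) (L w))
    {m : ℕ} (T : L.domain →ₗ[𝕜] (Fin m → 𝕜))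
    (hT : ∀ v, T v = 0 → 0 ≤ RCLike.re (inner 𝕜 (L v) (v : E))) : morseIndex L ≤ m := by
  classical
  rw [morseIndex_eq_toENat_rank, Cardinal.toENat_le_natCast]
  let Ψ : (⨁ l : Iio (0 : ℝ), eigenspace L l) →ₗ[𝕜] L.domain :=
    DirectSum.toModule 𝕜 (Iio (0 : ℝ)) L.domain
      fun l => Submodule.inclusion (fun v hv => hv.1 : eigenspace L l ≤ L.domain)
  have hΨ : ∀ x, Ψ x = ∑ l ∈ x.support, Submodule.inclusion
      (fun v hv => hv.1 : eigenspace L l ≤ L.domain) (x l) := by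
    intro x
    conv_lhs => rw [← DirectSum.sum_support_of x]
    rw [map_sum]
    refine Finset.sum_congr rfl fun l _ => ?_
    exact DirectSum.toModule_lof _ _ _
  have horth : ∀ (l l' : Iio (0 : ℝ)) (v : eigenspace L l) (w : eigenspace L l'), l ≠ l' →
      inner 𝕜 (v : E) (w : E) = 0 := by
    rintro ⟨l, hl⟩ ⟨l', hl'⟩ ⟨v, hv, ev⟩ ⟨w, hw, ew⟩ hne
    have h := hL ⟨v, hv⟩ ⟨w, hw⟩
    rw [ev, ew] at h
    simp only [inner_smul_left, inner_smul_right, RCLike.conj_ofReal] at h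
    rw [← sub_eq_zero, ← sub_mul, ← RCLike.ofReal_sub] at h
    rcases mul_eq_zero.1 h with h | h
    · exact absurd (Subtype.ext (sub_eq_zero.1 (by exact_mod_cast h))) hne
    · exact h
  -- Eigenspaces for distinct eigenvalues are orthogonal, so on a sum of eigenvectors the form
  -- equals `∑ l ‖x l‖²` with all `l < 0`. On the kernel of `T` it is also nonnegative, hence every
  -- component vanishes.
  have hinj : Function.Injective (T ∘ₗ Ψ) := by
    refine LinearMap.ker_eq_bot.1 (LinearMap.ker_eq_bot'.2 fun x hx => ?_)
    have h1 := hT (Ψ x) hx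
    have h2 : L (Ψ x) = ∑ l ∈ x.support, ((l : ℝ) : 𝕜) • (x l : E) := by
      rw [hΨ]
      change L.toFun _ = _
      rw [map_sum]
      exact Finset.sum_congr rfl fun l _ => (x l).2.2
    have h3 : ((Ψ x : L.domain) : E) = ∑ l ∈ x.support, (x l : E) := by
      rw [hΨ, AddSubmonoidClass.coe_finsetSum]
      rfl
    rw [h2, h3, sum_inner, map_sum] at h1
    have h4 : ∀ l ∈ x.support, RCLike.re (inner 𝕜 (((l : ℝ) : 𝕜) • (x l : E))
        (∑ l ∈ x.support, (x l : E))) = (l : ℝ) * ‖(x l : E)‖ ^ 2 := by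
      intro l hl
      rw [inner_sum, Finset.sum_eq_single l, inner_smul_left, RCLike.conj_ofReal,
        RCLike.re_ofReal_mul, inner_self_eq_norm_sq]
      · intro l' _ hne
        rw [inner_smul_left, horth _ _ _ _ hne.symm, mul_zero]
      · exact fun h => absurd hl h
    rw [Finset.sum_congr rfl h4] at h1
    have h5 : ∀ l ∈ x.support, (l : ℝ) * ‖(x l : E)‖ ^ 2 ≤ 0 := fun l _ =>
      mul_nonpos_of_nonpos_of_nonneg (le_of_lt l.2) (sq_nonneg _)
    have h6 := (Finset.sum_eq_zero_iff_of_nonpos h5).1 (le_antisymm (Finset.sum_nonpos h5) h1)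
    refine DFinsupp.support_eq_empty.1 (Finset.eq_empty_of_forall_notMem fun l hl => ?_)
    rcases mul_eq_zero.1 (h6 l hl) with h | h
    · exact (ne_of_lt l.2) h
    · exact (DFinsupp.mem_support_iff.1 hl) (by simpa using h)
  simpa [-rank_directSum] using LinearMap.lift_rank_le_of_injective _ hinj

end IndexBounds

/-! ### The operator and its form. -/

section Operator

open ComplexConjugate
open scoped BoundedContinuousFunction

variable {𝕜 : Type*} [RCLike 𝕜]

/-- The `L²` class of a real function on the half-line. -/
def ofFun (𝕜 : Type*) [RCLike 𝕜] (F : ℝ → ℝ) (hF : MemLp F 2 (volume.restrict (Ioi (0 : ℝ)))) :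
    L2Half 𝕜 :=
  (hF.ofReal : MemLp (fun x => (F x : 𝕜)) 2 (volume.restrict (Ioi (0 : ℝ)))).toLp _

lemma coeFn_ofFun {F : ℝ → ℝ} (hF : MemLp F 2 (volume.restrict (Ioi (0 : ℝ)))) :
    ofFun 𝕜 F hF =ᵐ[volume.restrict (Ioi (0 : ℝ))] fun x => (F x : 𝕜) :=
  MemLp.coeFn_toLp _

lemma inner_ofFun {F G : ℝ → ℝ} (hF : MemLp F 2 (volume.restrict (Ioi (0 : ℝ))))
    (hG : MemLp G 2 (volume.restrict (Ioi (0 : ℝ)))) :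
    inner 𝕜 (ofFun 𝕜 F hF) (ofFun 𝕜 G hG) = ((∫ x in Ioi (0 : ℝ), F x * G x : ℝ) : 𝕜) := by
  rw [L2.inner_def, ← integral_ofReal]
  refine integral_congr_ae ?_
  filter_upwards [coeFn_ofFun (𝕜 := 𝕜) hF, coeFn_ofFun (𝕜 := 𝕜) hG] with x h1 h2
  rw [h1, h2, RCLike.inner_apply, RCLike.conj_ofReal, RCLike.ofReal_mul, mul_comm]

lemma ofFun_ae_eq_prim {F G : ℝ → ℝ} (hF : MemLp F 2 (volume.restrict (Ioi (0 : ℝ))))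
    (hG : MemLp G 2 (volume.restrict (Ioi (0 : ℝ)))) (hd : ∀ x, HasDerivAt F (G x) x)
    (hc : Continuous G) :
    ofFun 𝕜 F hF =ᵐ[volume.restrict (Ioi (0 : ℝ))] prim (F 0 : 𝕜) (ofFun 𝕜 G hG) := by
  filter_upwards [coeFn_ofFun (𝕜 := 𝕜) hF, ae_restrict_mem measurableSet_Ioi] with x h1 hx
  have hx0 : (0 : ℝ) ≤ x := le_of_lt hx
  have h2 : ∫ t in (0 : ℝ)..x, ofFun 𝕜 G hG t = ∫ t in (0 : ℝ)..x, (G t : 𝕜) := by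
    rw [intervalIntegral.integral_of_le hx0, intervalIntegral.integral_of_le hx0]
    exact integral_congr_ae ((coeFn_ofFun (𝕜 := 𝕜) hG).filter_mono
      (ae_mono (Measure.restrict_mono Ioc_subset_Ioi_self le_rfl)))
  have h3 : ∫ t in (0 : ℝ)..x, (G t : 𝕜) = ((∫ t in (0 : ℝ)..x, G t : ℝ) : 𝕜) :=
    (RCLike.ofRealCLM (K := 𝕜)).intervalIntegral_comp_comm (hc.intervalIntegrable 0 x)
  rw [h1, prim, h2, h3, intervalIntegral.integral_eq_sub_of_hasDerivAt (fun t _ => hd t)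
    (hc.intervalIntegrable 0 x), RCLike.ofReal_sub]
  ring

lemma memLp_of_abs_le_exp {F : ℝ → ℝ} (hF : Continuous F) {C c : ℝ} (hc : 0 < c)
    (h : ∀ x, 0 ≤ x → |F x| ≤ C * Real.exp (-c * x)) :
    MemLp F 2 (volume.restrict (Ioi (0 : ℝ))) := by
  have h1 : MemLp (fun x => Real.exp (-c * x)) 2 (volume.restrict (Ioi (0 : ℝ))) := by
    refine (memLp_two_iff_integrable_sq (by fun_prop)).2 ?_
    have h2 := exp_neg_integrableOn_Ioi 0 (show 0 < 2 * c by linarith)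
    refine h2.congr (.of_forall fun x => ?_)
    simp only
    rw [← Real.exp_nat_mul]
    congr 1
    push_cast
    ring
  refine h1.of_le_mul (c := C) hF.aestronglyMeasurable ?_
  refine (ae_restrict_iff' measurableSet_Ioi).2 (.of_forall fun x hx => ?_)
  rw [Real.norm_eq_abs, Real.norm_of_nonneg (Real.exp_pos _).le]
  exact h x (le_of_lt hx)

variable (𝕜) in
-- Witnessed by `exp (-x)`. Testing with a function that does not vanish at the vertex reveals the
-- vertex condition.
lemma exists_isWeakDeriv_trace_one : ∃ f g : L2Half 𝕜, IsWeakDeriv f g ∧ HasTrace f 1 := by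
  have h1 : MemLp (fun x => Real.exp (-x)) 2 (volume.restrict (Ioi (0 : ℝ))) :=
    memLp_of_abs_le_exp (by fun_prop) (C := 1) one_pos fun x _ => by simp
  have h2 : MemLp (fun x => -Real.exp (-x)) 2 (volume.restrict (Ioi (0 : ℝ))) := h1.neg
  have h3 : ∀ x : ℝ, HasDerivAt (fun x => Real.exp (-x)) (-Real.exp (-x)) x := fun x => by
    simpa using (hasDerivAt_neg x).exp
  have h4 := ofFun_ae_eq_prim (𝕜 := 𝕜) h1 h2 h3 (by fun_prop)
  refine ⟨_, _, .of_ae_eq_prim h4, ?_⟩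
  have := HasTrace.of_ae_eq_prim h4
  simpa using this

variable {N : ℕ}

/-- The element of `H¹(Γ)` supported on a single edge. -/
def H1Graph.single (j : Fin N) {f g : L2Half 𝕜} (h : IsWeakDeriv f g) : H1Graph 𝕜 N :=
  ⟨(PiLp.single 2 j f, PiLp.single 2 j g), fun i => by
    by_cases hij : i = j
    · subst hij
      simpa using h
    · simpa [hij] using isWeakDeriv_zero⟩

lemma trace_zero : trace (0 : L2Half 𝕜) = 0 := hasTrace_zero.trace_eq

lemma traceSum_single (j : Fin N) {f g : L2Half 𝕜} (h : IsWeakDeriv f g) :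
    traceSum (H1Graph.single j h) = trace f := by
  rw [traceSum_apply, Finset.sum_eq_single j]
  · simp [H1Graph.single]
  · intro i _ hi
    simp [H1Graph.single, hi, trace_zero]
  · simp

lemma edgeForm_zero_right (ω : ℝ) (V : ℝ →ᵇ ℝ) (f g : L2Half 𝕜) : edgeForm ω V f g 0 0 = 0 := by
  simp [edgeForm]

lemma graphForm_single (β ω : ℝ) (V : Fin N → ℝ →ᵇ ℝ) (u : H1Graph 𝕜 N) (j : Fin N)
    {f g : L2Half 𝕜} (h : IsWeakDeriv f g) :
    graphForm β ω V u (H1Graph.single j h) = edgeForm ω (V j) (u.1.1 j) (u.1.2 j) f g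
      + ((β⁻¹ : ℝ) : 𝕜) * (conj (traceSum u) * trace f) := by
  rw [graphForm_apply, traceSum_single, Finset.sum_eq_single j]
  · simp [H1Graph.single]
  · intro i _ hi
    simp [H1Graph.single, hi, edgeForm_zero_right]
  · simp

lemma inner_single (v : L2Graph 𝕜 N) (j : Fin N) {f g : L2Half 𝕜} (h : IsWeakDeriv f g) :
    inner 𝕜 v (H1Graph.single j h).1.1 = inner 𝕜 (v j) f := by
  rw [PiLp.inner_apply, Finset.sum_eq_single j]
  · simp [H1Graph.single]
  · intro i _ hi
    simp [H1Graph.single, hi]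
  · simp

/-- The energy on one edge of a function with a second weak derivative. -/
lemma edgeForm_eq {f g h : L2Half 𝕜} {ω : ℝ} {V : ℝ →ᵇ ℝ} {d : 𝕜} (H : IsWeakDeriv g h)
    (hd : HasTrace g d) {f' g' : L2Half 𝕜} {z : 𝕜} (H' : IsWeakDeriv f' g') (hz : HasTrace f' z) :
    edgeForm ω V f g f' g' = inner 𝕜 (-h + (ω : 𝕜) • f - mulOp V f) f' - conj d * z := by
  have := H.inner_add_inner H' hd hz
  rw [edgeForm, inner_sub_left, inner_add_left, inner_neg_left, inner_smul_left, RCLike.conj_ofReal,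
    eq_sub_of_add_eq' this]
  ring

lemma mem_schrodinger_graph_iff {β ω : ℝ} {V : Fin N → ℝ →ᵇ ℝ} {v w : L2Graph 𝕜 N} :
    (v, w) ∈ (schrodinger 𝕜 N β ω fun j x => V j x).graph ↔ ∃ g h, InDomain N β v g h ∧
      ∀ j, w j = -h j + (ω : 𝕜) • v j - mulOp (V j) (v j) := by
  rw [schrodinger_graph]
  refine exists_congr fun g => exists_congr fun h => and_congr_right fun _ => forall_congr' fun j => ?_
  have key : ∀ᵐ x ∂(volume.restrict (Ioi (0 : ℝ))),
      (-h j + (ω : 𝕜) • v j - mulOp (V j) (v j) : L2Half 𝕜) x =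
        - h j x + (ω : 𝕜) * v j x - (V j x : 𝕜) * v j x := by
    filter_upwards [Lp.coeFn_sub (-h j + (ω : 𝕜) • v j) (mulOp (V j) (v j)),
      Lp.coeFn_add (-h j) ((ω : 𝕜) • v j), Lp.coeFn_neg (h j), Lp.coeFn_smul (ω : 𝕜) (v j),
      coeFn_mulOp (V j) (v j)] with x h1 h2 h3 h4 h5
    rw [h1, Pi.sub_apply, h2, Pi.add_apply, h3, h4, h5, Pi.neg_apply, Pi.smul_apply, smul_eq_mul]
  constructor
  · intro hx
    refine Lp.ext ?_
    filter_upwards [hx, key] with x h1 h2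
    rw [h2]
    exact h1
  · intro hx
    filter_upwards [key] with x h2
    rw [← h2]
    change w j x = _
    rw [hx]

/-- The first representation theorem: the operator is given by the form. -/
lemma exists_inner_eq_graphForm {β ω : ℝ} (hβ : β ≠ 0) {V : Fin N → ℝ →ᵇ ℝ} {v w : L2Graph 𝕜 N}
    (h : (v, w) ∈ (schrodinger 𝕜 N β ω fun j x => V j x).graph) :
    ∃ u : H1Graph 𝕜 N, u.1.1 = v ∧ ∀ u' : H1Graph 𝕜 N, inner 𝕜 w u'.1.1 = graphForm β ω V u u' := by
  obtain ⟨g, h, ⟨H, z, d, hz, hd, hs⟩, e⟩ := mem_schrodinger_graph_iff.1 h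
  refine ⟨⟨(v, g), fun j => (H j).1⟩, rfl, fun u' => ?_⟩
  have ht : traceSum ⟨(v, g), fun j => (H j).1⟩ = (β : 𝕜) * d := by
    rw [traceSum_apply, ← hs]
    exact Finset.sum_congr rfl fun j _ => (hz j).trace_eq
  rw [graphForm_apply, ht, PiLp.inner_apply,
    Finset.sum_congr rfl fun j _ => edgeForm_eq (H j).2 (hd j) (u'.2 j) (u'.2 j).hasTrace_trace,
    Finset.sum_sub_distrib, ← Finset.mul_sum, ← traceSum_apply, map_mul, RCLike.conj_ofReal]
  simp only [← e]
  have : ((β⁻¹ : ℝ) : 𝕜) * (β : 𝕜) = 1 := by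
    rw [← RCLike.ofReal_mul, inv_mul_cancel₀ hβ, RCLike.ofReal_one]
  linear_combination (-conj d * traceSum u') * this

/-- Eigenvectors of the form are eigenvectors of the operator. -/
lemma mem_eigenspace_of_graphForm {β ω l : ℝ} (hβ : β ≠ 0) {V : Fin N → ℝ →ᵇ ℝ} {u : H1Graph 𝕜 N}
    (hu : ∀ u' : H1Graph 𝕜 N, graphForm β ω V u u' = (l : 𝕜) * inner 𝕜 u.1.1 u'.1.1) :
    u.1.1 ∈ eigenspace (schrodinger 𝕜 N β ω fun j x => V j x) l := by
  -- The only candidate for the second derivative, obtained by solving the eigenvalue equation for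
  -- it.
  set h : L2Graph 𝕜 N := WithLp.toLp 2 fun j =>
    (ω : 𝕜) • u.1.1 j - mulOp (V j) (u.1.1 j) - (l : 𝕜) • u.1.1 j with hh
  have hj : ∀ j, h j = (ω : 𝕜) • u.1.1 j - mulOp (V j) (u.1.1 j) - (l : 𝕜) • u.1.1 j := fun _ => rfl
  have hedge : ∀ (j : Fin N) {f g : L2Half 𝕜} (_ : IsWeakDeriv f g),
      inner 𝕜 (u.1.2 j) g + inner 𝕜 (h j) f = -(((β⁻¹ : ℝ) : 𝕜) * (conj (traceSum u) * trace f)) := by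
    intro j f g H
    have h1 := hu (H1Graph.single j H)
    rw [graphForm_single, inner_single, edgeForm] at h1
    rw [hj, inner_sub_left, inner_sub_left, inner_smul_left, inner_smul_left, RCLike.conj_ofReal,
      RCLike.conj_ofReal]
    linear_combination h1
  -- Test functions supported off the vertex have trace zero, so the vertex term disappears and the
  -- weak equation is the definition of a weak derivative.
  have hweak : ∀ j, IsWeakDeriv (u.1.2 j) (h j) := by
    intro j ψ h1 h2 h3
    have hψ : MemLp ψ 2 (volume.restrict (Ioi (0 : ℝ))) :=
      (h1.continuous.memLp_of_hasCompactSupport h2).restrict _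
    have hc' : Continuous (deriv ψ) := h1.continuous_deriv (n := (⊤ : ℕ∞)) (by simp)
    have hψ' : MemLp (deriv ψ) 2 (volume.restrict (Ioi (0 : ℝ))) :=
      (hc'.memLp_of_hasCompactSupport h2.deriv).restrict _
    have hp := ofFun_ae_eq_prim (𝕜 := 𝕜) hψ hψ'
      (fun x => (h1.differentiable (by simp)).differentiableAt.hasDerivAt) hc'
    have h4 := hedge j (.of_ae_eq_prim hp)
    have h5 : ψ 0 = 0 := image_eq_zero_of_notMem_tsupport fun h => lt_irrefl (0 : ℝ) (h3 h)
    rw [(HasTrace.of_ae_eq_prim hp).trace_eq, h5, RCLike.ofReal_zero, mul_zero, mul_zero, neg_zero]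
      at h4
    have hint : ∀ {χ : ℝ → ℝ} (hχ : MemLp χ 2 (volume.restrict (Ioi (0 : ℝ)))) (f : L2Half 𝕜),
        ∫ x in Ioi (0 : ℝ), χ x • f x = conj (inner 𝕜 f (ofFun 𝕜 χ hχ)) := by
      intro χ hχ f
      rw [inner_conj_symm, L2.inner_def]
      refine integral_congr_ae ?_
      filter_upwards [coeFn_ofFun (𝕜 := 𝕜) hχ] with x hx
      rw [hx, RCLike.inner_apply, RCLike.conj_ofReal, RCLike.real_smul_eq_coe_mul, mul_comm]
    rw [hint hψ, hint hψ', ← map_neg, eq_neg_of_add_eq_zero_left h4]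
  -- The natural boundary condition: for a test function of trace one, comparing integration by
  -- parts with the weak equation identifies the derivative at the vertex, which is the same on all
  -- edges.
  have htr : ∀ j, HasTrace (u.1.2 j) (((β⁻¹ : ℝ) : 𝕜) * traceSum u) := by
    intro j
    obtain ⟨f, g, H, hf⟩ := exists_isWeakDeriv_trace_one 𝕜
    obtain ⟨d, hd⟩ := (hweak j).exists_hasTrace
    have h1 := (hweak j).inner_add_inner H hd hf
    have h2 := hedge j H
    rw [hf.trace_eq] at h2
    rw [add_comm, h2] at h1
    have h3 : conj d = conj (((β⁻¹ : ℝ) : 𝕜) * traceSum u) := by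
      rw [map_mul, RCLike.conj_ofReal]
      linear_combination h1
    rwa [← (starRingEnd 𝕜).injective h3]
  have hg : (u.1.1, (l : 𝕜) • u.1.1) ∈ (schrodinger 𝕜 N β ω fun j x => V j x).graph := by
    refine mem_schrodinger_graph_iff.2 ⟨u.1.2, h, ⟨fun j => ⟨u.2 j, hweak j⟩, fun j => trace (u.1.1 j),
      _, fun j => (u.2 j).hasTrace_trace, htr, ?_⟩, fun j => ?_⟩
    · rw [← traceSum_apply, ← mul_assoc, ← RCLike.ofReal_mul, mul_inv_cancel₀ hβ,
        RCLike.ofReal_one, one_mul]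
    · rw [hj, PiLp.smul_apply]
      abel
  obtain ⟨y, hy1, hy2⟩ := (LinearPMap.mem_graph_iff _).1 hg
  simp only at hy1 hy2
  exact ⟨hy1 ▸ y.2, by rw [← hy2]; congr 1; exact Subtype.ext hy1.symm⟩

/-- A space on which the form is negative definite bounds the Morse index from below. -/
theorem finrank_le_morseIndex_schrodinger {β ω : ℝ} (hβ : β ≠ 0) (hω : 0 < ω)
    {V : Fin N → ℝ →ᵇ ℝ} (hV : ∀ j, IntegrableOn (fun x => |V j x| * (1 + x)) (Ioi 0))
    {Y : Type*} [AddCommGroup Y] [Module 𝕜 Y] [FiniteDimensional 𝕜 Y] (Φ : Y →ₗ[𝕜] H1Graph 𝕜 N)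
    (hΦ : ∀ y, y ≠ 0 → RCLike.re (graphForm β ω V (Φ y) (Φ y)) < 0) :
    (Module.finrank 𝕜 Y : ℕ∞) ≤ morseIndex (schrodinger 𝕜 N β ω fun j x => V j x) := by
  obtain ⟨e, l, hl, ho, he⟩ :=
    (isCompactGarding_graphForm β hω hV).exists_orthonormal Φ hΦ _ le_rfl
  exact le_morseIndex hl ho fun i => mem_eigenspace_of_graphForm hβ (he i)

lemma schrodinger_symmetric {β ω : ℝ} (hβ : β ≠ 0) {V : Fin N → ℝ →ᵇ ℝ}
    (v w : (schrodinger 𝕜 N β ω fun j x => V j x).domain) :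
    inner 𝕜 (schrodinger 𝕜 N β ω (fun j x => V j x) v) (w : L2Graph 𝕜 N) =
      inner 𝕜 (v : L2Graph 𝕜 N) (schrodinger 𝕜 N β ω (fun j x => V j x) w) := by
  obtain ⟨u, hu, h1⟩ := exists_inner_eq_graphForm hβ (LinearPMap.mem_graph _ v)
  obtain ⟨u', hu', h2⟩ := exists_inner_eq_graphForm hβ (LinearPMap.mem_graph _ w)
  have h3 := h1 u'
  have h4 := h2 u
  rw [hu'] at h3
  rw [hu] at h4
  rw [h3, ← inner_conj_symm, h4, graphForm_apply, graphForm_apply]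
  simp only [map_add, map_sum, map_mul, conj_edgeForm, RCLike.conj_ofReal, RCLike.conj_conj]
  ring

end Operator

/-! ### Pöschl-Teller potentials and explicit functions on an edge. -/

section PoschlTeller

open ComplexConjugate
open scoped BoundedContinuousFunction

/-- The potential `A sech²(κ (x + a))`. -/
def sechSq (A κ a : ℝ) : ℝ →ᵇ ℝ :=
  BoundedContinuousFunction.ofNormedAddCommGroup (fun x => A * (1 / Real.cosh (κ * (x + a))) ^ 2)
    (by
      have : ∀ x : ℝ, Real.cosh (κ * (x + a)) ≠ 0 := fun x => (Real.cosh_pos _).ne'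
      fun_prop (disch := assumption)) |A|
    (fun x => by
      have h1 : 1 / Real.cosh (κ * (x + a)) ≤ 1 := by
        rw [div_le_one (Real.cosh_pos _)]
        exact Real.one_le_cosh _
      have h2 : 0 ≤ 1 / Real.cosh (κ * (x + a)) := by have := Real.cosh_pos (κ * (x + a)); positivity
      rw [norm_mul, Real.norm_eq_abs, Real.norm_of_nonneg (by positivity)]
      exact mul_le_of_le_one_right (abs_nonneg _) (pow_le_one₀ h2 h1))

lemma sechSq_apply (A κ a x : ℝ) : sechSq A κ a x = A * (1 / Real.cosh (κ * (x + a))) ^ 2 := rfl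

/-- The function `A tanh(κ (x + a))`. -/
def scaledTanh (A κ a : ℝ) : ℝ →ᵇ ℝ :=
  BoundedContinuousFunction.ofNormedAddCommGroup (fun x => A * Real.tanh (κ * (x + a)))
    (by
      have : ∀ x : ℝ, Real.cosh (κ * (x + a)) ≠ 0 := fun x => (Real.cosh_pos _).ne'
      simp only [Real.tanh_eq_sinh_div_cosh]
      fun_prop (disch := assumption)) |A|
    (fun x => by
      rw [norm_mul, Real.norm_eq_abs, Real.norm_eq_abs]
      exact mul_le_of_le_one_right (abs_nonneg _) (Real.abs_tanh_lt_one _).le)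

lemma scaledTanh_apply (A κ a x : ℝ) : scaledTanh A κ a x = A * Real.tanh (κ * (x + a)) := rfl

lemma hasDerivAt_shift (κ a x : ℝ) : HasDerivAt (fun x => κ * (x + a)) κ x := by
  simpa using ((hasDerivAt_id x).add_const a).const_mul κ

lemma hasDerivAt_scaledTanh (A κ a x : ℝ) :
    HasDerivAt (scaledTanh A κ a) (sechSq (A * κ) κ a x) x := by
  have hc := (Real.cosh_pos (κ * (x + a))).ne'
  have h1 := (((hasDerivAt_shift κ a x).sinh.div (hasDerivAt_shift κ a x).cosh hc).const_mul A)
  have h2 : ∀ x, A * Real.tanh (κ * (x + a)) =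
      A * (Real.sinh (κ * (x + a)) / Real.cosh (κ * (x + a))) := fun x => by
    rw [Real.tanh_eq_sinh_div_cosh]
  refine (h1.congr_of_eventuallyEq (.of_forall h2)).congr_deriv ?_
  rw [sechSq_apply]
  have h3 := Real.cosh_sq (κ * (x + a))
  field_simp
  rw [h3]
  ring

lemma contDiff_scaledTanh (A κ a : ℝ) : ContDiff ℝ (⊤ : ℕ∞) (scaledTanh A κ a) := by
  have h : (scaledTanh A κ a : ℝ → ℝ) = fun x =>
      A * (Real.sinh (κ * (x + a)) / Real.cosh (κ * (x + a))) := by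
    ext x
    rw [scaledTanh_apply, Real.tanh_eq_sinh_div_cosh]
  rw [h]
  have hy : ContDiff ℝ (⊤ : ℕ∞) fun x => κ * (x + a) := by fun_prop
  exact contDiff_const.mul ((Real.contDiff_sinh.comp hy).div (Real.contDiff_cosh.comp hy)
    fun x => (Real.cosh_pos _).ne')

/-- The Riccati equation of the logarithmic derivative of the soliton. -/
lemma riccati_scaledTanh (m κ a x : ℝ) :
    sechSq (-m * κ) κ a x + scaledTanh (-m) κ a x ^ 2 = m ^ 2 - sechSq (m * (m + κ)) κ a x := by
  rw [sechSq_apply, sechSq_apply, scaledTanh_apply, Real.tanh_eq_sinh_div_cosh]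
  have hc := (Real.cosh_pos (κ * (x + a))).ne'
  have h3 := Real.cosh_sq (κ * (x + a))
  field_simp
  rw [Real.sinh_sq]
  ring

/-- `sech²` decays like `exp (-2 κ x)`; one factor `exp (-κ x)` absorbs `1 + x`, the other is
integrable. -/
lemma integrableOn_sechSq_mul {A κ a : ℝ} (hκ : 0 < κ) :
    IntegrableOn (fun x => |sechSq A κ a x| * (1 + x)) (Ioi 0) := by
  have h1 := (exp_neg_integrableOn_Ioi 0 hκ).const_mul
    (|A| * 4 * Real.exp (-(2 * κ * a)) * (1 + 1 / κ))
  refine h1.mono' ?_ ?_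
  · exact (((sechSq A κ a).continuous.abs).mul (by fun_prop)).aestronglyMeasurable
  · refine (ae_restrict_iff' measurableSet_Ioi).2 (.of_forall fun x hx => ?_)
    have hx0 : 0 < x := hx
    have hy : Real.exp (κ * (x + a)) / 2 ≤ Real.cosh (κ * (x + a)) := by
      rw [Real.cosh_eq]
      linarith [Real.exp_pos (-(κ * (x + a)))]
    have h2 : 1 / Real.cosh (κ * (x + a)) ≤ 2 * Real.exp (-(κ * (x + a))) := by
      rw [Real.exp_neg, div_le_iff₀ (Real.cosh_pos _)]
      have := Real.exp_pos (κ * (x + a))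
      calc (1 : ℝ) = 2 * (Real.exp (κ * (x + a)))⁻¹ * (Real.exp (κ * (x + a)) / 2) := by
            field_simp
        _ ≤ _ := by gcongr
    have h3 : (1 / Real.cosh (κ * (x + a))) ^ 2 ≤ 4 * Real.exp (-(2 * κ * a)) *
        (Real.exp (-κ * x) * Real.exp (-κ * x)) := by
      have h4 : 0 ≤ 1 / Real.cosh (κ * (x + a)) := by
        have := Real.cosh_pos (κ * (x + a)); positivity
      refine (pow_le_pow_left₀ h4 h2 2).trans (le_of_eq ?_)
      rw [mul_pow, ← Real.exp_nat_mul, ← Real.exp_add, mul_assoc, ← Real.exp_add]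
      norm_num
      ring
    have h5 : (1 + x) * Real.exp (-κ * x) ≤ 1 + 1 / κ := by
      have h6 := Real.add_one_le_exp (κ * x)
      have h7 : 1 + x ≤ (1 + 1 / κ) * Real.exp (κ * x) := by
        have h8 : 0 ≤ κ * x := by positivity
        have h9 : 1 + x ≤ (1 + 1 / κ) * (κ * x + 1) := by
          have : (1 + 1 / κ) * (κ * x + 1) = κ * x + 1 + x + 1 / κ := by field_simp; ring
          rw [this]
          have : 0 < 1 / κ := by positivity
          linarith
        exact h9.trans (by gcongr)
      rw [neg_mul, Real.exp_neg, ← div_eq_mul_inv, div_le_iff₀ (Real.exp_pos _)]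
      exact h7
    rw [norm_mul, Real.norm_of_nonneg (abs_nonneg _), Real.norm_of_nonneg (by linarith),
      sechSq_apply, abs_mul, abs_of_nonneg (by positivity : 0 ≤ (1 / Real.cosh (κ * (x + a))) ^ 2)]
    calc |A| * (1 / Real.cosh (κ * (x + a))) ^ 2 * (1 + x)
        ≤ |A| * (4 * Real.exp (-(2 * κ * a)) * (Real.exp (-κ * x) * Real.exp (-κ * x))) * (1 + x) := by
          gcongr
      _ = |A| * 4 * Real.exp (-(2 * κ * a)) * ((1 + x) * Real.exp (-κ * x)) * Real.exp (-κ * x) := by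
          ring
      _ ≤ |A| * 4 * Real.exp (-(2 * κ * a)) * (1 + 1 / κ) * Real.exp (-κ * x) := by gcongr

/-- The ground state `cosh(κ (x + a)) ^ (-(1 + m / κ))` of the Pöschl-Teller operator
`-∂² + m² - (m + κ) (m + 2 κ) sech²(κ (x + a))`. -/
def sechPow (m κ a x : ℝ) : ℝ := Real.cosh (κ * (x + a)) ^ (-(1 + m / κ))

lemma sechPow_pos (m κ a x : ℝ) : 0 < sechPow m κ a x := Real.rpow_pos_of_pos (Real.cosh_pos _) _

lemma hasDerivAt_sechPow {m κ a : ℝ} (hκ : κ ≠ 0) (x : ℝ) : HasDerivAt (sechPow m κ a)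
    (-(m + κ) * (Real.sinh (κ * (x + a)) / Real.cosh (κ * (x + a))) * sechPow m κ a x) x := by
  have hc := Real.cosh_pos (κ * (x + a))
  refine ((hasDerivAt_shift κ a x).cosh.rpow_const (p := -(1 + m / κ)) (Or.inl hc.ne')).congr_deriv ?_
  rw [sechPow, Real.rpow_sub_one hc.ne']
  field_simp
  ring

lemma continuous_sechPow {m κ a : ℝ} (hκ : κ ≠ 0) : Continuous (sechPow m κ a) :=
  continuous_iff_continuousAt.2 fun x => (hasDerivAt_sechPow hκ x).continuousAt

/-- The product is `cosh ^ (-m / κ)`, which decays like `exp (-m x)`. It is the common majorant for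
the explicit functions below and their derivatives. -/
lemma cosh_mul_sechPow_le {m κ a : ℝ} (hm : 0 < m) (hκ : 0 < κ) (x : ℝ) :
    Real.cosh (κ * (x + a)) * sechPow m κ a x ≤
      Real.exp (-m * a) * 2 ^ (m / κ) * Real.exp (-m * x) := by
  have hc := Real.cosh_pos (κ * (x + a))
  have h1 : Real.cosh (κ * (x + a)) * sechPow m κ a x = Real.cosh (κ * (x + a)) ^ (-(m / κ)) := by
    rw [sechPow, show -(m / κ) = 1 + -(1 + m / κ) by ring, Real.rpow_add hc, Real.rpow_one]
  have hy : Real.exp (κ * (x + a)) / 2 ≤ Real.cosh (κ * (x + a)) := by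
    rw [Real.cosh_eq]
    linarith [Real.exp_pos (-(κ * (x + a)))]
  rw [h1]
  refine (Real.rpow_le_rpow_of_nonpos (by positivity) hy
    (by have : 0 < m / κ := by positivity
        linarith)).trans (le_of_eq ?_)
  rw [Real.div_rpow (Real.exp_pos _).le (by norm_num), ← Real.exp_mul,
    Real.rpow_neg (by norm_num), div_inv_eq_mul,
    mul_right_comm (Real.exp (-m * a)), ← Real.exp_add]
  congr 2
  field_simp
  ring

/-- Functions bounded by `cosh(y) sechPow` are square integrable. -/
lemma memLp_of_abs_le_cosh_mul_sechPow {m κ a C : ℝ} (hm : 0 < m) (hκ : 0 < κ) {F : ℝ → ℝ}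
    (hF : Continuous F) (hC : 0 ≤ C)
    (h : ∀ x, |F x| ≤ C * (Real.cosh (κ * (x + a)) * sechPow m κ a x)) :
    MemLp F 2 (volume.restrict (Ioi (0 : ℝ))) :=
  memLp_of_abs_le_exp hF (C := C * (Real.exp (-m * a) * 2 ^ (m / κ))) hm fun x _ =>
    (h x).trans (by
      rw [mul_assoc]
      exact mul_le_mul_of_nonneg_left (cosh_mul_sechPow_le hm hκ x) hC)

lemma abs_sinh_le_cosh (y : ℝ) : |Real.sinh y| ≤ Real.cosh y := by
  rw [abs_le]
  exact ⟨by linarith [Real.cosh_add_sinh y, Real.exp_pos y], (Real.sinh_lt_cosh y).le⟩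

variable {𝕜 : Type*} [RCLike 𝕜]

/-- A classical solution of `-F'' + (ω - W) F = l F` on the half-line, as an element of `L²` with its
energy. -/
lemma edgeForm_ofFun {F F' F'' : ℝ → ℝ} {W : ℝ →ᵇ ℝ} {ω l : ℝ}
    (hF : MemLp F 2 (volume.restrict (Ioi (0 : ℝ)))) (hF' : MemLp F' 2 (volume.restrict (Ioi (0 : ℝ))))
    (hF'' : MemLp F'' 2 (volume.restrict (Ioi (0 : ℝ))))
    (hd' : ∀ x, HasDerivAt F' (F'' x) x)
    (hc'' : Continuous F'') (heq : ∀ x, -F'' x + (ω - W x) * F x = l * F x)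
    {f g : L2Half 𝕜} (h : IsWeakDeriv f g) :
    edgeForm ω W (ofFun 𝕜 F hF) (ofFun 𝕜 F' hF') f g =
      (l : 𝕜) * inner 𝕜 (ofFun 𝕜 F hF) f - (F' 0 : 𝕜) * trace f := by
  have h1 := ofFun_ae_eq_prim (𝕜 := 𝕜) hF' hF'' hd' hc''
  rw [edgeForm_eq (.of_ae_eq_prim h1) (HasTrace.of_ae_eq_prim h1) h h.hasTrace_trace,
    RCLike.conj_ofReal]
  congr 1
  have h2 : -ofFun 𝕜 F'' hF'' + (ω : 𝕜) • ofFun 𝕜 F hF - mulOp W (ofFun 𝕜 F hF) =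
      (l : 𝕜) • ofFun 𝕜 F hF := by
    refine Lp.ext ?_
    filter_upwards [coeFn_ofFun (𝕜 := 𝕜) hF, coeFn_ofFun (𝕜 := 𝕜) hF'',
      Lp.coeFn_neg (ofFun 𝕜 F'' hF''), Lp.coeFn_smul (ω : 𝕜) (ofFun 𝕜 F hF),
      Lp.coeFn_smul (l : 𝕜) (ofFun 𝕜 F hF), coeFn_mulOp W (ofFun 𝕜 F hF),
      Lp.coeFn_add (-ofFun 𝕜 F'' hF'') ((ω : 𝕜) • ofFun 𝕜 F hF),
      Lp.coeFn_sub (-ofFun 𝕜 F'' hF'' + (ω : 𝕜) • ofFun 𝕜 F hF) (mulOp W (ofFun 𝕜 F hF))]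
      with x a1 a2 a3 a4 a5 a6 a7 a8
    rw [a8, Pi.sub_apply, a7, Pi.add_apply, a3, a4, a5, a6, Pi.neg_apply, Pi.smul_apply,
      Pi.smul_apply, a1, a2, smul_eq_mul, smul_eq_mul, ← RCLike.ofReal_neg]
    have := congrArg (fun r : ℝ => (r : 𝕜)) (heq x)
    simp only [RCLike.ofReal_add, RCLike.ofReal_mul, RCLike.ofReal_sub] at this
    rw [← this]
    ring
  rw [h2, inner_smul_left, RCLike.conj_ofReal]

lemma edgeForm_smul_add_smul_left (ω : ℝ) (V : ℝ →ᵇ ℝ) (c d : 𝕜) (f₁ g₁ f₂ g₂ f g : L2Half 𝕜) :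
    edgeForm ω V (c • f₁ + d • f₂) (c • g₁ + d • g₂) f g =
      conj c * edgeForm ω V f₁ g₁ f g + conj d * edgeForm ω V f₂ g₂ f g := by
  simp only [edgeForm, inner_add_left, inner_smul_left, map_add, map_smul]
  ring

/-- Two test functions on an edge: a solution `u` of the homogeneous equation, and, if the maximum of
the potential is inside the edge, a function `r` of negative energy that vanishes at the vertex. -/
lemma exists_edge_modes (𝕜 : Type*) [RCLike 𝕜] {m κ a : ℝ} (hm : 0 < m) (hκ : 0 < κ) :
    ∃ u u' r r' : L2Half 𝕜, IsWeakDeriv u u' ∧ IsWeakDeriv r r' ∧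
      HasTrace u ((Real.sinh (κ * a) * sechPow m κ a 0 : ℝ) : 𝕜) ∧ HasTrace r 0 ∧
      (∀ f g : L2Half 𝕜, IsWeakDeriv f g →
        edgeForm (m ^ 2) (sechSq ((m + κ) * (m + 2 * κ)) κ a) u u' f g =
          -(((-m * Real.cosh (κ * a) + (m + κ) / Real.cosh (κ * a)) * sechPow m κ a 0 : ℝ) : 𝕜)
            * trace f) ∧
      (a < 0 → RCLike.re (edgeForm (m ^ 2) (sechSq ((m + κ) * (m + 2 * κ)) κ a) r r' r r') < 0) := by
  have hcp : ∀ x, 0 < Real.cosh (κ * (x + a)) := fun x => Real.cosh_pos _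
  have hc0 : ∀ x, Real.cosh (κ * (x + a)) ≠ 0 := fun x => (hcp x).ne'
  have hc1 : ∀ x, 1 ≤ Real.cosh (κ * (x + a)) := fun x => Real.one_le_cosh _
  have hinv : ∀ x, (1 / Real.cosh (κ * (x + a))) ^ 2 ≤ 1 := fun x =>
    pow_le_one₀ (by have := hcp x; positivity) ((div_le_one (hcp x)).2 (hc1 x))
  have hEc : Continuous (sechPow m κ a) := continuous_sechPow hκ.ne'
  have hE0 := fun x => sechPow_pos m κ a x
  set E := sechPow m κ a with hE
  set B : ℝ := (m + κ) * (m + 2 * κ) with hB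
  have hB0 : 0 < B := by positivity
  set E₁ : ℝ → ℝ := fun x => -(m + κ) * (Real.sinh (κ * (x + a)) / Real.cosh (κ * (x + a))) * E x
    with hE₁
  set E₂ : ℝ → ℝ := fun x => ((m + κ) ^ 2 - B * (1 / Real.cosh (κ * (x + a))) ^ 2) * E x with hE₂
  -- Up to the factor `-m`, the derivative of `cosh ^ (-m / κ)`, hence proportional to the
  -- derivative of the soliton: the zero mode of the linearisation given by translation.
  set U : ℝ → ℝ := fun x => Real.sinh (κ * (x + a)) * E x with hU
  set U₁ : ℝ → ℝ := fun x =>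
    (-m * Real.cosh (κ * (x + a)) + (m + κ) / Real.cosh (κ * (x + a))) * E x with hU₁
  set U₂ : ℝ → ℝ := fun x => (m ^ 2 - B * (1 / Real.cosh (κ * (x + a))) ^ 2) * U x with hU₂
  have dE : ∀ x, HasDerivAt E (E₁ x) x := hasDerivAt_sechPow hκ.ne'
  have ds := fun x => (hasDerivAt_shift κ a x).sinh
  have dc := fun x => (hasDerivAt_shift κ a x).cosh
  have dE₁ : ∀ x, HasDerivAt E₁ (E₂ x) x := fun x => by
    refine (((((ds x).div (dc x) (hc0 x)).const_mul (-(m + κ))).mul (dE x))).congr_deriv ?_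
    simp only [hE₁, hE₂, hB, Pi.div_apply]
    have := hc0 x
    field_simp
    rw [Real.sinh_sq]
    ring
  have dU : ∀ x, HasDerivAt U (U₁ x) x := fun x => by
    refine ((ds x).mul (dE x)).congr_deriv ?_
    simp only [hE₁, hU₁]
    have := hc0 x
    field_simp
    rw [Real.sinh_sq]
    ring
  have dU₁ : ∀ x, HasDerivAt U₁ (U₂ x) x := fun x => by
    refine ((((dc x).const_mul (-m)).add (((hasDerivAt_const x (m + κ)).div (dc x) (hc0 x)))).mul
      (dE x)).congr_deriv ?_
    simp only [hE₁, hU₂, hU, hB, Pi.add_apply, Pi.div_apply]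
    have := hc0 x
    field_simp
    ring
  have cE₂ : Continuous E₂ := by fun_prop (disch := assumption)
  have cE₁ : Continuous E₁ := by fun_prop (disch := assumption)
  have cU : Continuous U := by fun_prop
  have cU₁ : Continuous U₁ := by fun_prop (disch := assumption)
  have cU₂ : Continuous U₂ := by fun_prop (disch := assumption)
  have bE : ∀ x, |E x| ≤ 1 * (Real.cosh (κ * (x + a)) * E x) := fun x => by
    rw [abs_of_pos (hE0 x), one_mul]
    exact le_mul_of_one_le_left (hE0 x).le (hc1 x)
  have bU : ∀ x, |U x| ≤ 1 * (Real.cosh (κ * (x + a)) * E x) := fun x => by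
    rw [hU, abs_mul, abs_of_pos (hE0 x), one_mul]
    exact mul_le_mul_of_nonneg_right (abs_sinh_le_cosh _) (hE0 x).le
  have bE₁ : ∀ x, |E₁ x| ≤ (m + κ) * (Real.cosh (κ * (x + a)) * E x) := fun x => by
    simp only [hE₁]
    rw [abs_mul, abs_mul, abs_neg, abs_of_pos (show 0 < m + κ by positivity), mul_assoc]
    refine mul_le_mul_of_nonneg_left (mul_le_mul ?_ ?_ (abs_nonneg _) (hcp x).le) (by positivity)
    · rw [abs_div, abs_of_pos (hcp x), div_le_iff₀ (hcp x)]
      exact (abs_sinh_le_cosh _).trans (le_mul_of_one_le_left (hcp x).le (hc1 x))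
    · rw [abs_of_pos (hE0 x)]
  have bcoef : ∀ A x, |A ^ 2 - B * (1 / Real.cosh (κ * (x + a))) ^ 2| ≤ A ^ 2 + B := fun A x => by
    have h1 : 0 ≤ B * (1 / Real.cosh (κ * (x + a))) ^ 2 := by positivity
    have h2 : B * (1 / Real.cosh (κ * (x + a))) ^ 2 ≤ B := mul_le_of_le_one_right hB0.le (hinv x)
    rw [abs_le]
    constructor <;> nlinarith [sq_nonneg A]
  have bE₂ : ∀ x, |E₂ x| ≤ ((m + κ) ^ 2 + B) * (Real.cosh (κ * (x + a)) * E x) := fun x => by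
    simp only [hE₂]
    rw [abs_mul]
    exact mul_le_mul (bcoef _ x) ((bE x).trans_eq (one_mul _)) (abs_nonneg _) (by positivity)
  have bU₂ : ∀ x, |U₂ x| ≤ (m ^ 2 + B) * (Real.cosh (κ * (x + a)) * E x) := fun x => by
    simp only [hU₂]
    rw [abs_mul]
    exact mul_le_mul (bcoef _ x) ((bU x).trans_eq (one_mul _)) (abs_nonneg _) (by positivity)
  have bU₁ : ∀ x, |U₁ x| ≤ (m + (m + κ)) * (Real.cosh (κ * (x + a)) * E x) := fun x => by
    simp only [hU₁]
    rw [abs_mul, abs_of_pos (hE0 x), ← mul_assoc]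
    refine mul_le_mul_of_nonneg_right ((abs_add_le _ _).trans ?_) (hE0 x).le
    rw [abs_mul, abs_neg, abs_of_pos hm, abs_of_pos (hcp x), abs_of_pos (by have := hcp x; positivity),
      add_mul]
    refine add_le_add_right ?_ _
    rw [div_le_iff₀ (hcp x), mul_assoc]
    exact le_mul_of_one_le_right (by positivity) (by nlinarith [hc1 x])
  have mE := memLp_of_abs_le_cosh_mul_sechPow hm hκ hEc zero_le_one bE
  have mU := memLp_of_abs_le_cosh_mul_sechPow hm hκ cU zero_le_one bU
  have mE₁ := memLp_of_abs_le_cosh_mul_sechPow hm hκ cE₁ (by positivity) bE₁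
  have mE₂ := memLp_of_abs_le_cosh_mul_sechPow hm hκ cE₂ (by positivity) bE₂
  have mU₁ := memLp_of_abs_le_cosh_mul_sechPow hm hκ cU₁ (by positivity) bU₁
  have mU₂ := memLp_of_abs_le_cosh_mul_sechPow hm hκ cU₂ (by positivity) bU₂
  have pE := ofFun_ae_eq_prim (𝕜 := 𝕜) mE mE₁ dE cE₁
  have pU := ofFun_ae_eq_prim (𝕜 := 𝕜) mU mU₁ dU cU₁
  have wE : IsWeakDeriv _ _ := .of_ae_eq_prim pE
  have wU : IsWeakDeriv _ _ := .of_ae_eq_prim pU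
  have tE := HasTrace.of_ae_eq_prim pE
  have tU := HasTrace.of_ae_eq_prim pU
  set s₀ : ℝ := Real.sinh (κ * a) with hs₀
  have hU0 : U 0 = s₀ * E 0 := by simp only [hU, zero_add, hs₀]
  -- `r = s₀ E - U` vanishes at the vertex because `U 0 = s₀ * E 0`.
  have wr := (wE.smul (s₀ : 𝕜)).add (wU.smul (-1))
  have tr : HasTrace ((s₀ : 𝕜) • ofFun 𝕜 E mE + (-1 : 𝕜) • ofFun 𝕜 U mU) 0 := by
    have h := (tE.smul (s₀ : 𝕜)).add (tU.smul (-1))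
    rw [hU0, RCLike.ofReal_mul] at h
    convert! h using 1
    ring
  have qE := fun {f g : L2Half 𝕜} (h : IsWeakDeriv f g) =>
    edgeForm_ofFun (W := sechSq B κ a) (ω := m ^ 2) (l := m ^ 2 - (m + κ) ^ 2) mE mE₁ mE₂ dE₁ cE₂
      (fun x => by simp only [hE₂, sechSq_apply]; ring) h
  have qU := fun {f g : L2Half 𝕜} (h : IsWeakDeriv f g) =>
    edgeForm_ofFun (W := sechSq B κ a) (ω := m ^ 2) (l := 0) mU mU₁ mU₂ dU₁ cU₂
      (fun x => by simp only [hU₂, sechSq_apply]; ring) h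
  refine ⟨_, _, _, _, wU, wr, by rw [← hU0]; exact tU, tr, fun f g h => ?_, fun ha => ?_⟩
  · rw [qU h]
    simp only [hU₁, zero_add, RCLike.ofReal_zero, zero_mul, zero_sub, neg_mul]
  · set r := (s₀ : 𝕜) • ofFun 𝕜 E mE + (-1 : 𝕜) • ofFun 𝕜 U mU with hr
    set r' := (s₀ : 𝕜) • ofFun 𝕜 E₁ mE₁ + (-1 : 𝕜) • ofFun 𝕜 U₁ mU₁ with hr'
    -- As `r` has trace zero, no boundary terms appear, and `U` is a zero mode; the energy is `s₀
    -- (m² - (m + κ)²) ⟨E, r⟩`. For `a < 0` all three factors are negative, the last because `r =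
    -- (s₀ - sinh (κ (x + a))) E < 0` for `x > 0`.
    have h1 : edgeForm (m ^ 2) (sechSq B κ a) r r' r r' =
        (s₀ : 𝕜) * edgeForm (m ^ 2) (sechSq B κ a) (ofFun 𝕜 E mE) (ofFun 𝕜 E₁ mE₁) r r' -
        edgeForm (m ^ 2) (sechSq B κ a) (ofFun 𝕜 U mU) (ofFun 𝕜 U₁ mU₁) r r' := by
      rw [edgeForm_smul_add_smul_left, RCLike.conj_ofReal, map_neg, map_one]
      ring
    have h2 : inner 𝕜 (ofFun 𝕜 E mE) r = ((∫ x in Ioi (0 : ℝ), (s₀ * (E x * E x) - E x * U x) : ℝ) : 𝕜) := by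
      have i1 : IntegrableOn (fun x => E x * E x) (Ioi 0) := mE.integrable_mul mE
      have i2 : IntegrableOn (fun x => E x * U x) (Ioi 0) := mE.integrable_mul mU
      rw [hr, inner_add_right, inner_smul_right, inner_smul_right, inner_ofFun, inner_ofFun,
        integral_sub (i1.const_mul _) i2, integral_const_mul, RCLike.ofReal_sub, RCLike.ofReal_mul]
      ring
    have h3 : ∫ x in Ioi (0 : ℝ), (s₀ * (E x * E x) - E x * U x) < 0 := by
      have i1 : IntegrableOn (fun x => E x * E x) (Ioi 0) := mE.integrable_mul mE
      have i2 : IntegrableOn (fun x => E x * U x) (Ioi 0) := mE.integrable_mul mU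
      have h4 : ∀ x, x ∈ Ioi (0 : ℝ) → 0 < -(s₀ * (E x * E x) - E x * U x) := by
        intro x hx
        have h5 : s₀ < Real.sinh (κ * (x + a)) := by
          rw [hs₀, Real.sinh_lt_sinh]
          have : 0 < κ * x := mul_pos hκ hx
          linarith
        have h6 : -(s₀ * (E x * E x) - E x * U x) = (Real.sinh (κ * (x + a)) - s₀) * (E x * E x) := by
          simp only [hU]; ring
        rw [h6]
        exact mul_pos (by linarith) (mul_pos (hE0 x) (hE0 x))
      have h7 : 0 < ∫ x in Ioi (0 : ℝ), -(s₀ * (E x * E x) - E x * U x) := by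
        rw [setIntegral_pos_iff_support_of_nonneg_ae]
        · have : Ioi (0 : ℝ) ⊆ Function.support (fun x => -(s₀ * (E x * E x) - E x * U x)) ∩ Ioi 0 :=
            fun x hx => ⟨(h4 x hx).ne', hx⟩
          refine lt_of_lt_of_le ?_ (measure_mono this)
          rw [Real.volume_Ioi]
          exact ENNReal.zero_lt_top
        · exact (ae_restrict_iff' measurableSet_Ioi).2 (.of_forall fun x hx => (h4 x hx).le)
        · exact ((i1.const_mul _).sub i2).neg
      rw [integral_neg] at h7
      linarith
    have hs : s₀ < 0 := by
      rw [hs₀, Real.sinh_neg_iff]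
      exact mul_neg_of_pos_of_neg hκ ha
    rw [h1, qE wr, qU wr, tr.trace_eq, h2]
    simp only [RCLike.ofReal_zero, mul_zero, sub_zero, zero_mul]
    rw [← RCLike.ofReal_mul, ← RCLike.ofReal_mul, RCLike.ofReal_re]
    have h8 : m ^ 2 - (m + κ) ^ 2 < 0 := by nlinarith
    exact mul_neg_of_neg_of_pos hs (mul_pos_of_neg_of_neg h8 h3)

end PoschlTeller

/-! ### Index bounds from boundary values and from test functions on the edges. -/

section Profile

open ComplexConjugate
open scoped BoundedContinuousFunction

variable {𝕜 : Type*} [RCLike 𝕜] {N : ℕ}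

/-- The test space spanned by two functions on every edge. -/
def modeMap {u u' r r' : Fin N → L2Half 𝕜} (hu : ∀ j, IsWeakDeriv (u j) (u' j))
    (hr : ∀ j, IsWeakDeriv (r j) (r' j)) : (Fin N → 𝕜) × (Fin N → 𝕜) →ₗ[𝕜] H1Graph 𝕜 N where
  toFun bc := ⟨(WithLp.toLp 2 fun j => bc.1 j • r j + bc.2 j • u j,
    WithLp.toLp 2 fun j => bc.1 j • r' j + bc.2 j • u' j),
    fun j => ((hr j).smul _).add ((hu j).smul _)⟩
  map_add' x y := by
    refine Subtype.ext (Prod.ext ?_ ?_) <;> ext j : 1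
    · change (x.1 j + y.1 j) • r j + (x.2 j + y.2 j) • u j =
        (x.1 j • r j + x.2 j • u j) + (y.1 j • r j + y.2 j • u j)
      module
    · change (x.1 j + y.1 j) • r' j + (x.2 j + y.2 j) • u' j =
        (x.1 j • r' j + x.2 j • u' j) + (y.1 j • r' j + y.2 j • u' j)
      module
  map_smul' c x := by
    refine Subtype.ext (Prod.ext ?_ ?_) <;> ext j : 1
    · change (c * x.1 j) • r j + (c * x.2 j) • u j = c • (x.1 j • r j + x.2 j • u j)
      module
    · change (c * x.1 j) • r' j + (c * x.2 j) • u' j = c • (x.1 j • r' j + x.2 j • u' j)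
      module

/-- A lower bound for the Morse index in terms of solutions `u` of the homogeneous equation and
functions `r` vanishing at the vertex, subject to the linear constraints `T`. -/
lemma le_morseIndex_of_modes {β ω : ℝ} (hβ : β ≠ 0) (hω : 0 < ω) {V : Fin N → ℝ →ᵇ ℝ}
    (hV : ∀ j, IntegrableOn (fun x => |V j x| * (1 + x)) (Ioi 0)) {u u' r r' : Fin N → L2Half 𝕜}
    (hu : ∀ j, IsWeakDeriv (u j) (u' j)) (hr : ∀ j, IsWeakDeriv (r j) (r' j)) {z δ : Fin N → ℝ}
    (tu : ∀ j, HasTrace (u j) (z j : 𝕜)) (tr : ∀ j, HasTrace (r j) 0)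
    (hδ : ∀ j (f g : L2Half 𝕜), IsWeakDeriv f g →
      edgeForm ω (V j) (u j) (u' j) f g = -(δ j : 𝕜) * trace f)
    {Z : Type*} [AddCommGroup Z] [Module 𝕜 Z] [FiniteDimensional 𝕜 Z]
    (T : (Fin N → 𝕜) × (Fin N → 𝕜) →ₗ[𝕜] Z)
    (hT : ∀ b c, T (b, c) = 0 → (b ≠ 0 ∨ c ≠ 0) →
      (∑ j, (‖b j‖ ^ 2 * RCLike.re (edgeForm ω (V j) (r j) (r' j) (r j) (r' j))
        - ‖c j‖ ^ 2 * (δ j * z j))) + β⁻¹ * ‖∑ j, c j * (z j : 𝕜)‖ ^ 2 < 0) :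
    ((2 * N - Module.finrank 𝕜 Z : ℕ) : ℕ∞) ≤
      morseIndex (schrodinger 𝕜 N β ω fun j x => V j x) := by
  have hdim : 2 * N - Module.finrank 𝕜 Z ≤ Module.finrank 𝕜 (LinearMap.ker T) := by
    have h1 := T.finrank_range_add_finrank_ker
    have h2 := (LinearMap.range T).finrank_le
    rw [Module.finrank_prod, Module.finrank_fin_fun] at h1
    omega
  refine le_trans (by exact_mod_cast hdim) (finrank_le_morseIndex_schrodinger hβ hω hV
    ((modeMap hu hr).comp (LinearMap.ker T).subtype) ?_)
  rintro ⟨⟨b, c⟩, hbc⟩ hne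
  have hne' : b ≠ 0 ∨ c ≠ 0 := by
    by_contra h
    push Not at h
    exact hne (Subtype.ext (Prod.ext h.1 h.2))
  have key := hT b c (LinearMap.mem_ker.1 hbc) hne'
  set w := modeMap hu hr (b, c) with hw
  have htw : ∀ j, trace (w.1.1 j) = c j * z j := fun j => by
    have h := (((tr j).smul (b j)).add ((tu j).smul (c j))).trace_eq
    rwa [mul_zero, zero_add] at h
  -- There are no cross terms: pairing the zero mode with any function leaves only a multiple of its
  -- trace, and `r j` has trace zero.
  have hedge : ∀ j, RCLike.re (edgeForm ω (V j) (w.1.1 j) (w.1.2 j) (w.1.1 j) (w.1.2 j)) =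
      ‖b j‖ ^ 2 * RCLike.re (edgeForm ω (V j) (r j) (r' j) (r j) (r' j))
        - ‖c j‖ ^ 2 * (δ j * z j) := by
    intro j
    have h1 : ∀ f g, edgeForm ω (V j) (w.1.1 j) (w.1.2 j) f g =
        conj (b j) * edgeForm ω (V j) (r j) (r' j) f g +
        conj (c j) * edgeForm ω (V j) (u j) (u' j) f g :=
      fun f g => edgeForm_smul_add_smul_left ω (V j) (b j) (c j) (r j) (r' j) (u j) (u' j) f g
    have h2 : edgeForm ω (V j) (r j) (r' j) (w.1.1 j) (w.1.2 j) =
        b j * edgeForm ω (V j) (r j) (r' j) (r j) (r' j) := by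
      rw [← conj_edgeForm, h1, hδ j _ _ (hr j), (tr j).trace_eq, mul_zero, mul_zero, add_zero,
        map_mul, RCLike.conj_conj, conj_edgeForm]
    rw [h1, h2, hδ j _ _ (w.2 j), htw]
    have h3 : conj (b j) * (b j * edgeForm ω (V j) (r j) (r' j) (r j) (r' j)) +
        conj (c j) * (-(δ j : 𝕜) * (c j * z j)) =
        ((‖b j‖ ^ 2 : ℝ) : 𝕜) * edgeForm ω (V j) (r j) (r' j) (r j) (r' j) -
        ((‖c j‖ ^ 2 * (δ j * z j) : ℝ) : 𝕜) := by
      rw [RCLike.ofReal_pow, ← RCLike.conj_mul, RCLike.ofReal_mul, RCLike.ofReal_pow,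
        ← RCLike.conj_mul, RCLike.ofReal_mul]
      ring
    rw [h3, map_sub, RCLike.re_ofReal_mul, RCLike.ofReal_re]
  change RCLike.re (graphForm β ω V w w) < 0
  rw [graphForm_apply, map_add, map_sum, RCLike.re_ofReal_mul, RCLike.conj_mul,
    ← RCLike.ofReal_pow, RCLike.ofReal_re, Finset.sum_congr rfl fun j _ => hedge j, traceSum_apply,
    Finset.sum_congr rfl fun j _ => htw j]
  exact key

/-- The energy of `-Δ_β + ω - φ^{p-1}` is bounded below by its boundary terms. -/
lemma re_graphForm_sechSq_ge (β m κ : ℝ) (a : Fin N → ℝ) (u : H1Graph 𝕜 N) :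
    (∑ j, m * Real.tanh (κ * a j) * ‖trace (u.1.1 j)‖ ^ 2) + β⁻¹ * ‖traceSum u‖ ^ 2 ≤
      RCLike.re (graphForm β (m ^ 2) (fun j => sechSq (m * (m + κ)) κ (a j)) u u) := by
  rw [re_graphForm_self]
  refine add_le_add_left (Finset.sum_le_sum fun j _ => ?_) _
  have h := (u.2 j).riccati_bound (u.2 j).hasTrace_trace (contDiff_scaledTanh (-m) κ (a j))
    (hasDerivAt_scaledTanh (-m) κ (a j)) (riccati_scaledTanh m κ (a j))
  rw [scaledTanh_apply, zero_add] at h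
  linarith

/-- The boundary value as a linear map on the domain. -/
def domainTrace {β ω : ℝ} (hβ : β ≠ 0) (V : Fin N → ℝ →ᵇ ℝ) (j : Fin N) :
    (schrodinger 𝕜 N β ω fun j x => V j x).domain →ₗ[𝕜] 𝕜 :=
  have key : ∀ v : (schrodinger 𝕜 N β ω fun j x => V j x).domain,
      HasTrace ((v : L2Graph 𝕜 N) j) (trace ((v : L2Graph 𝕜 N) j)) := fun v => by
    obtain ⟨u, hu, -⟩ := exists_inner_eq_graphForm hβ (LinearPMap.mem_graph _ v)
    rw [← hu]
    exact (u.2 j).hasTrace_trace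
  { toFun := fun v => trace ((v : L2Graph 𝕜 N) j)
    map_add' := fun v w => ((key v).add (key w)).trace_eq
    map_smul' := fun c v => ((key v).smul c).trace_eq }

lemma domainTrace_apply {β ω : ℝ} (hβ : β ≠ 0) (V : Fin N → ℝ →ᵇ ℝ) (j : Fin N)
    (v : (schrodinger 𝕜 N β ω fun j x => V j x).domain) :
    domainTrace hβ V j v = trace ((v : L2Graph 𝕜 N) j) := rfl

lemma sum_fin_ite_lt {k N : ℕ} (hk : k ≤ N) (x y : ℝ) :
    ∑ j : Fin N, (if (j : ℕ) < k then x else y) = k * x + (N - k) * y := by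
  obtain ⟨l, rfl⟩ := Nat.exists_eq_add_of_le hk
  rw [Fin.sum_univ_add]
  simp

/-- The operator with potential `m (m + κ) sech²` is nonnegative if the boundary coefficients
satisfy `∑ τ_j⁻¹ ≤ -β m`. -/
lemma isNonneg_schrodinger_sechSq {β m κ : ℝ} (hβ : β < 0) {a : Fin N → ℝ}
    {τ : Fin N → ℝ} (hτ : ∀ j, 0 < τ j) (ha : ∀ j, Real.tanh (κ * a j) = τ j)
    (hs : ∑ j, (τ j)⁻¹ = -β * m) :
    IsNonneg (schrodinger 𝕜 N β (m ^ 2) fun j x => sechSq (m * (m + κ)) κ (a j) x) := by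
  intro v
  obtain ⟨u, hu, h⟩ := exists_inner_eq_graphForm (V := fun j => sechSq (m * (m + κ)) κ (a j)) hβ.ne
    (LinearPMap.mem_graph _ v)
  have h1 := h u
  rw [hu] at h1
  rw [h1]
  refine le_trans ?_ (re_graphForm_sechSq_ge β m κ a u)
  -- Cauchy-Schwarz with weights `(τ j)⁻¹` and `τ j`. The total weight `-β * m` is exactly what
  -- balances the factor `β⁻¹` of the vertex term.
  have h2 : ‖traceSum u‖ ^ 2 ≤ (∑ j, (τ j)⁻¹) * ∑ j, τ j * ‖trace (u.1.1 j)‖ ^ 2 := by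
    rw [traceSum_apply]
    refine (pow_le_pow_left₀ (norm_nonneg _) (norm_sum_le _ _) 2).trans ?_
    refine Finset.sum_sq_le_sum_mul_sum_of_sq_le_mul _ (fun j _ => by have := hτ j; positivity)
      (fun j _ => by have := hτ j; positivity) fun j _ => ?_
    exact (by rw [← mul_assoc, inv_mul_cancel₀ (hτ j).ne', one_mul] : _ = _).le
  rw [hs] at h2
  have h3 : ∑ j, m * Real.tanh (κ * a j) * ‖trace (u.1.1 j)‖ ^ 2 =
      m * ∑ j, τ j * ‖trace (u.1.1 j)‖ ^ 2 := by
    rw [Finset.mul_sum]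
    exact Finset.sum_congr rfl fun j _ => by rw [ha, mul_assoc]
  rw [h3]
  have h4 := mul_le_mul_of_nonpos_left h2 (inv_lt_zero.2 hβ).le
  have h5 : β⁻¹ * (-β * m * ∑ j, τ j * ‖trace (u.1.1 j)‖ ^ 2) =
      -(m * ∑ j, τ j * ‖trace (u.1.1 j)‖ ^ 2) := by
    field_simp [hβ.ne]
  linarith

/-- The operator with potential `m (m + κ) sech²` is nonnegative on a space of codimension `M`. -/
lemma morseIndex_schrodinger_sechSq_le {M : ℕ} {β m κ : ℝ} (hβ : 0 < β)
    {a τ : Fin (M + 1) → ℝ} (hτ : ∀ j, 0 < τ j) (ha : ∀ j, Real.tanh (κ * a j) = -τ j)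
    (hs : ∑ j, (τ j)⁻¹ = β * m) :
    morseIndex (schrodinger 𝕜 (M + 1) β (m ^ 2) fun j x => sechSq (m * (m + κ)) κ (a j) x) ≤ M := by
  set V : Fin (M + 1) → ℝ →ᵇ ℝ := fun j => sechSq (m * (m + κ)) κ (a j) with hV
  -- The `M` conditions say that all `τ j * v_j(0)` agree. For such boundary values the negative
  -- edge terms `-m τ j |v_j(0)|²` and the positive vertex term cancel exactly.
  refine morseIndex_le (schrodinger_symmetric (V := V) hβ.ne')
    (LinearMap.pi fun i : Fin M => (τ i.succ : 𝕜) • domainTrace hβ.ne' V i.succ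
      - (τ 0 : 𝕜) • domainTrace hβ.ne' V 0) fun v hv => ?_
  obtain ⟨u, hu, h⟩ := exists_inner_eq_graphForm (V := V) hβ.ne' (LinearPMap.mem_graph _ v)
  have h1 := h u
  rw [hu] at h1
  rw [h1]
  refine le_trans (le_of_eq ?_) (re_graphForm_sechSq_ge β m κ a u)
  set c : 𝕜 := (τ 0 : 𝕜) * trace (u.1.1 0) with hc
  have hz : ∀ j, trace (u.1.1 j) = ((τ j)⁻¹ : ℝ) * c := by
    intro j
    have hj : (τ j : 𝕜) * trace (u.1.1 j) = c := by
      induction j using Fin.cases with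
      | zero => rfl
      | succ i =>
        have := congrFun hv i
        simp only [LinearMap.pi_apply, LinearMap.sub_apply, LinearMap.smul_apply,
          domainTrace_apply, smul_eq_mul, Pi.zero_apply, sub_eq_zero, ← hu] at this
        exact this
    rw [← hj, ← mul_assoc, ← RCLike.ofReal_mul, inv_mul_cancel₀ (hτ j).ne', RCLike.ofReal_one,
      one_mul]
  clear_value c
  have h2 : traceSum u = ((β * m : ℝ) : 𝕜) * c := by
    rw [traceSum_apply, Finset.sum_congr rfl fun j _ => hz j, ← Finset.sum_mul, ← hs,
      RCLike.ofReal_sum]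
  have h3 : ∑ j, m * Real.tanh (κ * a j) * ‖trace (u.1.1 j)‖ ^ 2 = -(m * (β * m) * ‖c‖ ^ 2) := by
    rw [← hs, Finset.mul_sum, Finset.sum_mul, ← Finset.sum_neg_distrib]
    refine Finset.sum_congr rfl fun j _ => ?_
    have := (hτ j).ne'
    rw [ha, hz, norm_mul, RCLike.norm_ofReal, mul_pow, sq_abs]
    field_simp
  rw [h3, h2, norm_mul, RCLike.norm_ofReal, mul_pow, sq_abs]
  field_simp
  ring

/-- The sign of the energy of the homogeneous solution of `exists_edge_modes`. -/
lemma mode_energy_eq {m κ a t : ℝ} (ht : Real.tanh (κ * a) = t) :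
    (-m * Real.cosh (κ * a) + (m + κ) / Real.cosh (κ * a)) * sechPow m κ a 0 *
      (Real.sinh (κ * a) * sechPow m κ a 0) =
      sechPow m κ a 0 ^ 2 * Real.cosh (κ * a) ^ 2 * (t * ((m + κ) * (1 - t ^ 2) - m)) := by
  have hc := (Real.cosh_pos (κ * a)).ne'
  have h3 := Real.cosh_sq (κ * a)
  rw [← ht, Real.tanh_eq_sinh_div_cosh]
  have h1 : 1 - (Real.sinh (κ * a) / Real.cosh (κ * a)) ^ 2 = 1 / Real.cosh (κ * a) ^ 2 := by
    field_simp
    linarith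
  rw [h1]
  field_simp
  ring

/-- The Morse index of the operator with potential `(m + κ) (m + 2 κ) sech²` is bounded below by the
codimension of linear constraints that make a diagonal form with explicit signs negative. -/
lemma exists_schrodinger_sechSq_modes.{u} (𝕜 : Type u) [RCLike 𝕜] {N : ℕ} {β m κ : ℝ} (hβ : β ≠ 0)
    (hm : 0 < m) (hκ : 0 < κ) {a t : Fin N → ℝ} (ht : ∀ j, Real.tanh (κ * a j) = t j) :
    ∃ (R D z : Fin N → ℝ), (∀ j, a j < 0 → R j < 0) ∧
      (∀ j, 0 < t j * ((m + κ) * (1 - t j ^ 2) - m) → 0 < D j) ∧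
      ∀ (Z : Type u) [AddCommGroup Z] [Module 𝕜 Z] [FiniteDimensional 𝕜 Z]
        (T : (Fin N → 𝕜) × (Fin N → 𝕜) →ₗ[𝕜] Z),
        (∀ b c, T (b, c) = 0 → (b ≠ 0 ∨ c ≠ 0) →
          (∑ j, (‖b j‖ ^ 2 * R j - ‖c j‖ ^ 2 * D j)) + β⁻¹ * ‖∑ j, c j * (z j : 𝕜)‖ ^ 2 < 0) →
        ((2 * N - Module.finrank 𝕜 Z : ℕ) : ℕ∞) ≤ morseIndex (schrodinger 𝕜 N β (m ^ 2)
          fun j x => sechSq ((m + κ) * (m + 2 * κ)) κ (a j) x) := by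
  choose u u' r r' hu hr tu tr hδ hR using fun j => exists_edge_modes 𝕜 (a := a j) hm hκ
  -- `D j` is the product of the derivative and the value of the zero mode at the vertex.
  refine ⟨_, fun j => _ * _, _, hR, fun j hj => ?_, fun Z _ _ _ T hT =>
    le_morseIndex_of_modes hβ (by positivity) (fun j => integrableOn_sechSq_mul hκ) hu hr tu tr hδ T hT⟩
  beta_reduce
  rw [mode_energy_eq (ht j)]
  have := sechPow_pos m κ (a j) 0
  have := Real.cosh_pos (κ * a j)
  positivity

end Profile

/-! ### The parameters of the profile. -/

section Parameters

variable {N k : ℕ} {p ω β t₁ tN : ℝ}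

/-- The two parameters lie on either side of the critical point of `t^{p-1} - t^{p+1}`. -/
lemma IsProfileParam.sq_lt_and_lt_sq (ht : IsProfileParam N k p ω β t₁ tN) (hp : 1 < p) :
    t₁ ^ 2 < (p - 1) / (p + 1) ∧ (p - 1) / (p + 1) < tN ^ 2 := by
  have h0 := ht.pos
  have hd : ∀ t : ℝ, 0 < t → HasDerivAt (fun t : ℝ => t ^ (p - 1) - t ^ (p + 1))
      ((p - 1) * t ^ (p - 1 - 1) - (p + 1) * t ^ (p + 1 - 1)) t := fun t h =>
    (Real.hasDerivAt_rpow_const (Or.inl h.ne')).sub (Real.hasDerivAt_rpow_const (Or.inl h.ne'))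
  -- Rolle's theorem between `t₁` and `tN`; the derivative is `t ^ (p - 2) * ((p - 1) - (p + 1)
  -- t²)`, so `c² = (p - 1) / (p + 1)`.
  obtain ⟨c, hc, h⟩ := exists_hasDerivAt_eq_zero ht.lt
    (fun t h => (hd t (h0.trans_le h.1)).continuousAt.continuousWithinAt) ht.eq
    fun t h => hd t (h0.trans h.1)
  have hc0 : 0 < c := h0.trans hc.1
  have h1 : c ^ (p + 1 - 1) = c ^ (p - 1 - 1) * c ^ 2 := by
    rw [← Real.rpow_natCast, ← Real.rpow_add hc0]
    congr 1
    push_cast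
    ring
  have h2 : (p - 1) / (p + 1) = c ^ 2 := by
    have h3 := (Real.rpow_pos_of_pos hc0 (p - 1 - 1)).ne'
    rw [div_eq_iff (by linarith)]
    refine mul_left_cancel₀ h3 ?_
    rw [h1] at h
    linarith
  rw [h2]
  exact ⟨pow_lt_pow_left₀ hc.1 h0.le two_ne_zero, pow_lt_pow_left₀ hc.2 hc0.le two_ne_zero⟩

/-- The parameter of the `j`-th entry of the profile. -/
def edgeParam (k : ℕ) (t₁ tN : ℝ) (j : Fin N) : ℝ := if (j : ℕ) < k then t₁ else tN

lemma IsProfileParam.edgeParam_mem (ht : IsProfileParam N k p ω β t₁ tN) (j : Fin N) :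
    edgeParam k t₁ tN j ∈ Ioo 0 1 := by
  have h1 := ht.pos
  have h2 := ht.lt
  have h3 := ht.lt_one
  unfold edgeParam
  split_ifs
  · exact ⟨h1, by linarith⟩
  · exact ⟨by linarith, h3⟩

lemma IsProfileParam.sum_inv_edgeParam (ht : IsProfileParam N k p ω β t₁ tN) (hk : k ≤ N) :
    ∑ j : Fin N, (edgeParam k t₁ tN j)⁻¹ = |β| * √ω := by
  rw [← ht.sum, ← sum_fin_ite_lt hk]
  exact Finset.sum_congr rfl fun j _ => apply_ite _ _ _ _

lemma tanh_mul_shift {t : ℝ} (hp : 1 < p) (hω : 0 < ω) (ht : t ∈ Ioo 0 1) :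
    Real.tanh ((p - 1) * √ω / 2 * shift p ω β t) = -Real.sign β * t := by
  have h1 : (p - 1) * √ω / 2 * shift p ω β t = -Real.sign β * Real.artanh t := by
    have := (Real.sqrt_pos.2 hω).ne'
    have : p - 1 ≠ 0 := by linarith
    unfold shift
    field_simp
  have h2 : Real.tanh (Real.artanh t) = t := Real.tanh_artanh ⟨by linarith [ht.1], ht.2⟩
  rw [h1]
  rcases Real.sign_apply_eq β with h | h | h <;> rw [h] <;> simp [h2]

lemma shift_neg {t : ℝ} (hp : 1 < p) (hω : 0 < ω) (hβ : 0 < β) (ht : t ∈ Ioo 0 1) :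
    shift p ω β t < 0 := by
  have h1 := Real.sqrt_pos.2 hω
  have h2 : 0 < p - 1 := by linarith
  have h3 := Real.artanh_pos ht
  unfold shift
  rw [Real.sign_of_pos hβ, neg_one_mul, neg_lt_zero]
  positivity

lemma soliton_rpow (hp : 1 < p) (hω : 0 < ω) (a x : ℝ) :
    soliton p ω a x ^ (p - 1) =
      (p + 1) * ω / 2 * (1 / Real.cosh ((p - 1) * √ω / 2 * (x + a))) ^ 2 := by
  unfold soliton
  have := Real.cosh_pos ((p - 1) * √ω / 2 * (x + a))
  have : 0 < p + 1 := by linarith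
  rw [one_div (p - 1), Real.rpow_inv_rpow (by positivity) (by linarith)]

/-- With `m = √ω` and `κ = (p - 1) √ω / 2` the amplitude `(p + 1) ω / 2` factors as `m (m + κ)`, the
form required by the Riccati equation. -/
lemma profile_rpow (hp : 1 < p) (hω : 0 < ω) (j : Fin N) (x : ℝ) :
    profile N k p ω β t₁ tN j x ^ (p - 1) = sechSq (√ω * (√ω + (p - 1) * √ω / 2))
      ((p - 1) * √ω / 2) (shift p ω β (edgeParam k t₁ tN j)) x := by
  have h : profile N k p ω β t₁ tN j x = soliton p ω (shift p ω β (edgeParam k t₁ tN j)) x := by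
    unfold profile edgeParam
    split_ifs <;> rfl
  have h1 := Real.mul_self_sqrt hω.le
  rw [h, soliton_rpow hp hω, sechSq_apply]
  congr 1
  linear_combination (-(p + 1) / 2) * h1

lemma opL₂_profile (𝕜 : Type*) [RCLike 𝕜] (hp : 1 < p) (hω : 0 < ω) :
    opL₂ 𝕜 N p ω β (profile N k p ω β t₁ tN) =
      schrodinger 𝕜 N β (√ω ^ 2) fun j x => sechSq (√ω * (√ω + (p - 1) * √ω / 2))
        ((p - 1) * √ω / 2) (shift p ω β (edgeParam k t₁ tN j)) x := by
  unfold opL₂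
  rw [Real.sq_sqrt hω.le]
  simp_rw [profile_rpow hp hω]

/-- Since `p m = m + 2 κ`, multiplying the amplitude by `p` gives `(m + κ) (m + 2 κ)`, for which the
derivative of the soliton is a zero mode. -/
lemma opL₁_profile (𝕜 : Type*) [RCLike 𝕜] (hp : 1 < p) (hω : 0 < ω) :
    opL₁ 𝕜 N p ω β (profile N k p ω β t₁ tN) =
      schrodinger 𝕜 N β (√ω ^ 2) fun j x =>
        sechSq ((√ω + (p - 1) * √ω / 2) * (√ω + 2 * ((p - 1) * √ω / 2)))
          ((p - 1) * √ω / 2) (shift p ω β (edgeParam k t₁ tN j)) x := by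
  unfold opL₁
  rw [Real.sq_sqrt hω.le]
  congr 1
  ext j x
  rw [profile_rpow hp hω, sechSq_apply, sechSq_apply]
  ring

/-- The expression equals `√ω / 2 * ((p - 1) - (p + 1) t²)`, which changes sign at the critical
point separating `t₁` from `tN`. -/
lemma IsProfileParam.mode_sign (ht : IsProfileParam N k p ω β t₁ tN) (hp : 1 < p) (hω : 0 < ω)
    (j : Fin N) :
    ((j : ℕ) < k → 0 < (√ω + (p - 1) * √ω / 2) * (1 - edgeParam k t₁ tN j ^ 2) - √ω) ∧
      (k ≤ (j : ℕ) → (√ω + (p - 1) * √ω / 2) * (1 - edgeParam k t₁ tN j ^ 2) - √ω < 0) := by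
  obtain ⟨h1, h2⟩ := ht.sq_lt_and_lt_sq hp
  have hm := Real.sqrt_pos.2 hω
  have hp' : 0 < p + 1 := by linarith
  rw [lt_div_iff₀ hp'] at h1
  rw [div_lt_iff₀ hp'] at h2
  have e : ∀ t : ℝ, (√ω + (p - 1) * √ω / 2) * (1 - t ^ 2) - √ω =
      √ω / 2 * ((p - 1) - t ^ 2 * (p + 1)) := fun t => by ring
  rw [e]
  unfold edgeParam
  constructor <;> intro hj
  · rw [if_pos hj]
    exact mul_pos (by positivity) (by linarith)
  · rw [if_neg (by omega)]
    exact mul_neg_of_pos_of_neg (by positivity) (by linarith)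

end Parameters

/-! ### Counting negative directions of `L₁`. -/

section Index

variable (𝕜 : Type*) [RCLike 𝕜] {N k : ℕ} {p ω β t₁ tN : ℝ}

/-- For `β > 0` every shift is negative, so all `N` functions `r_j` have negative energy. The zero
modes with `t = -tN` do too, apart from the positive vertex term. Excluding the first `k` zero modes
and making the sum of the boundary values vanish costs `k + 1` of the `2 N` dimensions. -/
lemma le_morseIndex_opL₁_of_pos (hk : k ≤ N) (hp : 1 < p) (hω : 0 < ω) (hβ : 0 < β)
    (ht : IsProfileParam N k p ω β t₁ tN) :
    ((2 * N - (k + 1) : ℕ) : ℕ∞) ≤ morseIndex (opL₁ 𝕜 N p ω β (profile N k p ω β t₁ tN)) := by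
  have hm := Real.sqrt_pos.2 hω
  have hp' : 0 < p - 1 := by linarith
  obtain ⟨R, D, z, hR, hD, h⟩ := exists_schrodinger_sechSq_modes 𝕜 (N := N) hβ.ne' hm
    (by positivity : 0 < (p - 1) * √ω / 2)
    fun j => tanh_mul_shift (β := β) hp hω (ht.edgeParam_mem j)
  rw [opL₁_profile 𝕜 hp hω]
  have hR' : ∀ j, R j < 0 := fun j => hR j (shift_neg hp hω hβ (ht.edgeParam_mem j))
  have hD' : ∀ j : Fin N, k ≤ (j : ℕ) → 0 < D j := fun j hj => by
    refine hD j ?_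
    rw [Real.sign_of_pos hβ, neg_one_mul, neg_sq]
    exact mul_pos_of_neg_of_neg (neg_lt_zero.2 (ht.edgeParam_mem j).1)
      ((ht.mode_sign hp hω j).2 hj)
  have key := h ((Fin k → 𝕜) × 𝕜)
    (((LinearMap.funLeft 𝕜 𝕜 (Fin.castLE hk)).prod
      (∑ j, (z j : 𝕜) • LinearMap.proj j)).comp (LinearMap.snd 𝕜 _ _)) ?_
  · rwa [Module.finrank_prod, Module.finrank_fin_fun, Module.finrank_self] at key
  intro b c hbc hne
  have hc : ∀ j : Fin N, (j : ℕ) < k → c j = 0 := fun j hj =>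
    congrFun (congrArg Prod.fst hbc) (⟨j, hj⟩ : Fin k)
  have hz : ∑ j, c j * (z j : 𝕜) = 0 := by
    have h2 : (∑ j, (z j : 𝕜) • LinearMap.proj (R := 𝕜) (φ := fun _ : Fin N => 𝕜) j) c = 0 :=
      congrArg Prod.snd hbc
    rw [LinearMap.sum_apply] at h2
    rw [← h2]
    exact Finset.sum_congr rfl fun j _ => mul_comm _ _
  rw [hz, norm_zero, zero_pow two_ne_zero, mul_zero, add_zero]
  have hb1 : ∀ j, ‖b j‖ ^ 2 * R j ≤ 0 := fun j =>
    mul_nonpos_of_nonneg_of_nonpos (by positivity) (hR' j).le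
  have hc1 : ∀ j, 0 ≤ ‖c j‖ ^ 2 * D j := fun j => by
    rcases lt_or_ge (j : ℕ) k with hj | hj
    · simp [hc j hj]
    · have := hD' j hj
      positivity
  refine Finset.sum_neg' (fun j _ => by linarith [hb1 j, hc1 j]) ?_
  rcases hne with hne | hne <;> obtain ⟨j, hj⟩ := Function.ne_iff.1 hne <;>
    refine ⟨j, Finset.mem_univ j, ?_⟩ <;> have hj' := norm_pos_iff.2 hj
  · have := mul_neg_of_pos_of_neg (pow_pos hj' 2) (hR' j)
    linarith [hc1 j]
  · have hjk : k ≤ (j : ℕ) := not_lt.1 fun hlt => hj (hc j hlt)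
    have := mul_pos (pow_pos hj' 2) (hD' j hjk)
    linarith [hb1 j]

/-- For `β < 0` the vertex term is nonpositive and needs no constraint. All `r_j` and the last `N -
k` zero modes are discarded, and the `k` zero modes with parameter `t₁` remain. -/
lemma le_morseIndex_opL₁_of_neg (hk : k ≤ N) (hp : 1 < p) (hω : 0 < ω) (hβ : β < 0)
    (ht : IsProfileParam N k p ω β t₁ tN) :
    (k : ℕ∞) ≤ morseIndex (opL₁ 𝕜 N p ω β (profile N k p ω β t₁ tN)) := by
  have hm := Real.sqrt_pos.2 hω
  have hp' : 0 < p - 1 := by linarith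
  obtain ⟨R, D, z, -, hD, h⟩ := exists_schrodinger_sechSq_modes 𝕜 (N := N) hβ.ne hm
    (by positivity : 0 < (p - 1) * √ω / 2)
    fun j => tanh_mul_shift (β := β) hp hω (ht.edgeParam_mem j)
  rw [opL₁_profile 𝕜 hp hω]
  have hD' : ∀ j : Fin N, (j : ℕ) < k → 0 < D j := fun j hj => by
    refine hD j ?_
    rw [Real.sign_of_neg hβ, neg_neg, one_mul]
    exact mul_pos (ht.edgeParam_mem j).1 ((ht.mode_sign hp hω j).1 hj)
  have key := h ((Fin N → 𝕜) × (Fin (N - k) → 𝕜))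
    (LinearMap.prodMap LinearMap.id (LinearMap.funLeft 𝕜 𝕜 fun i : Fin (N - k) =>
      (⟨k + i, by omega⟩ : Fin N))) ?_
  · rw [Module.finrank_prod, Module.finrank_fin_fun, Module.finrank_fin_fun] at key
    rwa [show 2 * N - (N + (N - k)) = k by omega] at key
  intro b c hbc hne
  have hb : b = 0 := congrArg Prod.fst hbc
  have hc : ∀ j : Fin N, k ≤ (j : ℕ) → c j = 0 := fun j hj => by
    have h2 : c ⟨k + (j - k), _⟩ = 0 := congrFun (congrArg Prod.snd hbc) ⟨j - k, by omega⟩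
    simpa only [Nat.add_sub_cancel' hj] using h2
  have hc1 : ∀ j, 0 ≤ ‖c j‖ ^ 2 * D j := fun j => by
    rcases lt_or_ge (j : ℕ) k with hj | hj
    · have := hD' j hj
      positivity
    · simp [hc j hj]
  subst hb
  refine add_neg_of_neg_of_nonpos (Finset.sum_neg' (fun j _ => ?_) ?_)
    (mul_nonpos_of_nonpos_of_nonneg (inv_lt_zero.2 hβ).le (sq_nonneg _))
  · simpa using hc1 j
  · obtain ⟨j, hj⟩ := Function.ne_iff.1 (hne.resolve_left fun h => h rfl)
    refine ⟨j, Finset.mem_univ j, ?_⟩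
    have := mul_pos (pow_pos (norm_pos_iff.2 hj) 2)
      (hD' j (not_le.1 fun hle => hj (hc j hle)))
    simpa using this

end Index

end StarGraph

end

open StarGraph in
/-- The natural subtractions are exact, since `1 ≤ k ≤ N - 1` gives `2 N - k ≥ 3`. -/
theorem proposition5p18 {𝕜 : Type*} [RCLike 𝕜] (N k : ℕ) (p ω β t₁ tN : ℝ)
    (hN : 2 ≤ N) (hk : 1 ≤ k) (hkN : k ≤ N - 1) (hp : 1 < p) (hβ : β ≠ 0)
    (hω : (p + 1) / (p - 1) * ((N : ℝ) ^ 2 / β ^ 2) < ω)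
    (ht : IsProfileParam N k p ω β t₁ tN) :
    (0 < β →
      morseIndex (opL₂ 𝕜 N p ω β (profile N k p ω β t₁ tN)) ≤ ((N - 1 : ℕ) : ℕ∞) ∧
      ((2 * N - k - 3 : ℕ) : ℕ∞) ≤ morseIndex (opL₁ 𝕜 N p ω β (profile N k p ω β t₁ tN))) ∧
    (β < 0 →
      IsNonneg (opL₂ 𝕜 N p ω β (profile N k p ω β t₁ tN)) ∧
      (k : ℕ∞) ≤ morseIndex (opL₁ 𝕜 N p ω β (profile N k p ω β t₁ tN))) := by
  have hp' : 0 < p - 1 := by linarith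
  have hω' : 0 < ω := lt_of_le_of_lt (by positivity) hω
  have hkN' : k ≤ N := by omega
  have hsum := ht.sum_inv_edgeParam hkN'
  refine ⟨fun hβ' => ⟨?_, le_trans ?_ (le_morseIndex_opL₁_of_pos 𝕜 hkN' hp hω' hβ' ht)⟩,
    fun hβ' => ⟨?_, le_morseIndex_opL₁_of_neg 𝕜 hkN' hp hω' hβ' ht⟩⟩
  · obtain ⟨M, rfl⟩ : ∃ M, N = M + 1 := ⟨N - 1, by omega⟩
    rw [opL₂_profile 𝕜 hp hω', Nat.add_sub_cancel]
    refine morseIndex_schrodinger_sechSq_le hβ' (fun j => (ht.edgeParam_mem j).1) (fun j => ?_)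
      (by rw [hsum, abs_of_pos hβ'])
    rw [tanh_mul_shift hp hω' (ht.edgeParam_mem j), Real.sign_of_pos hβ', neg_one_mul]
  -- The test space has dimension `2 N - k - 1`, two more than the claim needs.
  · exact_mod_cast (by omega : 2 * N - k - 3 ≤ 2 * N - (k + 1))
  · rw [opL₂_profile 𝕜 hp hω']
    refine isNonneg_schrodinger_sechSq hβ' (fun j => (ht.edgeParam_mem j).1) (fun j => ?_)
      (by rw [hsum, abs_of_neg hβ'])
    rw [tanh_mul_shift hp hω' (ht.edgeParam_mem j), Real.sign_of_neg hβ', neg_neg, one_mul]
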